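/- Let $n\ge 1$ and let $E$ be an elliptic curve with basis $x,y$ of $H^1(E;\mathbb Q)$. Let $E_2^{\bullet,\bullet}(M(A_n))$ be the second page of the Leray spectral sequence of the inclusion $C(n,E)\hookrightarrow E^n$ of the configuration space of $n$ ordered points (complement of the divisors $P_i=P_j$), in its combinatorial (Kriz) form: the graded-commutative $\mathbb Q$-algebra generated by anticommuting elements $x_i,y_i$ ($1\le i\le n$) of bidegree $(1,0)$ and $\omega_{i,j}=\omega_{j,i}$ ($i\ne j$) of bidegree $(0,1)$, with relations $x_i\omega_{i,j}=x_j\omega_{i,j}$, $y_i\omega_{i,j}=y_j\omega_{i,j}$ and $\omega_{i,j}\omega_{j,k}+\omega_{j,k}\omega_{k,i}+\omega_{k,i}\omega_{i,j}=0$. The group $\mathfrak S_n\times SL_2(\mathbb Q)$ acts by algebra automorphisms: $\mathfrak S_n$ permutes the indices and $SL_2(\mathbb Q)$ acts on each span $\langle x_i,y_i\rangle$ by the standard representation and fixes the $\omega_{i,j}$. Let $\mathbb V_a=\mathrm{Sym}^a(\mathbb Q^2)$. A labelled partition $(\lambda,s)$ of $n$ is a partition $\lambda\vdash n$ with a label $s(i)\in\{1,x,y,xy\}$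 on each block, and a weighted partition $(\lambda,t)$ has weights $t(i)\in\{0,1,2\}$ instead, both up to permuting blocks of the same size; $\deg$ is the degree in $H^\bullet(E)$. Let $E(\lambda,s)\subset E_2$ be the span of the products $\omega_{F,s}=\prod_{r}s(r)_r\cdot\prod_{(i,j)\in F}\omega_{i,j}$ over all forests $F$ on $\{1,\dots,n\}$ with labelled trees (with $r$ running over the roots, i.e. the greatest vertices of the trees, and $1_r=1$, $(xy)_r=x_ry_r$) whose tree sizes and labels are $(\lambda,s)$. It is $\mathfrak S_n$-stable. For $a\in\mathbb Z$ put $$E(\lambda,t,a)=\bigoplus_{\deg\circ s=t,\ |s^{-1}(x)|-|s^{-1}(y)|=a}E(\lambda,s).$$ Let $\sigma\in\mathfrak S_n$ have cycles of lengths $\lambda_i$ labelled by $s$, let $H(\lambda)\cong\prod_i\mathbb Z/\lambda_i$ be the subgroup generated by the cycles of $\sigma$, let $N(\lambda,s)$ be the product of the symmetric groups exchanging (compatibly with a choice of base points in the cycles) the cycles of $\sigma$ with the same length and the same label, and let $Z(\lambda,s)=H(\lambda)\rtimes N(\lambda,s)$. Fix for each $k$ a faithful character $\zeta_k:\mathbb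 Z/k\to\mathbb C^*$. Let $\xi(\lambda,s)$ be the one-dimensional complex character of $Z(\lambda,s)$ that is $\prod_i\zeta_{\lambda_i}$ on $H(\lambda)$ and $\operatorname{sgn}^{\deg s+1}$ on each factor of $N(\lambda,s)$ permuting cycles of a given length with a given label $s$. 1. For every weighted partition $(\lambda,t)$ of $n$ and every $a\ge0$, the virtual representation $E(\lambda,t,a)\ominus E(\lambda,t,a+2)$ is an actual $\mathbb Q[\mathfrak S_n]$-module, and for all $p,q\ge 0$ there is an isomorphism of representations of $\mathfrak S_n\times SL_2(\mathbb Q)$ over $\mathbb Q$ $$E_2^{p,q}(M(A_n))\cong\bigoplus_{\substack{0\le a\le p\\ |\lambda|=n-q\\ \sum_i t(i)=p}}\bigl(E(\lambda,t,a)\ominus E(\lambda,t,a+2)\bigr)\boxtimes\mathbb V_a ,$$ where $|\lambda|$ is the number of blocks of $\lambda$. 2. For every weighted partition $(\lambda,t)$ of $n$ and every $a\in\mathbb Z$, as complex representations of $\mathfrak S_n$, $$\mathbb C\otimes_{\mathbb Q}E(\lambda,t,a)\cong\operatorname{sgn}_n\otimes\bigoplus_{\substack{\deg\circ s=t\\ |s^{-1}(x)|-|s^{-1}(y)|=a}}\operatorname{Ind}_{Z(\lambda,s)}^{\mathfrak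 S_n}\xi(\lambda,s).$$ 3. If $\mathbb V_a$ occurs in $E_2^{p,q}(M(A_n))$, then $a\le p$, $p+2q\le 2n-a$ and $q\le n-1$. If $\mathbb V_a$ occurs in the component $E_2^{p,q}(M(A_n)/E)$ of the quotient by diagonal translations, i.e. of the subalgebra generated by the $x_i-x_j$, $y_i-y_j$ and $\omega_{i,j}$, then $a\le p$ and $p+2q\le 2n-2-a$; that is, $(p,q)$ lies in the triangle with vertices $(a,0)$, $(2n-2-a,0)$, $(a,n-1-a)$. -/

import Mathlib

open scoped TensorProduct DirectSum MatrixGroups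

noncomputable section

namespace BraidElliptic

/-! ### The bigraded algebra of the braid elliptic arrangement -/

/-- Generators: `cls 0 i` is `x_i = pr_i^* x`, `cls 1 i` is `y_i = pr_i^* y` (where `x, y` is a basis
of `H^1(E)`), and `edge i j` is the class `ω_{i,j}` of the divisor `P_i = P_j`. -/
inductive Gen (n : ℕ) : Type
  | cls (c : Fin 2) (i : Fin n)
  | edge (i j : Fin n)

/-- The generator `g` in the free algebra. -/
abbrev gen {n : ℕ} (g : Gen n) : FreeAlgebra ℚ (Gen n) := FreeAlgebra.ι ℚ g

/-- The defining relations: the generators anticommute (so their squares vanish, as `2` is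
invertible), `ω_{i,j} = ω_{j,i}`, there is no divisor for `i = j`, `x_i ω_{i,j} = x_j ω_{i,j}`,
`y_i ω_{i,j} = y_j ω_{i,j}`, and the circuit (Arnold) relation. -/
inductive Rel (n : ℕ) : FreeAlgebra ℚ (Gen n) → FreeAlgebra ℚ (Gen n) → Prop
  | anticomm (a b : Gen n) : Rel n (gen a * gen b) (-(gen b * gen a))
  | edge_self (i : Fin n) : Rel n (gen (.edge i i)) 0
  | edge_symm (i j : Fin n) : Rel n (gen (.edge i j)) (gen (.edge j i))
  | cls_edge (c : Fin 2) (i j : Fin n) :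
      Rel n (gen (.cls c i) * gen (.edge i j)) (gen (.cls c j) * gen (.edge i j))
  | arnold (i j k : Fin n) :
      Rel n (gen (.edge i j) * gen (.edge j k) + gen (.edge j k) * gen (.edge k i)
        + gen (.edge k i) * gen (.edge i j)) 0

/-- The algebra `E_2(M(A_n))` of the arrangement of the divisors `P_i = P_j` in `E^n`. -/
def E2Alg (n : ℕ) : Type := RingQuot (Rel n)

instance (n : ℕ) : Ring (E2Alg n) := inferInstanceAs (Ring (RingQuot (Rel n)))

instance (n : ℕ) : Algebra ℚ (E2Alg n) := inferInstanceAs (Algebra ℚ (RingQuot (Rel n)))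

/-- The quotient map from the free algebra. -/
def mkE2 (n : ℕ) : FreeAlgebra ℚ (Gen n) →ₐ[ℚ] E2Alg n := RingQuot.mkAlgHom ℚ (Rel n)

theorem mkE2_rel {n : ℕ} {a b : FreeAlgebra ℚ (Gen n)} (h : Rel n a b) : mkE2 n a = mkE2 n b :=
  RingQuot.mkAlgHom_rel ℚ h

/-- The class of a generator. -/
def cl {n : ℕ} (g : Gen n) : E2Alg n := mkE2 n (gen g)

variable {n : ℕ}

theorem cl_anticomm (a b : Gen n) : cl a * cl b = -(cl b * cl a) := by
  have h := mkE2_rel (Rel.anticomm a b)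
  simpa [cl] using h

theorem cl_edge_self (i : Fin n) : cl (.edge i i) = 0 := by
  have h := mkE2_rel (Rel.edge_self i)
  simpa [cl] using h

theorem cl_edge_symm (i j : Fin n) : cl (.edge i j) = cl (.edge j i) :=
  mkE2_rel (Rel.edge_symm i j)

theorem cl_cls_edge (c : Fin 2) (i j : Fin n) :
    cl (.cls c i) * cl (.edge i j) = cl (.cls c j) * cl (.edge i j) := by
  have h := mkE2_rel (Rel.cls_edge c i j)
  simpa [cl] using h

theorem cl_arnold (i j k : Fin n) :
    cl (.edge i j) * cl (.edge j k) + cl (.edge j k) * cl (.edge k i)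
      + cl (.edge k i) * cl (.edge i j) = 0 := by
  have h := mkE2_rel (Rel.arnold i j k)
  simpa [cl] using h

/-! ### The action of `S_n × SL_2(ℚ)` -/

/-- `(σ, A)` sends `ω_{i,j}` to `ω_{σ i, σ j}` and acts on `x_i, y_i` by moving the index and by the
standard representation of `SL_2` on the span of `x, y`. -/
def genAct (g : Equiv.Perm (Fin n) × SL(2, ℚ)) : Gen n → E2Alg n
  | .cls c i => ∑ d : Fin 2, (g.2 : Matrix (Fin 2) (Fin 2) ℚ) d c • cl (.cls d (g.1 i))
  | .edge i j => cl (.edge (g.1 i) (g.1 j))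

theorem anticomm_span {u v : E2Alg n} (hu : u ∈ Submodule.span ℚ (Set.range (cl (n := n))))
    (hv : v ∈ Submodule.span ℚ (Set.range (cl (n := n)))) : u * v = -(v * u) := by
  induction hu, hv using Submodule.span_induction₂ with
  | mem_mem x y hx hy =>
    obtain ⟨a, rfl⟩ := hx
    obtain ⟨b, rfl⟩ := hy
    exact cl_anticomm a b
  | zero_left => simp
  | zero_right => simp
  | add_left x y z _ _ _ h1 h2 => rw [add_mul, mul_add, h1, h2]; abel
  | add_right x y z _ _ _ h1 h2 => rw [add_mul, mul_add, h1, h2]; abel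
  | smul_left r x y _ _ h => rw [smul_mul_assoc, h, mul_smul_comm, smul_neg]
  | smul_right r x y _ _ h => rw [mul_smul_comm, h, smul_mul_assoc, smul_neg]

theorem genAct_mem_span (g : Equiv.Perm (Fin n) × SL(2, ℚ)) (a : Gen n) :
    genAct g a ∈ Submodule.span ℚ (Set.range (cl (n := n))) := by
  cases a with
  | cls c i =>
    exact Submodule.sum_mem _ fun d _ => Submodule.smul_mem _ _ (Submodule.subset_span ⟨_, rfl⟩)
  | edge i j => exact Submodule.subset_span ⟨_, rfl⟩

theorem genAct_rel (g : Equiv.Perm (Fin n) × SL(2, ℚ)) ⦃a b : FreeAlgebra ℚ (Gen n)⦄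
    (h : Rel n a b) : FreeAlgebra.lift ℚ (genAct g) a = FreeAlgebra.lift ℚ (genAct g) b := by
  cases h with
  | anticomm a b => simpa using anticomm_span (genAct_mem_span g a) (genAct_mem_span g b)
  | edge_self i => simpa [genAct] using cl_edge_self _
  | edge_symm i j => simpa [genAct] using cl_edge_symm _ _
  | cls_edge c i j =>
    simp only [map_mul, FreeAlgebra.lift_ι_apply, genAct, Finset.sum_mul, smul_mul_assoc]
    exact Finset.sum_congr rfl fun d _ => by rw [cl_cls_edge]
  | arnold i j k => simpa [genAct] using cl_arnold _ _ _

/-- The algebra automorphism by which a pair `(σ, A)` acts. -/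
def actHom (g : Equiv.Perm (Fin n) × SL(2, ℚ)) : E2Alg n →ₐ[ℚ] E2Alg n :=
  RingQuot.liftAlgHom ℚ ⟨FreeAlgebra.lift ℚ (genAct g), genAct_rel g⟩

theorem actHom_cl (g : Equiv.Perm (Fin n) × SL(2, ℚ)) (a : Gen n) :
    actHom g (cl a) = genAct g a := by
  have h : actHom g (mkE2 n (gen a)) = FreeAlgebra.lift ℚ (genAct g) (gen a) :=
    RingQuot.liftAlgHom_mkAlgHom_apply ℚ _ (genAct_rel g) _
  rw [cl, h, FreeAlgebra.lift_ι_apply]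

theorem algHom_ext_cl {f g : E2Alg n →ₐ[ℚ] E2Alg n} (h : ∀ a, f (cl a) = g (cl a)) : f = g := by
  apply RingQuot.ringQuot_ext'
  apply FreeAlgebra.hom_ext
  funext a
  exact h a

/-- `E_2(M(A_n))` as a representation of `S_n × SL_2(ℚ)`. -/
def E2Rep (n : ℕ) : Representation ℚ (Equiv.Perm (Fin n) × SL(2, ℚ)) (E2Alg n) where
  toFun g := (actHom g).toLinearMap
  map_one' := by
    rw [show actHom (1 : Equiv.Perm (Fin n) × SL(2, ℚ)) = AlgHom.id ℚ _ from ?_]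
    · rfl
    · apply algHom_ext_cl
      intro a
      cases a with
      | cls c i =>
        rw [actHom_cl]
        simp [genAct, Matrix.one_apply]
      | edge i j => rw [actHom_cl]; simp [genAct]
  map_mul' g h := by
    rw [show actHom (g * h) = (actHom g).comp (actHom h) from ?_]
    · rfl
    · apply algHom_ext_cl
      intro a
      cases a with
      | cls c i =>
        rw [AlgHom.comp_apply, actHom_cl, actHom_cl]
        simp only [genAct, map_add, map_smul, actHom_cl, Fin.sum_univ_two, Prod.snd_mul,
          Prod.fst_mul, Equiv.Perm.coe_mul, Function.comp_apply,
          Matrix.SpecialLinearGroup.coe_mul, Matrix.mul_apply]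
        module
      | edge i j =>
        rw [AlgHom.comp_apply, actHom_cl, actHom_cl]
        simp only [genAct, actHom_cl, Prod.fst_mul, Equiv.Perm.coe_mul, Function.comp_apply]

/-- `E_2(M(A_n))` as a representation of `S_n`. -/
abbrev symRep (n : ℕ) : Representation ℚ (Equiv.Perm (Fin n)) (E2Alg n) :=
  (E2Rep n).comp (MonoidHom.inl _ _)

/-- `E_2(M(A_n))` as a representation of `SL_2(ℚ)`. -/
abbrev slRep (n : ℕ) : Representation ℚ SL(2, ℚ) (E2Alg n) :=
  (E2Rep n).comp (MonoidHom.inr _ _)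

/-! ### The bigrading -/

/-- The span of the `x_i, y_i`, of bidegree `(1, 0)`. -/
def clsSpan (n : ℕ) : Submodule ℚ (E2Alg n) :=
  Submodule.span ℚ {z | ∃ c i, z = cl (.cls c i)}

/-- The span of the `ω_{i,j}`, of bidegree `(0, 1)`. -/
def edgeSpan (n : ℕ) : Submodule ℚ (E2Alg n) :=
  Submodule.span ℚ {z | ∃ i j, z = cl (.edge i j)}

theorem map_clsSpan_le (g : Equiv.Perm (Fin n) × SL(2, ℚ)) :
    (clsSpan n).map (actHom g).toLinearMap ≤ clsSpan n := by
  rw [clsSpan, Submodule.map_span_le]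
  rintro _ ⟨c, i, rfl⟩
  rw [AlgHom.toLinearMap_apply, actHom_cl]
  exact Submodule.sum_mem _ fun d _ =>
    Submodule.smul_mem _ _ (Submodule.subset_span ⟨d, g.1 i, rfl⟩)

theorem map_edgeSpan_le (g : Equiv.Perm (Fin n) × SL(2, ℚ)) :
    (edgeSpan n).map (actHom g).toLinearMap ≤ edgeSpan n := by
  rw [edgeSpan, Submodule.map_span_le]
  rintro _ ⟨i, j, rfl⟩
  rw [AlgHom.toLinearMap_apply, actHom_cl]
  exact Submodule.subset_span ⟨g.1 i, g.1 j, rfl⟩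

/-- The homogeneous component `E_2^{p,q}(M(A_n))`, spanned by the products of `p` generators among
the `x_i, y_i` and `q` generators among the `ω_{i,j}`. -/
def E2 (n p q : ℕ) : Subrepresentation (E2Rep n) where
  toSubmodule := clsSpan n ^ p * edgeSpan n ^ q
  apply_mem_toSubmodule g v hv := by
    have h : (clsSpan n ^ p * edgeSpan n ^ q).map (actHom g).toLinearMap
        ≤ clsSpan n ^ p * edgeSpan n ^ q := by
      rw [Submodule.map_mul, Submodule.map_pow, Submodule.map_pow]
      exact mul_le_mul' (pow_le_pow_left' (map_clsSpan_le g) p)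
        (pow_le_pow_left' (map_edgeSpan_le g) q)
    exact h ⟨v, hv, rfl⟩

/-- The span of the differences `x_i - x_j` and `y_i - y_j`. -/
def diffSpan (n : ℕ) : Submodule ℚ (E2Alg n) :=
  Submodule.span ℚ {z | ∃ c i j, z = cl (.cls c i) - cl (.cls c j)}

/-- The component `E_2^{p,q}(M(A_n)/E)` for the quotient by the diagonal translations, inside
`E_2^{p,q}(M(A_n))`: it is generated by the differences and by the `ω_{i,j}`. -/
def E2Quot (n p q : ℕ) : Submodule ℚ (E2Alg n) := diffSpan n ^ p * edgeSpan n ^ q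

/-! ### The irreducible representations of `SL_2(ℚ)` -/

/-- `SL_2(ℚ)` acting on `ℚ[X_0, X_1]` by linear substitutions, extending the standard
representation on the span of `X_0, X_1`. -/
def polyRep : Representation ℚ SL(2, ℚ) (MvPolynomial (Fin 2) ℚ) where
  toFun A := (MvPolynomial.aeval fun j =>
    ∑ i : Fin 2, (A : Matrix (Fin 2) (Fin 2) ℚ) i j • MvPolynomial.X i).toLinearMap
  map_one' := by
    rw [show MvPolynomial.aeval _ = AlgHom.id ℚ (MvPolynomial (Fin 2) ℚ) from ?_]
    · rfl
    · apply MvPolynomial.algHom_ext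
      intro j
      simp [Matrix.one_apply]
  map_mul' A B := by
    rw [Module.End.mul_eq_comp, ← AlgHom.comp_toLinearMap]
    congr 1
    apply MvPolynomial.algHom_ext
    intro j
    simp only [MvPolynomial.aeval_X, AlgHom.comp_apply, map_add, map_smul, Fin.sum_univ_two,
      Matrix.SpecialLinearGroup.coe_mul, Matrix.mul_apply]
    module

/-- The irreducible representation `𝕍_a = Sym^a(ℚ^2)` of `SL_2(ℚ)`, of dimension `a + 1`: binary
forms of degree `a`. -/
def V (a : ℕ) : Subrepresentation polyRep where
  toSubmodule := MvPolynomial.homogeneousSubmodule (Fin 2) ℚ a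
  apply_mem_toSubmodule A f hf := by
    rw [MvPolynomial.mem_homogeneousSubmodule] at hf ⊢
    have := hf.aeval (fun j => ∑ i : Fin 2, (A : Matrix (Fin 2) (Fin 2) ℚ) i j •
      (MvPolynomial.X i : MvPolynomial (Fin 2) ℚ)) (n := 1) (fun j => by
        refine MvPolynomial.IsHomogeneous.sum _ _ _ fun i _ => ?_
        rw [MvPolynomial.smul_eq_C_mul]
        simpa using (MvPolynomial.isHomogeneous_C (Fin 2)
          ((A : Matrix (Fin 2) (Fin 2) ℚ) i j)).mul (MvPolynomial.isHomogeneous_X ℚ i))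
    rwa [one_mul] at this

/-- `𝕍_a` occurs in the subspace `S` of `E_2(M(A_n))`. -/
def Occurs (a : ℕ) (S : Submodule ℚ (E2Alg n)) : Prop :=
  ∃ f : (V a).toRepresentation.IntertwiningMap (slRep n), f ≠ 0 ∧ ∀ v, f v ∈ S

/-! ### Labelled and weighted partitions -/

/-- The basis `1, x, y, xy` of `H^•(E)`. -/
inductive Label : Type
  | one | x | y | xy
  deriving DecidableEq

/-- The degree in `H^•(E)`. -/
def Label.deg : Label → Fin 3
  | one => 0
  | x => 1
  | y => 1
  | xy => 2

/-- A partition of the number `n` whose blocks carry an element of `α`, as the multiset of the pairs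
(size of the block, decoration of the block). -/
@[ext]
structure DecoratedPartition (α : Type) (n : ℕ) where
  blocks : Multiset (ℕ × α)
  pos : ∀ b ∈ blocks, 0 < b.1
  sum_eq : (blocks.map Prod.fst).sum = n

/-- Labelled partitions `(λ, s)`. -/
abbrev LabelledPartition (n : ℕ) := DecoratedPartition Label n

/-- Weighted partitions `(λ, t)`, with weights in `{0, 1, 2}`. -/
abbrev WeightedPartition (n : ℕ) := DecoratedPartition (Fin 3) n

/-- The weighted partition `(λ, deg ∘ s)`. -/
def toWeighted (L : LabelledPartition n) : WeightedPartition n where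
  blocks := L.blocks.map fun b => (b.1, b.2.deg)
  pos := by
    intro b hb
    obtain ⟨c, hc, rfl⟩ := Multiset.mem_map.1 hb
    exact L.pos c hc
  sum_eq := by rw [Multiset.map_map]; exact L.sum_eq

/-- `|s⁻¹(x)| - |s⁻¹(y)|`. -/
def torusWeight (L : LabelledPartition n) : ℤ :=
  ((L.blocks.map Prod.snd).count .x : ℤ) - (L.blocks.map Prod.snd).count .y

/-! ### Labelled forests and the subspaces they span -/

/-- A forest on `{1, …, n}` whose trees are labelled by `1, x, y, xy`. -/
structure LabelledForest (n : ℕ) where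
  graph : SimpleGraph (Fin n)
  acyclic : graph.IsAcyclic
  label : graph.ConnectedComponent → Label

/-- The shape of a labelled forest: the sizes of the trees with their labels. -/
def LabelledForest.shape (F : LabelledForest n) : Multiset (ℕ × Label) :=
  (@Finset.univ F.graph.ConnectedComponent (Fintype.ofFinite _)).val.map
    fun c => (c.supp.ncard, F.label c)

/-- The pull-back of an element of the basis of `H^•(E)` along the `i`-th projection. -/
def labelClass : Label → Fin n → E2Alg n
  | .one, _ => 1
  | .x, i => cl (.cls 0 i)
  | .y, i => cl (.cls 1 i)
  | .xy, i => cl (.cls 0 i) * cl (.cls 1 i)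

/-- The root of a tree is its greatest vertex. -/
def IsRoot (G : SimpleGraph (Fin n)) (i : Fin n) : Prop := ∀ j, G.Reachable i j → j ≤ i

open Classical in
/-- The roots of a forest, in increasing order. -/
def roots (G : SimpleGraph (Fin n)) : List (Fin n) :=
  (List.finRange n).filter fun i => IsRoot G i

open Classical in
/-- The edges `(i, j)`, `i < j`, of a forest, in lexicographical order. -/
def edges (G : SimpleGraph (Fin n)) : List (Fin n × Fin n) :=
  (List.finRange n ×ˢ List.finRange n).filter fun e => e.1 < e.2 ∧ G.Adj e.1 e.2

/-- The product `ω_F` of the classes of the edges. -/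
def edgeMonomial (G : SimpleGraph (Fin n)) : E2Alg n :=
  ((edges G).map fun e => cl (.edge e.1 e.2)).prod

/-- The element `ω_{F,s}`. -/
def LabelledForest.monomial (F : LabelledForest n) : E2Alg n :=
  ((roots F.graph).map fun i => labelClass (F.label (F.graph.connectedComponentMk i)) i).prod
    * edgeMonomial F.graph

/-! ### The symmetric group permutes the elements `ω_{F,s}` up to sign -/

/-- `a` and `b` commute up to sign. -/
def SignComm (a b : E2Alg n) : Prop := a * b = b * a ∨ a * b = -(b * a)

theorem SignComm.symm {a b : E2Alg n} (h : SignComm a b) : SignComm b a := by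
  rcases h with h | h
  · exact Or.inl h.symm
  · exact Or.inr (by rw [h, neg_neg])

theorem SignComm.one_right (a : E2Alg n) : SignComm a 1 := Or.inl (by simp)

theorem SignComm.mul_right {a b c : E2Alg n} (hb : SignComm a b) (hc : SignComm a c) :
    SignComm a (b * c) := by
  rcases hb with hb | hb <;> rcases hc with hc | hc
  · left; rw [← mul_assoc, hb, mul_assoc, hc, mul_assoc]
  · right; rw [← mul_assoc, hb, mul_assoc, hc, mul_neg, mul_assoc]
  · right; rw [← mul_assoc, hb, neg_mul, mul_assoc, hc, mul_assoc]
  · left; rw [← mul_assoc, hb, neg_mul, mul_assoc, hc, mul_neg, neg_neg, mul_assoc]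

theorem SignComm.mul_left {a b c : E2Alg n} (ha : SignComm a c) (hb : SignComm b c) :
    SignComm (a * b) c := (SignComm.mul_right ha.symm hb.symm).symm

theorem SignComm.prod_right {a : E2Alg n} {l : List (E2Alg n)} (h : ∀ b ∈ l, SignComm a b) :
    SignComm a l.prod := by
  induction l with
  | nil => exact SignComm.one_right a
  | cons b l ih =>
    rw [List.prod_cons]
    exact (h b (by simp)).mul_right (ih fun c hc => h c (by simp [hc]))

theorem signComm_cl (a b : Gen n) : SignComm (cl a) (cl b) := Or.inr (cl_anticomm a b)

theorem signComm_label_cl (l : Label) (i : Fin n) (b : Gen n) :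
    SignComm (labelClass l i) (cl b) := by
  cases l
  · exact (SignComm.one_right _).symm
  · exact signComm_cl _ _
  · exact signComm_cl _ _
  · exact (signComm_cl _ _).mul_left (signComm_cl _ _)

theorem signComm_label_label (l m : Label) (i j : Fin n) :
    SignComm (labelClass l i) (labelClass m j) := by
  cases m
  · exact SignComm.one_right _
  · exact signComm_label_cl _ _ _
  · exact signComm_label_cl _ _ _
  · exact (signComm_label_cl _ _ _).mul_right (signComm_label_cl _ _ _)

/-- Reordering a product of elements that commute up to sign changes it at most by a sign. -/
theorem prod_perm {l m : List (E2Alg n)} (hp : l.Perm m)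
    (h : ∀ a ∈ l, ∀ b ∈ l, SignComm a b) : l.prod = m.prod ∨ l.prod = -m.prod := by
  induction hp with
  | nil => simp
  | cons x _ ih =>
    rcases ih fun a ha b hb => h a (by simp [ha]) b (by simp [hb]) with h' | h' <;>
      simp [h']
  | swap x y l =>
    rcases h y (by simp) x (by simp) with h' | h'
    · left; simp [← mul_assoc, h']
    · right; simp [← mul_assoc, h']
  | trans hp1 _ ih1 ih2 =>
    have h2 := ih2 fun a ha b hb => h a (hp1.mem_iff.2 ha) b (hp1.mem_iff.2 hb)
    rcases ih1 h with h1 | h1 <;> rcases h2 with h2 | h2 <;> simp [h1, h2]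

theorem mul_prod_eq_zero {z e : E2Alg n} {l : List (E2Alg n)} (he : e ∈ l)
    (hz : z * e = 0) (h : ∀ b ∈ l, SignComm z b) : z * l.prod = 0 := by
  induction l with
  | nil => simp at he
  | cons b l ih =>
    rw [List.prod_cons, ← mul_assoc]
    rcases List.mem_cons.1 he with rfl | he
    · rw [hz, zero_mul]
    · have := ih he fun c hc => h c (by simp [hc])
      rcases h b (by simp) with h' | h' <;> simp [h', mul_assoc, this]

theorem mem_edges {G : SimpleGraph (Fin n)} {e : Fin n × Fin n} :
    e ∈ edges G ↔ e.1 < e.2 ∧ G.Adj e.1 e.2 := by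
  obtain ⟨i, j⟩ := e
  simp [edges]

theorem mem_roots {G : SimpleGraph (Fin n)} {i : Fin n} : i ∈ roots G ↔ IsRoot G i := by
  simp [roots]

theorem nodup_edges (G : SimpleGraph (Fin n)) : (edges G).Nodup :=
  ((List.nodup_finRange n).product (List.nodup_finRange n)).filter _

theorem nodup_roots (G : SimpleGraph (Fin n)) : (roots G).Nodup :=
  (List.nodup_finRange n).filter _

theorem cls_edgeMonomial_of_adj {G : SimpleGraph (Fin n)} {i j : Fin n} (h : G.Adj i j)
    (c : Fin 2) : cl (.cls c i) * edgeMonomial G = cl (.cls c j) * edgeMonomial G := by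
  wlog hij : i < j generalizing i j
  · exact (this h.symm (lt_of_le_of_ne (not_lt.1 hij) h.ne.symm)).symm
  rw [← sub_eq_zero, ← sub_mul]
  refine mul_prod_eq_zero (e := cl (.edge i j))
    (List.mem_map.2 ⟨(i, j), mem_edges.2 ⟨hij, h⟩, rfl⟩) ?_ ?_
  · rw [sub_mul, cl_cls_edge, sub_self]
  · intro b hb
    obtain ⟨e, _, rfl⟩ := List.mem_map.1 hb
    right
    rw [sub_mul, mul_sub, cl_anticomm, cl_anticomm (.cls c j)]
    abel

theorem cls_edgeMonomial_of_reachable {G : SimpleGraph (Fin n)} {i j : Fin n}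
    (h : G.Reachable i j) (c : Fin 2) :
    cl (.cls c i) * edgeMonomial G = cl (.cls c j) * edgeMonomial G := by
  obtain ⟨w⟩ := h
  induction w with
  | nil => rfl
  | cons h _ ih => rw [cls_edgeMonomial_of_adj h, ih]

theorem label_edgeMonomial_of_reachable {G : SimpleGraph (Fin n)} {i j : Fin n}
    (h : G.Reachable i j) (l : Label) :
    labelClass l i * edgeMonomial G = labelClass l j * edgeMonomial G := by
  cases l
  · rfl
  · exact cls_edgeMonomial_of_reachable h 0
  · exact cls_edgeMonomial_of_reachable h 1
  · simp only [labelClass]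
    rw [mul_assoc, cls_edgeMonomial_of_reachable h 1, ← mul_assoc, cl_anticomm, neg_mul,
      mul_assoc, cls_edgeMonomial_of_reachable h 0, ← mul_assoc, ← neg_mul, ← cl_anticomm]

theorem signComm_label_edgeMonomial (G : SimpleGraph (Fin n)) (l : Label) (i : Fin n) :
    SignComm (labelClass l i) (edgeMonomial G) := by
  refine SignComm.prod_right fun b hb => ?_
  obtain ⟨e, _, rfl⟩ := List.mem_map.1 hb
  exact signComm_label_cl _ _ _

/-- The labels may be placed on any vertices of the trees. -/
theorem prod_label_congr {ι : Type*} {G : SimpleGraph (Fin n)} (l : List ι) (s : ι → Label)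
    (u v : ι → Fin n) (h : ∀ a ∈ l, G.Reachable (u a) (v a)) :
    (l.map fun a => labelClass (s a) (u a)).prod * edgeMonomial G
      = (l.map fun a => labelClass (s a) (v a)).prod * edgeMonomial G := by
  induction l with
  | nil => rfl
  | cons a l ih =>
    have hP : SignComm (edgeMonomial G) (l.map fun a => labelClass (s a) (v a)).prod := by
      refine SignComm.prod_right fun b hb => ?_
      obtain ⟨e, _, rfl⟩ := List.mem_map.1 hb
      exact (signComm_label_edgeMonomial G _ _).symm
    have ha := label_edgeMonomial_of_reachable (h a (by simp)) (s a)
    simp only [List.map_cons, List.prod_cons, mul_assoc]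
    rw [ih fun b hb => h b (by simp [hb])]
    rcases hP with hP | hP
    · rw [← hP, ← mul_assoc, ha, mul_assoc]
    · rw [← neg_eq_iff_eq_neg.2 hP, mul_neg, mul_neg, ← mul_assoc, ha, mul_assoc]

theorem exists_root (G : SimpleGraph (Fin n)) (i : Fin n) :
    ∃ r, IsRoot G r ∧ G.Reachable i r := by
  classical
  obtain ⟨r, hr, hmax⟩ := (Finset.univ.filter fun j => G.Reachable i j).exists_max_image id
    ⟨i, by simp⟩
  simp only [Finset.mem_filter, Finset.mem_univ, true_and, id] at hr hmax
  exact ⟨r, fun j hj => hmax j (hr.trans hj), hr⟩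

theorem IsRoot.unique {G : SimpleGraph (Fin n)} {r t : Fin n} (hr : IsRoot G r) (ht : IsRoot G t)
    (h : G.Reachable r t) : r = t := le_antisymm (ht _ h.symm) (hr _ h)

/-- The forest `σ F` with the labels carried along. -/
def LabelledForest.perm (σ : Equiv.Perm (Fin n)) (F : LabelledForest n) : LabelledForest n where
  graph := F.graph.map σ.toEmbedding
  acyclic := (SimpleGraph.Iso.isAcyclic_iff (SimpleGraph.Iso.map σ F.graph)).1 F.acyclic
  label c := F.label ((SimpleGraph.Iso.map σ F.graph).connectedComponentEquiv.symm c)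

theorem LabelledForest.shape_perm (σ : Equiv.Perm (Fin n)) (F : LabelledForest n) :
    (F.perm σ).shape = F.shape := by
  classical
  let φ := SimpleGraph.Iso.map σ F.graph
  let _ : Fintype F.graph.ConnectedComponent := Fintype.ofFinite _
  let _ : Fintype (F.perm σ).graph.ConnectedComponent := Fintype.ofFinite _
  have h : (Finset.univ : Finset (F.perm σ).graph.ConnectedComponent)
      = Finset.univ.map φ.connectedComponentEquiv.toEmbedding :=
    (Finset.map_univ_equiv _).symm
  unfold LabelledForest.shape
  rw [h, Finset.map_val]
  refine (Multiset.map_map _ _ _).trans (Multiset.map_congr rfl fun c _ => ?_)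
  refine Prod.ext ?_ ?_
  · have : (φ.connectedComponentEquiv c).supp = φ '' c.supp := by
      induction c using SimpleGraph.ConnectedComponent.ind with | _ v => ?_
      ext w
      obtain ⟨w, rfl⟩ := φ.surjective w
      simp [SimpleGraph.Iso.reachable_iff]
    change (φ.connectedComponentEquiv c).supp.ncard = _
    rw [this, Set.ncard_image_of_injective _ φ.injective]
  · change F.label (φ.connectedComponentEquiv.symm (φ.connectedComponentEquiv c)) = _
    rw [Equiv.symm_apply_apply]

theorem symRep_label (σ : Equiv.Perm (Fin n)) (l : Label) (i : Fin n) :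
    actHom (σ, (1 : SL(2, ℚ))) (labelClass l i) = labelClass l (σ i) := by
  cases l <;> simp [labelClass, actHom_cl, genAct, Matrix.one_apply]

theorem actHom_edgeMonomial (σ : Equiv.Perm (Fin n)) (F : LabelledForest n) :
    actHom (σ, (1 : SL(2, ℚ))) (edgeMonomial F.graph) = edgeMonomial (F.perm σ).graph ∨
      actHom (σ, (1 : SL(2, ℚ))) (edgeMonomial F.graph) = -edgeMonomial (F.perm σ).graph := by
  classical
  let o : Fin n × Fin n → Fin n × Fin n := fun e => if e.1 < e.2 then e else (e.2, e.1)
  have ho : ∀ e : Fin n × Fin n, cl (.edge (o e).1 (o e).2) = cl (.edge e.1 e.2) := by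
    intro e
    by_cases he : e.1 < e.2
    · simp [o, he]
    · simp only [o, he, if_false]; exact cl_edge_symm _ _
  let f : Fin n × Fin n → Fin n × Fin n := fun e => o (σ e.1, σ e.2)
  have hadj : ∀ i j, (F.perm σ).graph.Adj (σ i) (σ j) ↔ F.graph.Adj i j := fun i j =>
    (SimpleGraph.Iso.map σ F.graph).map_adj_iff
  have hperm : ((edges F.graph).map f).Perm (edges (F.perm σ).graph) := by
    rw [List.perm_ext_iff_of_nodup _ (nodup_edges _)]
    · rintro ⟨i, j⟩
      rw [List.mem_map, mem_edges]
      constructor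
      · rintro ⟨⟨a, b⟩, hab, h⟩
        rw [mem_edges] at hab
        have hne : σ a ≠ σ b := σ.injective.ne hab.2.ne
        by_cases hlt : σ a < σ b
        · simp only [f, o, hlt, if_true, Prod.mk.injEq] at h
          obtain ⟨rfl, rfl⟩ := h
          exact ⟨hlt, (hadj _ _).2 hab.2⟩
        · simp only [f, o, hlt, if_false, Prod.mk.injEq] at h
          obtain ⟨rfl, rfl⟩ := h
          exact ⟨lt_of_le_of_ne (not_lt.1 hlt) hne.symm, ((hadj _ _).2 hab.2).symm⟩
      · rintro ⟨hlt, h⟩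
        obtain ⟨a, rfl⟩ := σ.surjective i
        obtain ⟨b, rfl⟩ := σ.surjective j
        rw [hadj] at h
        dsimp only at hlt
        rcases lt_or_gt_of_ne h.ne with hab | hab
        · exact ⟨(a, b), mem_edges.2 ⟨hab, h⟩, by simp [f, o, hlt]⟩
        · exact ⟨(b, a), mem_edges.2 ⟨hab, h.symm⟩, by simp [f, o, hlt.not_gt]⟩
    · refine List.Nodup.map_on ?_ (nodup_edges _)
      rintro ⟨a, b⟩ hab ⟨c, d⟩ hcd h
      rw [mem_edges] at hab hcd
      have h1 := hab.1
      have h2 := hcd.1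
      dsimp only at h1 h2
      simp only [f, o] at h
      split_ifs at h <;> simp only [Prod.mk.injEq, σ.injective.eq_iff] at h
      · rw [h.1, h.2]
      · omega
      · omega
      · rw [h.1, h.2]
  have h1 : actHom (σ, (1 : SL(2, ℚ))) (edgeMonomial F.graph)
      = (((edges F.graph).map f).map fun e => cl (.edge e.1 e.2)).prod := by
    rw [edgeMonomial, map_list_prod, List.map_map, List.map_map]
    congr 1
    refine List.map_congr_left fun e _ => ?_
    simp only [Function.comp_apply, f, ho, actHom_cl, genAct]
  rw [h1]
  refine prod_perm (hperm.map _) ?_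
  intro a ha b hb
  obtain ⟨_, _, rfl⟩ := List.mem_map.1 ha
  obtain ⟨_, _, rfl⟩ := List.mem_map.1 hb
  exact signComm_cl _ _

theorem symRep_monomial (σ : Equiv.Perm (Fin n)) (F : LabelledForest n) :
    symRep n σ F.monomial = (F.perm σ).monomial ∨
      symRep n σ F.monomial = -(F.perm σ).monomial := by
  classical
  let G' := (F.perm σ).graph
  choose r hr hr' using exists_root G'
  let φ := SimpleGraph.Iso.map σ F.graph
  have hreach : ∀ i j, G'.Reachable (σ i) (σ j) ↔ F.graph.Reachable i j := fun i j =>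
    SimpleGraph.Iso.reachable_iff (φ := φ)
  let s' : Fin n → Label := fun i => (F.perm σ).label (G'.connectedComponentMk i)
  have hs : ∀ i, F.label (F.graph.connectedComponentMk i) = s' (r (σ i)) := by
    intro i
    have h1 : G'.connectedComponentMk (r (σ i)) = φ.connectedComponentEquiv
        (F.graph.connectedComponentMk i) :=
      (SimpleGraph.ConnectedComponent.eq.2 (hr' (σ i))).symm
    change _ = F.label (φ.connectedComponentEquiv.symm (G'.connectedComponentMk (r (σ i))))
    rw [h1, Equiv.symm_apply_apply]
  have hperm : ((roots F.graph).map fun i => r (σ i)).Perm (roots G') := by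
    rw [List.perm_ext_iff_of_nodup _ (nodup_roots _)]
    · intro t
      rw [List.mem_map, mem_roots]
      constructor
      · rintro ⟨i, _, rfl⟩
        exact hr _
      · intro ht
        obtain ⟨a, rfl⟩ := σ.surjective t
        obtain ⟨b, hb, hab⟩ := exists_root F.graph a
        refine ⟨b, mem_roots.2 hb, (hr _).unique ht ?_⟩
        exact (((hreach a b).2 hab).trans (hr' (σ b))).symm
    · refine List.Nodup.map_on ?_ (nodup_roots _)
      intro a ha b hb h
      rw [mem_roots] at ha hb
      refine ha.unique hb ((hreach a b).1 ?_)
      have h2 := hr' (σ b)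
      rw [← h] at h2
      exact (hr' (σ a)).trans h2.symm
  have hroots : ((roots F.graph).map fun i => labelClass (s' (r (σ i))) (r (σ i))).prod
        = ((roots G').map fun i => labelClass (s' i) i).prod ∨
      ((roots F.graph).map fun i => labelClass (s' (r (σ i))) (r (σ i))).prod
        = -((roots G').map fun i => labelClass (s' i) i).prod := by
    have h := hperm.map fun i => labelClass (s' i) i
    rw [List.map_map] at h
    refine prod_perm h ?_
    intro a ha b hb
    obtain ⟨_, _, rfl⟩ := List.mem_map.1 ha
    obtain ⟨_, _, rfl⟩ := List.mem_map.1 hb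
    exact signComm_label_label _ _ _ _
  have hact : symRep n σ F.monomial
      = ((roots F.graph).map fun i => labelClass (s' (r (σ i))) (σ i)).prod
        * actHom (σ, (1 : SL(2, ℚ))) (edgeMonomial F.graph) := by
    change actHom (σ, (1 : SL(2, ℚ))) F.monomial = _
    rw [LabelledForest.monomial, map_mul, map_list_prod, List.map_map]
    congr 2
    refine List.map_congr_left fun i _ => ?_
    rw [Function.comp_apply, symRep_label, hs]
  have hcongr := prod_label_congr (G := G') (roots F.graph) (fun i => s' (r (σ i)))
    (fun i => σ i) (fun i => r (σ i)) fun i _ => hr' (σ i)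
  have htarget : (F.perm σ).monomial
      = ((roots G').map fun i => labelClass (s' i) i).prod * edgeMonomial G' := rfl
  rw [hact, htarget]
  rcases actHom_edgeMonomial σ F with h | h <;> rw [h] <;> rcases hroots with h' | h'
  · left; rw [hcongr, h']
  · right; rw [hcongr, h', neg_mul]
  · right; rw [mul_neg, hcongr, h']
  · left; rw [mul_neg, hcongr, h', neg_mul, neg_neg]

/-! ### The subspaces `E(λ,s)` and `E(λ,t,a)` -/

/-- `E(λ,s)`: the span of the `ω_{F,s'}` such that the labelled forest `(F,s')` has shape `(λ,s)`. -/
def ELabelled (L : LabelledPartition n) : Subrepresentation (symRep n) where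
  toSubmodule := Submodule.span ℚ {z | ∃ F : LabelledForest n, F.shape = L.blocks ∧ z = F.monomial}
  apply_mem_toSubmodule σ v hv := by
    induction hv using Submodule.span_induction with
    | mem z hz =>
      obtain ⟨F, hF, rfl⟩ := hz
      have hmem : (F.perm σ).monomial ∈ Submodule.span ℚ
          {z | ∃ F : LabelledForest n, F.shape = L.blocks ∧ z = F.monomial} :=
        Submodule.subset_span ⟨F.perm σ, (F.shape_perm σ).trans hF, rfl⟩
      rcases symRep_monomial σ F with h | h <;> rw [h]
      · exact hmem
      · exact Submodule.neg_mem _ hmem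
    | zero => simp
    | add x y _ _ hx hy => rw [map_add]; exact Submodule.add_mem _ hx hy
    | smul c x _ hx => rw [map_smul]; exact Submodule.smul_mem _ c hx

/-- The labelled partitions `(λ, s)` with `deg ∘ s = t` and `|s⁻¹(x)| - |s⁻¹(y)| = a`. -/
def Labellings (T : WeightedPartition n) (a : ℤ) : Set (LabelledPartition n) :=
  {L | toWeighted L = T ∧ torusWeight L = a}

/-- `E(λ,t,a)`: the sum of the `E(λ,s)` with `deg ∘ s = t` and `|s⁻¹(x)| - |s⁻¹(y)| = a`. -/
def EWeighted (T : WeightedPartition n) (a : ℤ) : Subrepresentation (symRep n) where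
  toSubmodule := ⨆ L ∈ Labellings T a, (ELabelled L).toSubmodule
  apply_mem_toSubmodule σ v hv := by
    have h : (⨆ L ∈ Labellings T a, (ELabelled L).toSubmodule).map (symRep n σ)
        ≤ ⨆ L ∈ Labellings T a, (ELabelled L).toSubmodule := by
      simp only [Submodule.map_iSup]
      refine iSup₂_mono fun L _ => ?_
      rintro _ ⟨z, hz, rfl⟩
      exact (ELabelled L).apply_mem_toSubmodule σ hz
    exact h ⟨v, hv, rfl⟩

/-- The number of blocks of `λ`. -/
def numBlocks (T : WeightedPartition n) : ℕ := Multiset.card T.blocks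

/-- The total weight `∑ t(i)`. -/
def totalWeight (T : WeightedPartition n) : ℕ := (T.blocks.map fun b => (b.2 : ℕ)).sum

/-! ### The groups `Z(λ,s)` and the characters `ξ(λ,s)` -/

/-- A model of `{1, …, n}` adapted to `(λ,s)`: the disjoint union of cyclic sets `ℤ/k`, one for each
block, arranged by the type `c = (k, l)` of the block (size and label); `⟨c, j, u⟩` is the element
`u` of the `j`-th block of type `c`. The permutation `σ` of shape `λ` is `u ↦ u + 1` on each
block. -/
abbrev Points (L : LabelledPartition n) : Type :=
  Σ c : L.blocks.toFinset, Fin (L.blocks.count c.1) × ZMod c.1.1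

theorem nonempty_points_equiv (L : LabelledPartition n) : Nonempty (Points L ≃ Fin n) := by
  classical
  have : ∀ c : L.blocks.toFinset, NeZero c.1.1 := fun c =>
    ⟨(L.pos c.1 (Multiset.mem_toFinset.1 c.2)).ne'⟩
  refine ⟨Fintype.equivFinOfCardEq ?_⟩
  rw [Fintype.card_sigma]
  simp only [Fintype.card_prod, Fintype.card_fin, ZMod.card]
  rw [Finset.sum_coe_sort L.blocks.toFinset fun c => L.blocks.count c * c.1]
  conv_rhs => rw [← L.sum_eq, Finset.sum_multiset_map_count]
  simp

/-- `g` permutes the blocks of each type `c` by `π c` and shifts the `j`-th block of type `c` by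
`s c j`. -/
def IsWreath (L : LabelledPartition n) (g : Equiv.Perm (Points L))
    (π : ∀ c : L.blocks.toFinset, Equiv.Perm (Fin (L.blocks.count c.1)))
    (s : ∀ c : L.blocks.toFinset, Fin (L.blocks.count c.1) → ZMod c.1.1) : Prop :=
  ∀ c j u, g ⟨c, j, u⟩ = ⟨c, π c j, u + s c j⟩

section

variable {L : LabelledPartition n} {g h : Equiv.Perm (Points L)}
  {π π' : ∀ c : L.blocks.toFinset, Equiv.Perm (Fin (L.blocks.count c.1))}
  {s s' : ∀ c : L.blocks.toFinset, Fin (L.blocks.count c.1) → ZMod c.1.1}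

theorem IsWreath.mul (hg : IsWreath L g π s) (hh : IsWreath L h π' s') :
    IsWreath L (g * h) (fun c => π c * π' c) (fun c j => s' c j + s c (π' c j)) := by
  intro c j u
  rw [Equiv.Perm.mul_apply, hh, hg, add_assoc]
  rfl

theorem IsWreath.one : IsWreath L 1 (fun _ => 1) (fun _ _ => 0) := by
  intro c j u
  simp

theorem IsWreath.inv (hg : IsWreath L g π s) :
    IsWreath L g⁻¹ (fun c => (π c)⁻¹) (fun c j => -s c ((π c)⁻¹ j)) := by
  intro c j u
  rw [Equiv.Perm.inv_eq_iff_eq, hg]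
  simp

theorem IsWreath.unique (hg : IsWreath L g π s) (hg' : IsWreath L g π' s') : π = π' ∧ s = s' := by
  have key : ∀ c j, π c j = π' c j ∧ s c j = s' c j := by
    intro c j
    have h := (hg c j 0).symm.trans (hg' c j 0)
    simpa using h
  exact ⟨funext fun c => Equiv.ext fun j => (key c j).1,
    funext fun c => funext fun j => (key c j).2⟩

end

/-- `Z(λ,s) = H(λ) ⋊ N(λ,s)`: the subgroup `H(λ)` generated by the cycles of `σ` consists of the
elements with `π = 1`, and `N(λ,s)`, which exchanges cycles with the same length and label, of those
with `s = 0`. -/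
def Z (L : LabelledPartition n) : Subgroup (Equiv.Perm (Points L)) where
  carrier := {g | ∃ π s, IsWreath L g π s}
  one_mem' := ⟨_, _, IsWreath.one⟩
  mul_mem' := by
    rintro _ _ ⟨_, _, hg⟩ ⟨_, _, hh⟩
    exact ⟨_, _, hg.mul hh⟩
  inv_mem' := by
    rintro _ ⟨_, _, hg⟩
    exact ⟨_, _, hg.inv⟩

/-- The permutation of the blocks of type `c`. -/
def blockPerm {L : LabelledPartition n} (g : Z L) (c : L.blocks.toFinset) :
    Equiv.Perm (Fin (L.blocks.count c.1)) := g.2.choose c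

/-- The shift of the `j`-th block of type `c`. -/
def blockShift {L : LabelledPartition n} (g : Z L) (c : L.blocks.toFinset)
    (j : Fin (L.blocks.count c.1)) : ZMod c.1.1 := g.2.choose_spec.choose c j

theorem isWreath_block {L : LabelledPartition n} (g : Z L) :
    IsWreath L g.1 (blockPerm g) (blockShift g) := g.2.choose_spec.choose_spec

theorem block_mul {L : LabelledPartition n} (g h : Z L) :
    (blockPerm (g * h) = fun c => blockPerm g c * blockPerm h c) ∧
      blockShift (g * h) = fun c j => blockShift h c j + blockShift g c (blockPerm h c j) :=
  (isWreath_block (g * h)).unique ((isWreath_block g).mul (isWreath_block h))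

theorem block_one {L : LabelledPartition n} :
    (blockPerm (1 : Z L) = fun _ => 1) ∧ blockShift (1 : Z L) = fun _ _ => 0 :=
  (isWreath_block (1 : Z L)).unique IsWreath.one

/-- The one-dimensional character `ξ(λ,s) = ζ_λ ⊠ α(λ,s)` of `Z(λ,s)`, for a choice of characters
`ζ k` of the cyclic groups `ℤ/k`: it is the product of the `ζ k` on `H(λ)`, and on `N(λ,s)` it is the
product of the characters `sgn^(d+1)` of the symmetric groups permuting the blocks of a given size
and given label of degree `d`. -/
def xi (ζ : ∀ k : ℕ, AddChar (ZMod k) ℂ) (L : LabelledPartition n) : Z L →* ℂ where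
  toFun g := ∏ c : L.blocks.toFinset, (∏ j, ζ c.1.1 (blockShift g c j)) *
    ((Equiv.Perm.sign (blockPerm g c) : ℤ) : ℂ) ^ ((c.1.2.deg : ℕ) + 1)
  map_one' := by
    rw [block_one.1, block_one.2]
    simp
  map_mul' g h := by
    rw [(block_mul g h).1, (block_mul g h).2, ← Finset.prod_mul_distrib]
    refine Finset.prod_congr rfl fun c _ => ?_
    simp only [AddChar.map_add_eq_mul, Finset.prod_mul_distrib, map_mul, Units.val_mul,
      Int.cast_mul, mul_pow]
    rw [Equiv.prod_comp (blockPerm h c) fun j => ζ c.1.1 (blockShift g c j)]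
    ring

/-- The one-dimensional representation with a given character. -/
def charRep {G : Type*} [Group G] (χ : G →* ℂ) : Representation ℂ G ℂ :=
  ((Algebra.lmul ℂ ℂ : ℂ →ₐ[ℂ] Module.End ℂ ℂ) : ℂ →* Module.End ℂ ℂ).comp χ

/-- The sign representation `sgn_n`. -/
def sgnRep (n : ℕ) : Representation ℂ (Equiv.Perm (Fin n)) ℂ :=
  charRep ((Int.castRingHom ℂ : ℤ →* ℂ).comp ((Units.coeHom ℤ).comp Equiv.Perm.sign))

/-- The inclusion of `Z(λ,s)` in `S_n` by means of a numbering of the points. -/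
def ZHom (L : LabelledPartition n) (e : Points L ≃ Fin n) : Z L →* Equiv.Perm (Fin n) :=
  (e.permCongrHom : Equiv.Perm (Points L) →* Equiv.Perm (Fin n)).comp (Z L).subtype

/-- `Ind_{Z(λ,s)}^{S_n} ξ(λ,s)`. -/
abbrev indXi (ζ : ∀ k : ℕ, AddChar (ZMod k) ℂ) (L : LabelledPartition n)
    (e : Points L ≃ Fin n) :=
  Representation.ind (ZHom L e) (charRep (xi ζ L))

/-- Extension of scalars from `ℚ` to `ℂ`. -/
def complexify {G W : Type*} [Group G] [AddCommMonoid W] [Module ℚ W]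
    (ρ : Representation ℚ G W) : Representation ℂ G (ℂ ⊗[ℚ] W) :=
  (Module.End.baseChangeHom ℚ ℂ W : Module.End ℚ W →* Module.End ℂ (ℂ ⊗[ℚ] W)).comp ρ

/-- The external tensor product `ρ ⊠ τ` of representations of `G` and `H`. -/
abbrev boxTensor {G H W U : Type*} [Group G] [Group H] [AddCommGroup W] [Module ℚ W]
    [AddCommGroup U] [Module ℚ U] (ρ : Representation ℚ G W) (τ : Representation ℚ H U) :
    Representation ℚ (G × H) (W ⊗[ℚ] U) :=
  Representation.tprod (ρ.comp (MonoidHom.fst G H)) (τ.comp (MonoidHom.snd G H))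

end BraidElliptic

end

/-!
The algebra is understood through *labelled words*: products of paths `ω_{a,b} ω_{b,c} ⋯` on
disjoint sets of points, each multiplied by a label `1`, `x`, `y` or `xy` at one of its points. The
Arnold relation turns a tree into a combination of paths on the same points, so `E(λ,s)` is spanned
by the products of labelled words with sizes and labels `(λ,s)` (`ELabelled_eq_span`), and the
component of bidegree `(p,q)` is the sum of the `E(λ,s)` with `n - q` blocks and total degree `p`
(`E2_eq_iSup`). That these sums are direct, and the dimension of each `E(λ,s)`, come from comparing
two bounds.

*Upper bound.* The Arnold relation makes the signed sums of shuffles of two words vanish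
(`IsEdgeSystem.sum_shuffles`). As in Klyachko's theorem on the Lie representations, averaging a
word over all orders of its letters with the weights `q^maj`, for a primitive root of unity `q`, is
therefore a nonzero multiple of the word, and it is a combination of eigenvectors of the rotations
(`IsEdgeSystem.pathWord_mem_span_cyclicVector`). Products of such eigenvectors, one for each
numbering of the points of the blocks, span `ℂ ⊗ E(λ,s)`, and `Z(λ,s)` acts on them by the
character `sgn ⊗ ξ(λ,s)` (`eigenVec_trans`). Hence `ℂ ⊗ E(λ,s)` is a quotient of
`sgn ⊗ Ind ξ(λ,s)`, and `dim E(λ,s)` is at most the index of `Z(λ,s)`. The cosets of all the groups `Z(λ,s)`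
correspond to the permutations with labelled cycles, so the indices add up to at most
`4 · 5 ⋯ (n + 3)` (`sum_index_le`).

*Lower bound.* The contractions with the dual basis of `x, y` at the last point and the residues
along the divisors `P_i = P_{n+1}` show that `1, x_{n+1}, y_{n+1}, x_{n+1} y_{n+1}, ω_{i,n+1}` are
independent over the algebra of `n` points (`pointBasis_injective`). Hence the dimension of the
whole algebra is at least `4 · 5 ⋯ (n + 3)` (`le_finrank_E2Alg`).

So all the inequalities are equalities (`sum_finrank_ELabelled`): the `E(λ,s)` are independent
(`iSupIndep_ELabelled`), and the maps from the induced representations are isomorphisms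
(`nonempty_complexify_equiv`).

For the decomposition under `SL_2`, the Lie algebra `sl_2` acts by derivations, and `E(λ,t,a)` is
the space of weight `a` of a weight module (`isWeightFamily_EWeighted`). As `e f` is bijective on
the spaces of positive weight, `E(λ,t,a)` is for `a ≥ 0` the direct sum of its highest weight
vectors and of `f E(λ,t,a+2)`, which is a copy of `E(λ,t,a+2)` (`nonempty_highest_prod_equiv`). The
highest weight vectors are thus the module `E(λ,t,a) ⊖ E(λ,t,a+2)`. The unipotent matrices act by
the exponentials of `e` and `f` (`slRep_eq_exp`) and generate `SL_2(ℚ)`, so a highest weight vector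
of weight `a` generates a copy of `𝕍_a` (`slRep_formMap`). These copies exhaust the homogeneous
components (`iSup_range_stringMap`), and a count of dimensions shows that their sum is direct
(`nonempty_E2_equiv`).

If `𝕍_a` occurs in a component, then the image of `X_0^a` is an eigenvector of `diag(2, 1/2)` with
eigenvalue `2^a`, so some `E(λ,s)` in the component has weight `a`, and the bounds hold for each
block (`Occurs.bounds`). For the quotient by the translations, the multiplication by the invariant
`x_1 y_1` is injective on the subalgebra generated by the differences and the `ω_{i,j}`, because
the contractions along the diagonal translations vanish on it (`eq_zero_of_mul_labelClass_xy`). So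
an occurrence in bidegree `(p,q)` gives one in `E_2^{p+2,q}`, and the bound improves by `2`.
-/

open scoped TensorProduct DirectSum MatrixGroups

noncomputable section

namespace BraidElliptic

/-! ### Words in a system of edge classes -/

/-- A family of elements `ω i j` of a ring satisfying the relations between the classes of the
divisors `P_i = P_j`. -/
structure IsEdgeSystem {ι B : Type*} [Ring B] (ω : ι → ι → B) : Prop where
  symm : ∀ i j, ω i j = ω j i
  self : ∀ i, ω i i = 0
  anti : ∀ i j k l, ω i j * ω k l = -(ω k l * ω i j)
  sq : ∀ i j, ω i j * ω i j = 0
  arnold : ∀ i j k, ω i j * ω j k + ω j k * ω k i + ω k i * ω i j = 0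

/-- The product `ω_{a,b} ω_{b,c} ⋯` along the word `a b c ⋯`, given by its first letter and the
remaining ones. -/
def path {ι B : Type*} [Ring B] (ω : ι → ι → B) : ι → List ι → B
  | _, [] => 1
  | a, b :: w => ω a b * path ω b w

/-- All the shuffles of two words. -/
def shuffles {ι : Type*} : List ι → List ι → List (List ι)
  | [], v => [v]
  | a :: u, [] => [a :: u]
  | a :: u, b :: v => (shuffles u (b :: v)).map (a :: ·) ++ (shuffles (a :: u) v).map (b :: ·)
termination_by u v => u.length + v.length

/-- The sign of the permutation that sorts a word without repetitions. -/
def wordSign {ι : Type*} [LinearOrder ι] : List ι → ℤ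
  | [] => 1
  | a :: w => (w.map fun b => if a < b then (1 : ℤ) else -1).prod * wordSign w

section

variable {ι B : Type*} [Ring B] {ω : ι → ι → B}

@[simp] theorem path_nil (a : ι) : path ω a [] = 1 := rfl

@[simp] theorem path_cons (a b : ι) (w : List ι) : path ω a (b :: w) = ω a b * path ω b w := rfl

theorem path_comp {κ : Type*} (f : κ → ι) (a : κ) (w : List κ) :
    path (fun i j => ω (f i) (f j)) a w = path ω (f a) (w.map f) := by
  induction w generalizing a with
  | nil => rfl
  | cons b w ih => simp [ih]

theorem map_path {C : Type*} [Ring C] (φ : B →+* C) (a : ι) (w : List ι) :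
    φ (path ω a w) = path (fun i j => φ (ω i j)) a w := by
  induction w generalizing a with
  | nil => simp
  | cons b w ih => simp [ih]

theorem IsEdgeSystem.comp {κ : Type*} (h : IsEdgeSystem ω) (f : κ → ι) :
    IsEdgeSystem fun i j => ω (f i) (f j) :=
  ⟨fun _ _ => h.symm _ _, fun _ => h.self _, fun _ _ _ _ => h.anti _ _ _ _, fun _ _ => h.sq _ _,
    fun _ _ _ => h.arnold _ _ _⟩

theorem IsEdgeSystem.map {C : Type*} [Ring C] (h : IsEdgeSystem ω) (φ : B →+* C) :
    IsEdgeSystem fun i j => φ (ω i j) := by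
  refine ⟨fun i j => by rw [h.symm], fun i => by rw [h.self, map_zero], fun i j k l => ?_,
    fun i j => by rw [← map_mul, h.sq, map_zero], fun i j k => ?_⟩
  · rw [← map_mul, h.anti, map_neg, map_mul]
  · rw [← map_mul, ← map_mul, ← map_mul, ← map_add, ← map_add, h.arnold, map_zero]

theorem IsEdgeSystem.triangle (h : IsEdgeSystem ω) (u a b : ι) :
    ω u a * ω u b = ω u a * ω a b - ω u b * ω b a := by
  have h1 := h.arnold u a b
  have h2 : ω a b * ω b u = -(ω u b * ω b a) := by rw [h.anti, h.symm b u, h.symm a b]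
  have h3 : ω b u * ω u a = -(ω u a * ω u b) := by rw [h.anti, h.symm b u]
  rw [h2, h3] at h1
  rw [← sub_eq_zero, ← neg_eq_zero, ← h1]
  abel

theorem IsEdgeSystem.path_mul (h : IsEdgeSystem ω) (a : ι) (w : List ι) (i j : ι) :
    path ω a w * ω i j = (-1) ^ w.length * (ω i j * path ω a w) := by
  induction w generalizing a with
  | nil => simp
  | cons b w ih =>
    rw [path_cons, mul_assoc, ih, List.length_cons, pow_succ, ← mul_assoc, ← mul_assoc]
    rcases neg_one_pow_eq_or B w.length with h' | h' <;> rw [h'] <;>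
      simp [h.anti i j a b, ← mul_assoc]

theorem perm_of_mem_shuffles {u v w : List ι} (h : w ∈ shuffles u v) : w.Perm (u ++ v) := by
  induction u, v using shuffles.induct generalizing w with
  | case1 v => simp [shuffles] at h; simp [h]
  | case2 a u => simp [shuffles] at h; simp [h]
  | case3 a u b v ih1 ih2 =>
    rw [shuffles, List.mem_append, List.mem_map, List.mem_map] at h
    rcases h with ⟨z, hz, rfl⟩ | ⟨z, hz, rfl⟩
    · exact (ih1 hz).cons a
    · exact ((ih2 hz).cons b).trans (List.perm_middle (l₁ := a :: u)).symm

/-- One step of the shuffle of two words starting at the same letter. -/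
theorem IsEdgeSystem.path_mul_path_step (h : IsEdgeSystem ω) (a b c : ι) (u v : List ι) :
    path ω a (b :: u) * path ω a (c :: v)
      = ω a b * (path ω b u * path ω b (c :: v))
        - (-1 : ℤ) ^ u.length • (ω a c * (path ω c (b :: u) * path ω c v)) := by
  have h1 : path ω a (b :: u) * path ω a (c :: v)
      = (-1) ^ u.length * ((ω a b * ω a c) * path ω b u * path ω c v) := by
    rw [path_cons, path_cons, mul_assoc, ← mul_assoc _ (ω a c), h.path_mul]
    rcases neg_one_pow_eq_or B u.length with h' | h' <;> rw [h'] <;> simp [mul_assoc]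
  have h2 : path ω b u * path ω b (c :: v)
      = (-1) ^ u.length * (ω b c * path ω b u * path ω c v) := by
    rw [path_cons, ← mul_assoc, h.path_mul]
    simp only [mul_assoc]
  rw [h1, h2, h.triangle, path_cons]
  have h3 : ((-1 : ℤ) ^ u.length) • (ω a c * (ω c b * path ω b u * path ω c v))
      = (-1) ^ u.length * (ω a c * (ω c b * path ω b u * path ω c v)) := by
    rw [zsmul_eq_mul]
    simp
  rw [h3]
  rcases neg_one_pow_eq_or B u.length with h' | h' <;> rw [h'] <;> simp [mul_assoc, sub_mul]
  abel

theorem IsEdgeSystem.path_mul_path_mem (h : IsEdgeSystem ω) (R : Type*) [CommRing R] [Algebra R B]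
    (a : ι) (u v : List ι) :
    path ω a u * path ω a v ∈ Submodule.span R {z | ∃ w : List ι, w.Perm (u ++ v) ∧
      z = path ω a w} := by
  induction u, v using shuffles.induct generalizing a with
  | case1 v => exact Submodule.subset_span ⟨v, by simp, by simp⟩
  | case2 b u => exact Submodule.subset_span ⟨b :: u, by simp, by simp⟩
  | case3 b u c v ih1 ih2 =>
    have key : ∀ (d : ι) (m m' : List ι) (x : B), (d :: m).Perm m' →
        x ∈ Submodule.span R {z | ∃ w : List ι, w.Perm m ∧ z = path ω d w} →
        ω a d * x ∈ Submodule.span R {z | ∃ w : List ι, w.Perm m' ∧ z = path ω a w} := by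
      intro d m m' x hm hx
      induction hx using Submodule.span_induction with
      | mem x hx =>
        obtain ⟨w, hw, rfl⟩ := hx
        exact Submodule.subset_span ⟨d :: w, (hw.cons d).trans hm, rfl⟩
      | zero => simp
      | add x y _ _ hx hy => rw [mul_add]; exact Submodule.add_mem _ hx hy
      | smul r x _ hx => rw [mul_smul_comm]; exact Submodule.smul_mem _ r hx
    rw [h.path_mul_path_step]
    have e1 := key b _ (b :: u ++ c :: v) _ (List.Perm.refl _) (ih1 b)
    have e2 := key c _ (b :: u ++ c :: v) _ (List.perm_middle (l₁ := b :: u)).symm (ih2 c)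
    refine Submodule.sub_mem _ e1 ?_
    rcases neg_one_pow_eq_or ℤ u.length with h' | h' <;> rw [h']
    · rwa [one_smul]
    · rw [neg_one_smul]; exact Submodule.neg_mem _ e2

/-- A closed walk has vanishing class. -/
theorem IsEdgeSystem.edge_mul_path_of_mem (h : IsEdgeSystem ω) {a v : ι} {w : List ι} (hv : v ∈ w) :
    ω a v * path ω a w = 0 := by
  induction w generalizing a with
  | nil => simp at hv
  | cons b w ih =>
    rw [path_cons, ← mul_assoc]
    by_cases hb : v = b
    · rw [hb, h.sq, zero_mul]
    · have h1 : ω b v * path ω b w = 0 := ih ((List.mem_cons.1 hv).resolve_left hb)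
      rw [h.triangle, h.symm v b, sub_mul, mul_assoc, mul_assoc, h1, mul_zero, mul_zero, sub_zero]

/-- Reversing a word changes the class at most by a sign. -/
theorem IsEdgeSystem.exists_path_reverse (h : IsEdgeSystem ω) (a : ι) (l : List ι) (u : ι)
    (r : List ι) :
    path ω a (l ++ u :: r) = path ω u ((a :: l).reverse) * path ω u r ∨
      path ω a (l ++ u :: r) = -(path ω u ((a :: l).reverse) * path ω u r) := by
  have hconcat : ∀ (x : ι) (w : List ι) (b c : ι),
      path ω x (w ++ [b, c]) = path ω x (w ++ [b]) * ω b c := by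
    intro x w b c
    induction w generalizing x with
    | nil => simp
    | cons y w ih => simp [ih, mul_assoc]
  have hsplit : ∀ (x : ι) (w : List ι) (b : ι) (s : List ι),
      path ω x (w ++ b :: s) = path ω x (w ++ [b]) * path ω b s := by
    intro x w b s
    induction w generalizing x with
    | nil => simp
    | cons y w ih => simp [ih, mul_assoc]
  have hrev : ∀ (x : ι) (w : List ι) (b : ι), path ω x (w ++ [b]) = path ω b (w.reverse ++ [x]) ∨
      path ω x (w ++ [b]) = -path ω b (w.reverse ++ [x]) := by
    intro x w b
    induction w generalizing x with
    | nil => left; simp [h.symm]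
    | cons y w ih =>
      have h1 : path ω b ((y :: w).reverse ++ [x]) = path ω b (w.reverse ++ [y]) * ω y x := by
        rw [List.reverse_cons, List.append_assoc]
        exact hconcat _ _ _ _
      rw [h1, List.cons_append, path_cons, h.path_mul, h.symm y x]
      rcases neg_one_pow_eq_or B (w.reverse ++ [y]).length with h' | h' <;> rw [h'] <;>
        rcases ih y with e | e <;> simp [e]
  rw [hsplit]
  simp only [List.reverse_cons]
  rcases hrev a l u with e | e <;> rw [e] <;> simp

/-- A word can be rewritten in words that start with any prescribed letter. -/
theorem IsEdgeSystem.path_mem_reroot (h : IsEdgeSystem ω) (R : Type*) [CommRing R] [Algebra R B]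
    {a u : ι} {w : List ι} (hu : u ∈ a :: w) :
    ∃ m : List ι, (u :: m).Perm (a :: w) ∧
      path ω a w ∈ Submodule.span R {z | ∃ w' : List ι, w'.Perm m ∧ z = path ω u w'} := by
  rcases List.mem_cons.1 hu with rfl | hu
  · exact ⟨w, List.Perm.refl _, Submodule.subset_span ⟨w, List.Perm.refl _, rfl⟩⟩
  · obtain ⟨l, r, rfl⟩ := List.append_of_mem hu
    refine ⟨(a :: l).reverse ++ r, ?_, ?_⟩
    · refine (List.perm_middle.symm).trans ?_
      exact (List.reverse_perm (a :: l)).append_right _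
    · have h1 := h.path_mul_path_mem R u ((a :: l).reverse) r
      rcases h.exists_path_reverse a l u r with e | e <;> rw [e]
      · exact h1
      · exact Submodule.neg_mem _ h1

end

section

variable {ι B : Type*} [Ring B] {ω : ι → ι → B} [LinearOrder ι]

theorem wordSign_perm_factor {a : ι} {w w' : List ι} (h : w.Perm w') :
    (w.map fun b => if a < b then (1 : ℤ) else -1).prod
      = (w'.map fun b => if a < b then (1 : ℤ) else -1).prod :=
  (h.map _).prod_eq

theorem wordSign_factor_lt {a : ι} {w : List ι} (h : ∀ b ∈ w, a < b) :
    (w.map fun b => if a < b then (1 : ℤ) else -1).prod = 1 := by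
  apply List.prod_eq_one
  intro x hx
  obtain ⟨b, hb, rfl⟩ := List.mem_map.1 hx
  simp [h b hb]

theorem wordSign_factor_gt {a : ι} {w : List ι} (h : ∀ b ∈ w, b < a) :
    (w.map fun b => if a < b then (1 : ℤ) else -1).prod = (-1) ^ w.length := by
  induction w with
  | nil => simp
  | cons b w ih =>
    rw [List.map_cons, List.prod_cons, ih fun c hc => h c (by simp [hc]),
      if_neg (h b (by simp)).not_gt, List.length_cons, pow_succ']

/-- The product of two words with the same first letter is the signed sum of the shuffles. -/
theorem IsEdgeSystem.path_mul_path (h : IsEdgeSystem ω) (a : ι) (u v : List ι)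
    (huv : ∀ x ∈ u, ∀ y ∈ v, x < y) :
    (wordSign u * wordSign v) • (path ω a u * path ω a v)
      = ((shuffles u v).map fun w => wordSign w • path ω a w).sum := by
  induction u, v using shuffles.induct generalizing a with
  | case1 v => simp [shuffles, wordSign]
  | case2 b u => simp [shuffles, wordSign]
  | case3 b u c v ih1 ih2 =>
    have ih1 := ih1 b fun x hx y hy => huv x (by simp [hx]) y hy
    have ih2 := ih2 c fun x hx y hy => huv x hx y (by simp [hy])
    have e1 : ((shuffles u (c :: v)).map fun w => wordSign (b :: w) • path ω a (b :: w)).sum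
        = ((u.map fun x => if b < x then (1 : ℤ) else -1).prod * (wordSign u * wordSign (c :: v)))
          • (ω a b * (path ω b u * path ω b (c :: v))) := by
      rw [mul_smul, ← mul_smul_comm, ih1, ← List.sum_map_mul_left, List.smul_sum, List.map_map]
      congr 1
      refine List.map_congr_left fun w hw => ?_
      have : (w.map fun x => if b < x then (1 : ℤ) else -1).prod
          = (u.map fun x => if b < x then (1 : ℤ) else -1).prod := by
        rw [wordSign_perm_factor (perm_of_mem_shuffles hw), List.map_append, List.prod_append,
          wordSign_factor_lt (w := c :: v) fun y hy => huv b (by simp) y hy, mul_one]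
      simp only [wordSign, this, path_cons, Function.comp_apply, mul_smul_comm, smul_smul]
    have e2 : ((shuffles (b :: u) v).map fun w => wordSign (c :: w) • path ω a (c :: w)).sum
        = ((-1) ^ (u.length + 1) * (v.map fun x => if c < x then (1 : ℤ) else -1).prod
            * (wordSign (b :: u) * wordSign v))
          • (ω a c * (path ω c (b :: u) * path ω c v)) := by
      rw [mul_smul, ← mul_smul_comm, ih2, ← List.sum_map_mul_left, List.smul_sum, List.map_map]
      congr 1
      refine List.map_congr_left fun w hw => ?_
      have : (w.map fun x => if c < x then (1 : ℤ) else -1).prod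
          = (-1) ^ (u.length + 1) * (v.map fun x => if c < x then (1 : ℤ) else -1).prod := by
        rw [wordSign_perm_factor (perm_of_mem_shuffles hw), List.map_append, List.prod_append,
          wordSign_factor_gt (w := b :: u) fun y hy => huv y hy c (by simp), List.length_cons]
      simp only [wordSign, this, path_cons, Function.comp_apply, mul_smul_comm, smul_smul]
    rw [shuffles, List.map_append, List.map_map, List.map_map, List.sum_append]
    simp only [Function.comp_def]
    rw [e1, e2, h.path_mul_path_step, smul_sub, smul_smul, sub_eq_add_neg, ← neg_smul]
    congr 2
    · simp only [wordSign]
      ring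
    · simp only [wordSign]
      ring

end

/-! ### Signed sums of shuffles vanish -/

/-- The product `ω_{a,b} ω_{b,c} ⋯` along a word `a b c ⋯`. -/
def pathWord {ι B : Type*} [Ring B] (ω : ι → ι → B) : List ι → B
  | [] => 1
  | a :: w => path ω a w

section

variable {ι B : Type*} [Ring B] {ω : ι → ι → B}

theorem mem_shuffles_iff {p : ι → Prop} [DecidablePred p] {u v w : List ι} (hu : ∀ x ∈ u, p x)
    (hv : ∀ x ∈ v, ¬p x) :
    w ∈ shuffles u v ↔ w.filter (fun x => p x) = u ∧ w.filter (fun x => ¬p x) = v := by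
  induction u, v using shuffles.induct generalizing w with
  | case1 v =>
    rw [shuffles, List.mem_singleton]
    constructor
    · rintro rfl
      exact ⟨by simpa using hv, by simpa using hv⟩
    · rintro ⟨h1, h2⟩
      rw [← h2]
      refine (List.filter_eq_self.2 ?_).symm
      simpa using h1
  | case2 a u =>
    rw [shuffles, List.mem_singleton]
    constructor
    · rintro rfl
      exact ⟨by simpa using hu, by simpa using hu⟩
    · rintro ⟨h1, h2⟩
      rw [← h1]
      refine (List.filter_eq_self.2 ?_).symm
      simpa using h2
  | case3 a u b v ih1 ih2 =>
    have ha := hu a (by simp)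
    have hb := hv b (by simp)
    rw [shuffles, List.mem_append, List.mem_map, List.mem_map]
    cases w with
    | nil => simp
    | cons c w =>
      by_cases hc : p c
      · have hcb : b ≠ c := fun h => hb (h ▸ hc)
        have := ih1 (w := w) (fun x hx => hu x (by simp [hx])) hv
        simp only [List.cons.injEq, hcb, false_and, and_false, exists_false, or_false,
          List.filter_cons, hc, decide_true, if_true, not_true, decide_false]
        grind
      · have hca : a ≠ c := fun h => hc (h ▸ ha)
        have := ih2 (w := w) hu (fun x hx => hv x (by simp [hx]))
        simp only [List.cons.injEq, hca, false_and, and_false, exists_false, false_or,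
          List.filter_cons, hc, decide_true, if_true, not_false_eq_true, decide_false]
        grind

theorem nodup_shuffles {p : ι → Prop} {u v : List ι} (hu : ∀ x ∈ u, p x)
    (hv : ∀ x ∈ v, ¬p x) : (shuffles u v).Nodup := by
  induction u, v using shuffles.induct with
  | case1 v => simp [shuffles]
  | case2 a u => simp [shuffles]
  | case3 a u b v ih1 ih2 =>
    rw [shuffles]
    refine List.Nodup.append ((ih1 (fun x hx => hu x (by simp [hx])) hv).map ?_)
      ((ih2 hu fun x hx => hv x (by simp [hx])).map ?_) ?_
    · exact fun x y h => by simpa using h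
    · exact fun x y h => by simpa using h
    · intro x h1 h2
      obtain ⟨y, _, rfl⟩ := List.mem_map.1 h1
      obtain ⟨z, _, hz⟩ := List.mem_map.1 h2
      rw [List.cons.injEq] at hz
      exact hv b (by simp) (hz.1 ▸ hu a (by simp))

/-- The signed sum of the shuffles of two nonempty words vanishes. -/
theorem IsEdgeSystem.sum_shuffles [LinearOrder ι] (h : IsEdgeSystem ω) {u v : List ι}
    (hu : u ≠ []) (hv : v ≠ []) (huv : ∀ x ∈ u, ∀ y ∈ v, x < y) :
    ((shuffles u v).map fun w => wordSign w • pathWord ω w).sum = 0 := by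
  obtain ⟨a, u, rfl⟩ := List.exists_cons_of_ne_nil hu
  obtain ⟨b, v, rfl⟩ := List.exists_cons_of_ne_nil hv
  have e1 : ((shuffles u (b :: v)).map fun w => wordSign (a :: w) • path ω a w).sum
      = ((u.map fun x => if a < x then (1 : ℤ) else -1).prod * (wordSign u * wordSign (b :: v)))
        • (path ω a u * path ω a (b :: v)) := by
    rw [mul_smul, h.path_mul_path a u (b :: v) fun x hx y hy => huv x (by simp [hx]) y hy,
      List.smul_sum, List.map_map]
    congr 1
    refine List.map_congr_left fun w hw => ?_
    have : (w.map fun x => if a < x then (1 : ℤ) else -1).prod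
        = (u.map fun x => if a < x then (1 : ℤ) else -1).prod := by
      rw [wordSign_perm_factor (perm_of_mem_shuffles hw), List.map_append, List.prod_append,
        wordSign_factor_lt (w := b :: v) fun y hy => huv a (by simp) y hy, mul_one]
    simp only [wordSign, this, Function.comp_apply, smul_smul]
  have e2 : ((shuffles (a :: u) v).map fun w => wordSign (b :: w) • path ω b w).sum
      = ((-1) ^ (u.length + 1) * (v.map fun x => if b < x then (1 : ℤ) else -1).prod
          * (wordSign (a :: u) * wordSign v))
        • (path ω b (a :: u) * path ω b v) := by
    rw [mul_smul, h.path_mul_path b (a :: u) v fun x hx y hy => huv x hx y (by simp [hy]),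
      List.smul_sum, List.map_map]
    congr 1
    refine List.map_congr_left fun w hw => ?_
    have : (w.map fun x => if b < x then (1 : ℤ) else -1).prod
        = (-1) ^ (u.length + 1) * (v.map fun x => if b < x then (1 : ℤ) else -1).prod := by
      rw [wordSign_perm_factor (perm_of_mem_shuffles hw), List.map_append, List.prod_append,
        wordSign_factor_gt (w := a :: u) fun y hy => huv y hy b (by simp), List.length_cons]
    simp only [wordSign, this, Function.comp_apply, smul_smul]
  have e3 : path ω a u * path ω a (b :: v)
      = (-1 : ℤ) ^ u.length • (path ω b (a :: u) * path ω b v) := by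
    rw [path_cons, path_cons, ← mul_assoc, h.path_mul, h.symm b a, zsmul_eq_mul]
    simp [mul_assoc]
  rw [shuffles, List.map_append, List.map_map, List.map_map, List.sum_append]
  simp only [Function.comp_def, pathWord]
  rw [e1, e2, e3, smul_smul, ← add_smul]
  convert zero_smul ℤ _ using 2
  simp only [wordSign]
  ring

theorem wordSign_ofFn {k : ℕ} [LinearOrder ι] (f : Fin k → ι) :
    wordSign (List.ofFn f) = ∏ i, ∏ j ∈ Finset.Ioi i, if f i < f j then (1 : ℤ) else -1 := by
  induction k with
  | zero => simp [wordSign]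
  | succ k ih =>
    rw [List.ofFn_succ, wordSign, ih, Fin.prod_univ_succ]
    congr 1
    · rw [List.map_ofFn, List.prod_ofFn, Fin.prod_Ioi_zero]
      rfl
    · refine Finset.prod_congr rfl fun i _ => ?_
      rw [Fin.prod_Ioi_succ]

theorem wordSign_perm {k : ℕ} (σ : Equiv.Perm (Fin k)) :
    wordSign (List.ofFn σ) = Equiv.Perm.sign σ := by
  rw [wordSign_ofFn, Equiv.Perm.sign_eq_prod_prod_Ioi]
  simp only [Units.coe_prod]
  refine Finset.prod_congr rfl fun i _ => Finset.prod_congr rfl fun j _ => ?_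
  split_ifs <;> rfl

theorem pair_sublist_ofFn {k : ℕ} (σ : Equiv.Perm (Fin k)) (x y : Fin k) :
    [x, y].Sublist (List.ofFn σ) ↔ σ.symm x < σ.symm y := by
  rw [List.sublist_iff_exists_fin_orderEmbedding_get_eq]
  constructor
  · rintro ⟨f, hf⟩
    have h0 := hf ⟨0, by simp⟩
    have h1 := hf ⟨1, by simp⟩
    simp only [List.get_eq_getElem, List.getElem_cons_zero, List.getElem_cons_succ,
      List.getElem_ofFn] at h0 h1
    rw [h0, h1, Equiv.symm_apply_apply, Equiv.symm_apply_apply]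
    exact f.lt_iff_lt.2 (by simp)
  · intro h
    refine ⟨OrderEmbedding.ofStrictMono (fun i => if i.1 = 0 then ⟨σ.symm x, by simp⟩
      else ⟨σ.symm y, by simp⟩) ?_, ?_⟩
    · rintro ⟨i, hi⟩ ⟨j, hj⟩ hij
      simp at hi hj hij
      have : i = 0 := by omega
      have : j = 1 := by omega
      subst i j
      simpa using h
    · rintro ⟨i, hi⟩
      simp at hi
      interval_cases i <;> simp

end

/-! ### The cyclic eigenvectors generate the top degree of the braid arrangement -/

/-- The weight `q^{maj(σ⁻¹)}`, the product of the powers of `q` given by the descents of `σ⁻¹`. -/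
def majWeight {R : Type*} [CommRing R] {m : ℕ} (q : R) (σ : Equiv.Perm (Fin (m + 1))) : R :=
  ∏ i : Fin m, if σ.symm i.castSucc < σ.symm i.succ then 1 else q ^ (i.1 + 1)

section

variable {B : Type*} [Ring B] {m : ℕ} {ω : Fin (m + 1) → Fin (m + 1) → B}

/-- The signed sum of the arrangements of the letters in which certain pairs of consecutive letters
keep their order vanishes, unless all these pairs do. -/
theorem IsEdgeSystem.sum_ascending (h : IsEdgeSystem ω) {A : Finset (Fin m)} {d : Fin m}
    (hd : d ∉ A) :
    ∑ σ : Equiv.Perm (Fin (m + 1)) with ∀ i ∈ A, σ.symm i.castSucc < σ.symm i.succ,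
      ((Equiv.Perm.sign σ : ℤˣ) : ℤ) • pathWord ω (List.ofFn σ) = 0 := by
  classical
  let p : Fin (m + 1) → Prop := fun x => x ≤ d.castSucc
  let F : Equiv.Perm (Fin (m + 1)) → List (Fin (m + 1)) × List (Fin (m + 1)) := fun σ =>
    ((List.ofFn σ).filter (fun x => p x), (List.ofFn σ).filter (fun x => ¬p x))
  -- The order condition only involves pairs of letters on the same side of the cut at `d`.
  have hasc : ∀ (i : Fin m), i ∈ A → ∀ σ τ : Equiv.Perm (Fin (m + 1)), F σ = F τ →
      σ.symm i.castSucc < σ.symm i.succ → τ.symm i.castSucc < τ.symm i.succ := by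
    intro i hi σ τ hF hσ
    have hid : i ≠ d := fun e => hd (e ▸ hi)
    rw [← pair_sublist_ofFn] at hσ ⊢
    simp only [F, Prod.mk.injEq] at hF
    by_cases hp : p i.castSucc
    · have hp' : p i.succ := by
        simp only [p, Fin.le_def, Fin.val_castSucc, Fin.val_succ] at hp ⊢
        have := Fin.val_ne_of_ne hid
        omega
      have := hσ.filter (fun x => decide (p x))
      rw [hF.1] at this
      simp only [List.filter_cons, hp, hp', decide_true, if_true, List.filter_nil] at this
      exact this.trans List.filter_sublist
    · have hp' : ¬p i.succ := by
        simp only [p, Fin.le_def, Fin.val_castSucc, Fin.val_succ] at hp ⊢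
        omega
      have := hσ.filter (fun x => decide (¬p x))
      rw [hF.2] at this
      simp only [List.filter_cons, hp, hp', decide_true, if_true, List.filter_nil,
        not_false_eq_true] at this
      exact this.trans List.filter_sublist
  rw [← Finset.sum_fiberwise_of_maps_to (g := F) (t := Finset.univ.image F) (by simp)]
  refine Finset.sum_eq_zero fun uv _ => ?_
  obtain ⟨u, v⟩ := uv
  rw [Finset.filter_filter]
  rcases Finset.eq_empty_or_nonempty (Finset.univ.filter fun σ : Equiv.Perm (Fin (m + 1)) =>
    (∀ i ∈ A, σ.symm i.castSucc < σ.symm i.succ) ∧ F σ = (u, v)) with he | ⟨σ₀, hσ₀⟩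
  · rw [he, Finset.sum_empty]
  rw [Finset.mem_filter] at hσ₀
  obtain ⟨-, hasc₀, hF₀⟩ := hσ₀
  have hfil : (Finset.univ.filter fun σ : Equiv.Perm (Fin (m + 1)) =>
      (∀ i ∈ A, σ.symm i.castSucc < σ.symm i.succ) ∧ F σ = (u, v))
      = Finset.univ.filter fun σ : Equiv.Perm (Fin (m + 1)) => F σ = (u, v) := by
    ext σ
    simp only [Finset.mem_filter, Finset.mem_univ, true_and, and_iff_right_iff_imp]
    exact fun hσ i hi => hasc i hi σ₀ σ (hF₀.trans hσ.symm) (hasc₀ i hi)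
  rw [hfil]
  have hF₀' : (List.ofFn σ₀).filter (fun x => p x) = u ∧
      (List.ofFn σ₀).filter (fun x => ¬p x) = v := by simpa [F] using hF₀
  have hu : ∀ x ∈ u, p x := by
    intro x hx
    rw [← hF₀'.1, List.mem_filter] at hx
    simpa using hx.2
  have hv : ∀ x ∈ v, ¬p x := by
    intro x hx
    rw [← hF₀'.2, List.mem_filter] at hx
    simpa using hx.2
  have hmem : ∀ σ : Equiv.Perm (Fin (m + 1)), List.ofFn σ ∈ shuffles u v ↔ F σ = (u, v) := by
    intro σ
    rw [mem_shuffles_iff (p := p) hu hv]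
    simp [F]
  have hsum : ∑ σ : Equiv.Perm (Fin (m + 1)) with F σ = (u, v),
      ((Equiv.Perm.sign σ : ℤˣ) : ℤ) • pathWord ω (List.ofFn σ)
      = ∑ w ∈ (shuffles u v).toFinset, wordSign w • pathWord ω w := by
    refine Finset.sum_bij (fun σ _ => List.ofFn σ) ?_ ?_ ?_ ?_
    · intro σ hσ
      rw [Finset.mem_filter] at hσ
      rw [List.mem_toFinset, hmem]
      exact hσ.2
    · intro σ _ τ _ hst
      exact Equiv.ext fun i => congrFun (List.ofFn_injective hst) i
    · intro w hw
      rw [List.mem_toFinset] at hw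
      have hperm : w.Perm (List.ofFn σ₀) := by
        refine (perm_of_mem_shuffles hw).trans ?_
        exact (perm_of_mem_shuffles ((hmem σ₀).2 hF₀)).symm
      have hlen : w.length = m + 1 := by rw [hperm.length_eq, List.length_ofFn]
      have hnd : w.Nodup := hperm.nodup_iff.2 (List.nodup_ofFn.2 σ₀.injective)
      obtain ⟨f, rfl⟩ : ∃ f : Fin (m + 1) → Fin (m + 1), w = List.ofFn f :=
        ⟨fun i => w.get (i.cast hlen.symm), by
          refine List.ext_getElem (by simp [hlen]) fun i h1 h2 => ?_
          rw [List.getElem_ofFn]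
          rfl⟩
      have hinj := List.nodup_ofFn.1 hnd
      refine ⟨Equiv.ofBijective f (Finite.injective_iff_bijective.1 hinj), ?_, rfl⟩
      rw [Finset.mem_filter, ← hmem]
      exact ⟨Finset.mem_univ _, hw⟩
    · intro σ _
      rw [wordSign_perm]
  rw [hsum, List.sum_toFinset _ (nodup_shuffles hu hv)]
  have hne : ∀ (x : Fin (m + 1)), x ∈ List.ofFn σ₀ := fun x =>
    List.mem_ofFn.2 ⟨σ₀.symm x, by simp⟩
  refine h.sum_shuffles ?_ ?_ ?_
  · refine List.ne_nil_of_mem (a := d.castSucc) ?_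
    rw [← hF₀'.1, List.mem_filter]
    exact ⟨hne _, by simp [p]⟩
  · refine List.ne_nil_of_mem (a := d.succ) ?_
    rw [← hF₀'.2, List.mem_filter]
    exact ⟨hne _, by simp [p]⟩
  · intro x hx y hy
    exact (hu x hx).trans_lt (not_le.1 (hv y hy))

/-- Summing over all arrangements of the letters with the weights `q^maj` multiplies the class of a
word by `∏ (1 - q^i)`, because only the trivial arrangement survives the expansion over sets of
ascents. -/
theorem IsEdgeSystem.sum_majWeight {R : Type*} [CommRing R] [Algebra R B] (h : IsEdgeSystem ω)
    (q : R) :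
    ∑ σ : Equiv.Perm (Fin (m + 1)), majWeight q σ •
      (((Equiv.Perm.sign σ : ℤˣ) : ℤ) • pathWord ω (List.ofFn σ))
      = (∏ i : Fin m, (1 - q ^ (i.1 + 1))) • pathWord ω (List.finRange (m + 1)) := by
  classical
  have hexp : ∀ σ : Equiv.Perm (Fin (m + 1)), majWeight q σ
      = ∑ A : Finset (Fin m), if (∀ i ∈ A, σ.symm i.castSucc < σ.symm i.succ) then
          (∏ i ∈ A, (1 - q ^ (i.1 + 1))) * ∏ i ∈ Finset.univ \ A, q ^ (i.1 + 1) else 0 := by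
    intro σ
    have h1 : majWeight q σ = ∏ i : Fin m,
        ((if σ.symm i.castSucc < σ.symm i.succ then (1 - q ^ (i.1 + 1)) else 0)
          + q ^ (i.1 + 1)) := by
      refine Finset.prod_congr rfl fun i _ => ?_
      split_ifs <;> ring
    rw [h1, Finset.prod_add, Finset.powerset_univ]
    refine Finset.sum_congr rfl fun A _ => ?_
    rw [Finset.prod_ite_zero]
    split_ifs <;> simp
  simp only [hexp, Finset.sum_smul]
  rw [Finset.sum_comm, Finset.sum_eq_single Finset.univ]
  · have : ∀ σ : Equiv.Perm (Fin (m + 1)),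
        (∀ i ∈ (Finset.univ : Finset (Fin m)), σ.symm i.castSucc < σ.symm i.succ) ↔ σ = 1 := by
      intro σ
      constructor
      · intro hσ
        have hmono : StrictMono σ.symm :=
          Fin.strictMono_iff_lt_succ.2 fun i => hσ i (Finset.mem_univ _)
        have := (hmono.range_inj (strictMono_id (α := Fin (m + 1)))).1 (by simp)
        ext x
        have h2 := congrFun this (σ x)
        simp only [Equiv.symm_apply_apply, id] at h2
        simp [← h2]
      · rintro rfl i _
        exact Fin.castSucc_lt_succ
    simp only [this, ite_smul, zero_smul]
    rw [Finset.sum_ite_eq' Finset.univ (1 : Equiv.Perm (Fin (m + 1)))]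
    have hid : List.ofFn ((1 : Equiv.Perm (Fin (m + 1))) : Fin (m + 1) → Fin (m + 1))
        = List.finRange (m + 1) := List.ofFn_id _
    rw [if_pos (Finset.mem_univ _), hid, Equiv.Perm.sign_one]
    simp
  · intro A _ hA
    obtain ⟨d, hd⟩ : ∃ d, d ∉ A := by
      by_contra! hcon
      exact hA (Finset.eq_univ_iff_forall.2 hcon)
    have := h.sum_ascending hd
    rw [Finset.sum_filter] at this
    simp only [ite_smul, zero_smul]
    have h2 := congrArg (((∏ i ∈ A, (1 - q ^ (i.1 + 1))) *
      ∏ i ∈ Finset.univ \ A, q ^ (i.1 + 1)) • ·) this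
    rw [smul_zero, Finset.smul_sum] at h2
    refine Eq.trans (Finset.sum_congr rfl fun σ _ => ?_) h2
    split_ifs
    · rfl
    · rw [smul_zero]
  · simp

/-- Rotating a word changes its major index by one modulo its length. -/
theorem majWeight_mul_addRight_one {R : Type*} [CommRing R] {q : R} (hq : q ^ (m + 1) = 1)
    (σ : Equiv.Perm (Fin (m + 1))) :
    majWeight q (σ * Equiv.addRight 1) = q * majWeight q σ := by
  have hunit : IsUnit q := IsUnit.of_pow_eq_one hq (by omega)
  let p : Fin (m + 1) := σ 0
  have hstep : majWeight q (σ * Equiv.addRight 1)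
      * ∏ i : Fin m, (if i.succ = p then q ^ (i.1 + 1) else 1)
      = majWeight q σ * ∏ i : Fin m, (if i.castSucc = p then q ^ (i.1 + 1) else 1) := by
    rw [majWeight, majWeight, ← Finset.prod_mul_distrib, ← Finset.prod_mul_distrib]
    refine Finset.prod_congr rfl fun i _ => ?_
    have hne : σ.symm i.castSucc ≠ σ.symm i.succ :=
      σ.symm.injective.ne Fin.castSucc_lt_succ.ne
    have h1 : ∀ x, (σ * Equiv.addRight 1).symm x = σ.symm x - 1 := by
      intro x
      rw [Equiv.symm_apply_eq]
      simp
    have h2 : ∀ x, x = p ↔ σ.symm x = 0 := by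
      intro x
      rw [Equiv.symm_apply_eq]
    simp only [h1, h2]
    generalize σ.symm i.castSucc = a at *
    generalize σ.symm i.succ = b at *
    have hsub : ∀ x : Fin (m + 1), (x - 1).1 = if x.1 = 0 then m else x.1 - 1 := by
      intro x
      rw [Fin.coe_sub_one]
      by_cases hx : x = 0
      · simp [hx]
      · rw [if_neg hx, if_neg fun h : x.1 = 0 => hx (Fin.ext h)]
    simp only [Fin.lt_def, hsub, Fin.ext_iff, Fin.val_zero]
    have ha := a.2
    have hb := b.2
    have hne' := Fin.val_ne_of_ne hne
    split_ifs <;> first | omega | simp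
  have h1 : ∏ i : Fin m, (if i.succ = p then q ^ (i.1 + 1) else 1) = q ^ p.1 := by
    have : ∏ j : Fin (m + 1), (if j = p then q ^ j.1 else 1) = q ^ p.1 := by
      rw [Finset.prod_ite_eq' Finset.univ p]; simp
    rw [← this, Fin.prod_univ_succ]
    simp
  have h2 : ∏ i : Fin m, (if i.castSucc = p then q ^ (i.1 + 1) else 1) = q ^ (p.1 + 1) := by
    have : ∏ j : Fin (m + 1), (if j = p then q ^ (j.1 + 1) else 1) = q ^ (p.1 + 1) := by
      rw [Finset.prod_ite_eq' Finset.univ p]; simp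
    rw [← this, Fin.prod_univ_castSucc]
    simp [hq]
  rw [h1, h2] at hstep
  refine (hunit.pow p.1).mul_right_cancel ?_
  rw [hstep]
  ring

theorem majWeight_mul_addRight {R : Type*} [CommRing R] {q : R} (hq : q ^ (m + 1) = 1)
    (σ : Equiv.Perm (Fin (m + 1))) (h : Fin (m + 1)) :
    majWeight q (σ * Equiv.addRight h) = q ^ h.1 * majWeight q σ := by
  have hadd : ∀ a b : Fin (m + 1), Equiv.addRight (a + b)
      = Equiv.addRight a * Equiv.addRight b := by
    intro a b
    apply Equiv.ext
    intro x
    simp only [Equiv.coe_addRight, Equiv.Perm.mul_apply]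
    abel
  have key : ∀ r : ℕ, majWeight q (σ * Equiv.addRight (Fin.ofNat (m + 1) r))
      = q ^ r * majWeight q σ := by
    intro r
    induction r with
    | zero =>
      have : Equiv.addRight (Fin.ofNat (m + 1) 0) = 1 := by
        apply Equiv.ext
        intro x
        simp
      rw [this]
      simp
    | succ r ih =>
      have : Fin.ofNat (m + 1) (r + 1) = Fin.ofNat (m + 1) r + 1 := by
        simp [Fin.ext_iff, Fin.val_add, Fin.ofNat]
      rw [this, hadd, ← mul_assoc, majWeight_mul_addRight_one hq, ih]
      ring
  have h1 := key h.1
  have h2 : Fin.ofNat (m + 1) h.1 = h := by simp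
  rwa [h2] at h1

end

/-- The word `f 0, f 1, …, f (k - 1)`. -/
def cyclicWord {ι : Type*} (k : ℕ) (f : ZMod k → ι) : List ι :=
  (List.range k).map fun i : ℕ => f (i : ZMod k)

theorem finEquiv_apply (m : ℕ) (i : Fin (m + 1)) :
    ZMod.finEquiv (m + 1) i = ((i.1 : ℕ) : ZMod (m + 1)) :=
  (ZMod.natCast_zmod_val (n := m + 1) (ZMod.finEquiv (m + 1) i)).symm

theorem cyclicWord_succ {ι : Type*} (m : ℕ) (f : ZMod (m + 1) → ι) :
    cyclicWord (m + 1) f = List.ofFn fun i => f (ZMod.finEquiv (m + 1) i) := by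
  rw [cyclicWord, List.ofFn_eq_map, ← List.map_coe_finRange_eq_range, List.map_map]
  refine List.map_congr_left fun i _ => ?_
  rw [Function.comp_apply, finEquiv_apply]

/-- The projection of the class of the cyclic word `u ↦ f u` to an eigenspace of the rotations. -/
def cyclicVector {ι B : Type*} [Ring B] [Algebra ℂ B] (ω : ι → ι → B) {k : ℕ} [NeZero k]
    (ζ : AddChar (ZMod k) ℂ) (f : ZMod k → ι) : B :=
  ∑ h : ZMod k, (ζ (-h) * ((Equiv.Perm.sign (Equiv.addRight h) : ℤ) : ℂ)) •
      pathWord ω (cyclicWord k fun u => f (u + h))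

theorem sign_addRight_add {G : Type*} [AddCommGroup G] [Fintype G] [DecidableEq G] (a b : G) :
    Equiv.Perm.sign (Equiv.addRight (a + b))
      = Equiv.Perm.sign (Equiv.addRight a) * Equiv.Perm.sign (Equiv.addRight b) := by
  rw [← Equiv.Perm.sign_mul]
  congr 1
  apply Equiv.ext
  intro x
  simp only [Equiv.coe_addRight, Equiv.Perm.mul_apply]
  abel

theorem intCast_sign_mul_self {α : Type*} [Fintype α] [DecidableEq α] (σ : Equiv.Perm α) :
    ((Equiv.Perm.sign σ : ℤ) : ℂ) * ((Equiv.Perm.sign σ : ℤ) : ℂ) = 1 := by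
  rcases Int.units_eq_one_or (Equiv.Perm.sign σ) with h | h <;> simp [h]

/-- The rotations act on the cyclic vectors by a character. -/
theorem cyclicVector_rotate {ι B : Type*} [Ring B] [Algebra ℂ B] (ω : ι → ι → B) {k : ℕ} [NeZero k]
    (ζ : AddChar (ZMod k) ℂ) (f : ZMod k → ι) (s : ZMod k) :
    cyclicVector ω ζ (fun u => f (u + s))
      = (ζ s * ((Equiv.Perm.sign (Equiv.addRight s) : ℤ) : ℂ)) • cyclicVector ω ζ f := by
  rw [cyclicVector, cyclicVector, Finset.smul_sum]
  conv_rhs => rw [← Equiv.sum_comp (Equiv.addRight s)]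
  refine Finset.sum_congr rfl fun h _ => ?_
  simp only [Equiv.coe_addRight, sign_addRight_add, smul_smul]
  have e : (fun u : ZMod k => f (u + h + s)) = fun u => f (u + (h + s)) := by
    funext u; rw [add_assoc]
  rw [e]
  congr 1
  have h1 : ζ s * ζ (-(h + s)) = ζ (-h) := by
    rw [← AddChar.map_add_eq_mul]
    congr 1
    abel
  rw [← h1]
  push_cast
  linear_combination (-(ζ s * ζ (-(h + s)) * ((Equiv.Perm.sign (Equiv.addRight h) : ℤ) : ℂ)))
    * intCast_sign_mul_self (Equiv.addRight s)

/-- **Klyachko's theorem** for the top degree of the braid arrangement: for a primitive character, the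
class of a word is a combination of the cyclic vectors of its rearrangements. -/
theorem IsEdgeSystem.pathWord_mem_span_cyclicVector {ι B : Type*} [Ring B] [Algebra ℂ B]
    {ω : ι → ι → B} (hω : IsEdgeSystem ω) {k : ℕ} [NeZero k] (ζ : AddChar (ZMod k) ℂ)
    (hζ : Function.Injective ζ) (f : ZMod k → ι) :
    pathWord ω (cyclicWord k f) ∈ Submodule.span ℂ
      {z | ∃ σ : Equiv.Perm (ZMod k), z = cyclicVector ω ζ (f ∘ σ)} := by
  obtain ⟨m, rfl⟩ := Nat.exists_eq_succ_of_ne_zero (NeZero.ne k)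
  let E : Fin (m + 1) ≃+* ZMod (m + 1) := ZMod.finEquiv (m + 1)
  let ω' : Fin (m + 1) → Fin (m + 1) → B := fun i j => ω (f (E i)) (f (E j))
  have hω' : IsEdgeSystem ω' := hω.comp fun i => f (E i)
  have hword : ∀ w : List (Fin (m + 1)), pathWord ω' w = pathWord ω (w.map fun i => f (E i)) := by
    rintro (_ | ⟨a, w⟩)
    · rfl
    · exact path_comp _ _ _
  let q : ℂ := ζ (-1)
  have hqpow : ∀ r : ℕ, q ^ r = ζ (-(r : ZMod (m + 1))) := by
    intro r
    rw [← AddChar.map_nsmul_eq_pow]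
    simp
  have hq : q ^ (m + 1) = 1 := by
    rw [hqpow]
    simp
  have hq1 : ∀ i : Fin m, 1 - q ^ (i.1 + 1) ≠ 0 := by
    intro i hi
    rw [sub_eq_zero, hqpow, ← AddChar.map_zero_eq_one ζ] at hi
    have h0 := hζ hi
    rw [eq_comm, neg_eq_zero, ZMod.natCast_eq_zero_iff] at h0
    have := Nat.le_of_dvd (by omega) h0
    omega
  let X : Equiv.Perm (Fin (m + 1)) → B := fun σ =>
    ((Equiv.Perm.sign σ : ℤˣ) : ℤ) • pathWord ω' (List.ofFn σ)
  have hsum := hω'.sum_majWeight q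
  -- Averaging over the rotations turns the words into cyclic vectors.
  have hcyc : ∀ σ : Equiv.Perm (Fin (m + 1)),
      ∑ h : Fin (m + 1), majWeight q (σ * Equiv.addRight h) • X (σ * Equiv.addRight h)
        = (majWeight q σ * ((Equiv.Perm.sign σ : ℤ) : ℂ)) • cyclicVector ω ζ
          (f ∘ (E.toEquiv.symm.trans (σ.trans E.toEquiv))) := by
    intro σ
    rw [cyclicVector, Finset.smul_sum, ← Equiv.sum_comp E.toEquiv]
    refine Finset.sum_congr rfl fun h _ => ?_
    have hs : Equiv.Perm.sign (Equiv.addRight (E.toEquiv h)) = Equiv.Perm.sign (Equiv.addRight h) := by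
      rw [← Equiv.Perm.sign_permCongr E.toEquiv (Equiv.addRight h)]
      congr 1
    have hEh : E h = ((h.1 : ℕ) : ZMod (m + 1)) := finEquiv_apply m h
    have hz : ζ (-(E.toEquiv h)) = q ^ h.1 := by
      rw [hqpow, ← hEh]
      rfl
    have hw : pathWord ω' (List.ofFn (σ * Equiv.addRight h)) = pathWord ω (cyclicWord (m + 1)
        fun u => (f ∘ (E.toEquiv.symm.trans (σ.trans E.toEquiv))) (u + E.toEquiv h)) := by
      rw [hword, cyclicWord_succ, List.map_ofFn]
      congr 2
    simp only [X]
    rw [hs, hz, ← hw, majWeight_mul_addRight hq, Equiv.Perm.sign_mul, ← Int.cast_smul_eq_zsmul ℂ,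
      smul_smul, smul_smul]
    congr 1
    push_cast
    ring
  have htotal : ((m + 1 : ℕ) : ℂ) • ∑ σ : Equiv.Perm (Fin (m + 1)), majWeight q σ • X σ
      = ∑ σ : Equiv.Perm (Fin (m + 1)), ∑ h : Fin (m + 1),
        majWeight q (σ * Equiv.addRight h) • X (σ * Equiv.addRight h) := by
    rw [Finset.sum_comm]
    have : ∀ h : Fin (m + 1), ∑ σ : Equiv.Perm (Fin (m + 1)),
        majWeight q (σ * Equiv.addRight h) • X (σ * Equiv.addRight h)
        = ∑ σ : Equiv.Perm (Fin (m + 1)), majWeight q σ • X σ := fun h =>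
      Equiv.sum_comp (Equiv.mulRight (Equiv.addRight h)) fun σ => majWeight q σ • X σ
    rw [Finset.sum_congr rfl fun h _ => this h, Finset.sum_const, Finset.card_univ,
      Fintype.card_fin, Nat.cast_smul_eq_nsmul]
  have hfin : pathWord ω (cyclicWord (m + 1) f) = pathWord ω' (List.finRange (m + 1)) := by
    rw [hword, cyclicWord_succ, List.ofFn_eq_map]
  have hne : ((m + 1 : ℕ) : ℂ) * ∏ i : Fin m, (1 - q ^ (i.1 + 1)) ≠ 0 :=
    mul_ne_zero (Nat.cast_ne_zero.2 (Nat.succ_ne_zero m)) (Finset.prod_ne_zero_iff.2 fun i _ => hq1 i)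
  have heq : (((m + 1 : ℕ) : ℂ) * ∏ i : Fin m, (1 - q ^ (i.1 + 1))) •
      pathWord ω (cyclicWord (m + 1) f) ∈ Submodule.span ℂ
      {z | ∃ σ : Equiv.Perm (ZMod (m + 1)), z = cyclicVector ω ζ (f ∘ σ)} := by
    rw [hfin, mul_smul, ← hsum, htotal]
    refine Submodule.sum_mem _ fun σ _ => ?_
    rw [hcyc]
    exact Submodule.smul_mem _ _ (Submodule.subset_span ⟨_, rfl⟩)
  exact (Submodule.smul_mem_iff _ hne).1 heq

/-! ### Homomorphisms out of the algebra and a lower bound for its dimension -/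

/-- Elements of a ring satisfying the defining relations of `E2Alg n`. -/
structure IsE2Family {n : ℕ} {B : Type*} [Ring B] (φ : Gen n → B) : Prop where
  anticomm : ∀ a b, φ a * φ b = -(φ b * φ a)
  edge_self : ∀ i, φ (.edge i i) = 0
  edge_symm : ∀ i j, φ (.edge i j) = φ (.edge j i)
  cls_edge : ∀ c i j, φ (.cls c i) * φ (.edge i j) = φ (.cls c j) * φ (.edge i j)
  arnold : ∀ i j k, φ (.edge i j) * φ (.edge j k) + φ (.edge j k) * φ (.edge k i)
    + φ (.edge k i) * φ (.edge i j) = 0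

section

variable {n : ℕ} {B : Type*} [Ring B] [Algebra ℚ B]

theorem isE2Family_cl : IsE2Family (cl (n := n)) :=
  ⟨cl_anticomm, cl_edge_self, cl_edge_symm, cl_cls_edge, cl_arnold⟩

theorem IsE2Family.lift_rel {φ : Gen n → B} (h : IsE2Family φ) ⦃a b : FreeAlgebra ℚ (Gen n)⦄
    (hab : Rel n a b) : FreeAlgebra.lift ℚ φ a = FreeAlgebra.lift ℚ φ b := by
  cases hab with
  | anticomm a b => simpa using h.anticomm a b
  | edge_self i => simpa using h.edge_self i
  | edge_symm i j => simpa using h.edge_symm i j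
  | cls_edge c i j => simpa using h.cls_edge c i j
  | arnold i j k => simpa using h.arnold i j k

/-- The universal property of `E2Alg n`. -/
def IsE2Family.lift {φ : Gen n → B} (h : IsE2Family φ) : E2Alg n →ₐ[ℚ] B :=
  RingQuot.liftAlgHom ℚ ⟨FreeAlgebra.lift ℚ φ, h.lift_rel⟩

@[simp] theorem IsE2Family.lift_cl {φ : Gen n → B} (h : IsE2Family φ) (g : Gen n) :
    h.lift (cl g) = φ g := by
  have h1 : h.lift (mkE2 n (gen g)) = FreeAlgebra.lift ℚ φ (gen g) :=
    RingQuot.liftAlgHom_mkAlgHom_apply ℚ _ h.lift_rel _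
  rw [cl, h1, FreeAlgebra.lift_ι_apply]

theorem IsE2Family.exists_lift {φ : Gen n → B} (h : IsE2Family φ) :
    ∃ Φ : E2Alg n →ₐ[ℚ] B, ∀ g, Φ (cl g) = φ g := ⟨h.lift, h.lift_cl⟩

theorem E2Alg.induction {P : E2Alg n → Prop} (algebraMap : ∀ r : ℚ, P (algebraMap ℚ _ r))
    (cl : ∀ g, P (cl g)) (mul : ∀ a b, P a → P b → P (a * b)) (add : ∀ a b, P a → P b → P (a + b))
    (a : E2Alg n) : P a := by
  obtain ⟨a, rfl⟩ := RingQuot.mkAlgHom_surjective ℚ (Rel n) a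
  induction a using FreeAlgebra.induction with
  | grade0 r => rw [AlgHom.commutes]; exact algebraMap r
  | grade1 g => exact cl g
  | mul a b ha hb => rw [map_mul]; exact mul _ _ ha hb
  | add a b ha hb => rw [map_add]; exact add _ _ ha hb

/-- The twist of a family by an odd derivation (or a residue) with scalar values `c g` on the
generators. Products of these triangular matrices compute the signs of the Leibniz rule. -/
theorem IsE2Family.extend {φ : Gen n → B} (h : IsE2Family φ) (c : Gen n → ℚ)
    (c_self : ∀ i, c (.edge i i) = 0) (c_symm : ∀ i j, c (.edge i j) = c (.edge j i))
    (c_cls : ∀ d i j, c (.edge i j) • φ (.cls d i) - c (.cls d i) • φ (.edge i j)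
      = c (.edge i j) • φ (.cls d j) - c (.cls d j) • φ (.edge i j))
    (c_arnold : ∀ i j k, c (.edge j k) • (φ (.edge i j) - φ (.edge k i)) = 0) :
    IsE2Family fun g => (!![φ g, algebraMap ℚ B (c g); 0, -φ g] : Matrix (Fin 2) (Fin 2) B) := by
  have hmul : ∀ (a b : B) (r s : ℚ), (!![a, algebraMap ℚ B r; 0, -a] : Matrix (Fin 2) (Fin 2) B)
      * !![b, algebraMap ℚ B s; 0, -b] = !![a * b, s • a - r • b; 0, a * b] := by
    intro a b r s
    rw [Matrix.mul_fin_two, ← Algebra.commutes s a, ← Algebra.smul_def, mul_neg, ← Algebra.smul_def]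
    simp [sub_eq_add_neg, Algebra.smul_def]
  refine ⟨fun a b => ?_, fun i => ?_, fun i j => ?_, fun d i j => ?_, fun i j k => ?_⟩
  · rw [hmul, hmul, h.anticomm a b]
    ext i j
    fin_cases i <;> fin_cases j <;> simp
  · rw [h.edge_self, c_self]
    ext i j
    fin_cases i <;> fin_cases j <;> simp
  · rw [h.edge_symm, c_symm]
  · rw [hmul, hmul, h.cls_edge, c_cls]
  · rw [hmul, hmul, hmul]
    have h1 := c_arnold i j k
    have h2 := c_arnold j k i
    have h3 := c_arnold k i j
    have h4 : (c (.edge j k) • φ (.edge i j) - c (.edge i j) • φ (.edge j k))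
        + (c (.edge k i) • φ (.edge j k) - c (.edge j k) • φ (.edge k i))
        + (c (.edge i j) • φ (.edge k i) - c (.edge k i) • φ (.edge i j)) = 0 := by
      rw [smul_sub] at h1 h2 h3
      have h5 := congrArg₂ (· + ·) (congrArg₂ (· + ·) h1 h2) h3
      simp only [add_zero] at h5
      rw [← h5]
      abel
    ext a b
    fin_cases a <;> fin_cases b <;> simp [h.arnold, h4]

/-- If the images of the generators are lower triangular, so are all the images. -/
theorem map_apply_zero_one (Ψ : E2Alg n →ₐ[ℚ] Matrix (Fin 2) (Fin 2) B)
    (hΨ : ∀ g, Ψ (cl g) 0 1 = 0) (a : E2Alg n) : Ψ a 0 1 = 0 := by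
  induction a using E2Alg.induction with
  | algebraMap r => simp [Matrix.algebraMap_matrix_apply]
  | cl g => exact hΨ g
  | mul a b ha hb => rw [map_mul, Matrix.mul_apply, Fin.sum_univ_two, ha, hb]; simp
  | add a b ha hb => rw [map_add, Matrix.add_apply, ha, hb, add_zero]

/-- If the images of the generators are lower triangular, the first diagonal entry is
multiplicative. -/
theorem map_apply_zero_zero (Ψ : E2Alg n →ₐ[ℚ] Matrix (Fin 2) (Fin 2) B)
    (hΨ : ∀ g, Ψ (cl g) 0 1 = 0) (Φ : E2Alg n →ₐ[ℚ] B) (hΦ : ∀ g, Ψ (cl g) 0 0 = Φ (cl g))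
    (a : E2Alg n) : Ψ a 0 0 = Φ a := by
  induction a using E2Alg.induction with
  | algebraMap r => simp [Matrix.algebraMap_matrix_apply]
  | cl g => exact hΦ g
  | mul a b ha hb =>
    rw [map_mul, Matrix.mul_apply, Fin.sum_univ_two, map_apply_zero_one Ψ hΨ a, ha, hb, zero_mul,
      add_zero, map_mul]
  | add a b ha hb => rw [map_add, Matrix.add_apply, ha, hb, map_add]

/-- Renaming the points. -/
def Gen.map {m : ℕ} (r : Fin n → Fin m) : Gen n → Gen m
  | .cls c i => .cls c (r i)
  | .edge i j => .edge (r i) (r j)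

theorem isE2Family_map {m : ℕ} (r : Fin n → Fin m) : IsE2Family fun g => cl (Gen.map r g) :=
  ⟨fun _ _ => cl_anticomm _ _, fun _ => cl_edge_self _, fun _ _ => cl_edge_symm _ _,
    fun _ _ _ => cl_cls_edge _ _ _, fun _ _ _ => cl_arnold _ _ _⟩

/-- The pullback `E2Alg n → E2Alg (n + 1)` along the projection that forgets the last point. -/
def addPoint (n : ℕ) : E2Alg n →ₐ[ℚ] E2Alg (n + 1) := (isE2Family_map Fin.castSucc).lift

/-- The family of the residue along the divisor `P_i = P_{n+1}`. -/
theorem isE2Family_residue (i : Fin n) :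
    IsE2Family fun g : Gen (n + 1) => (!![cl (Gen.map (Fin.lastCases i id) g),
      algebraMap ℚ _ (match g with
        | .cls _ _ => 0
        | .edge j k => if (j = i.castSucc ∧ k = Fin.last n) ∨ (k = i.castSucc ∧ j = Fin.last n)
          then 1 else 0); 0, -cl (Gen.map (Fin.lastCases i id) g)] :
      Matrix (Fin 2) (Fin 2) (E2Alg n)) := by
  refine (isE2Family_map _).extend _ (fun j => ?_) (fun j k => ?_) (fun d j k => ?_)
    fun j k l => ?_
  · simp only [ite_eq_right_iff, one_ne_zero, imp_false, or_self, not_and]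
    rintro rfl
    exact (Fin.castSucc_lt_last i).ne
  · simp only [or_comm]
  · simp only [Gen.map]
    split_ifs with h
    · rcases h with ⟨rfl, rfl⟩ | ⟨rfl, rfl⟩ <;> simp
    · simp
  · simp only [Gen.map]
    split_ifs with h
    · rcases h with ⟨rfl, rfl⟩ | ⟨rfl, rfl⟩ <;> simp [cl_edge_symm]
    · simp

/-- The family that kills the classes of the last point. -/
theorem isE2Family_kill (n : ℕ) : IsE2Family (n := n + 1) fun g => (match g with
    | .cls c i => Fin.lastCases 0 (fun i => cl (.cls c i)) i
    | .edge i j => Fin.lastCases 0 (fun i => Fin.lastCases 0 (fun j => cl (.edge i j)) j) i :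
      E2Alg n) := by
  refine ⟨?_, ?_, ?_, ?_, ?_⟩
  · rintro (⟨c, i⟩ | ⟨i, j⟩) (⟨d, k⟩ | ⟨k, l⟩)
    · cases i using Fin.lastCases <;> cases k using Fin.lastCases <;> simp [← cl_anticomm]
    · cases i using Fin.lastCases <;> cases k using Fin.lastCases <;>
        cases l using Fin.lastCases <;> simp [← cl_anticomm]
    · cases i using Fin.lastCases <;> cases j using Fin.lastCases <;>
        cases k using Fin.lastCases <;> simp [← cl_anticomm]
    · cases i using Fin.lastCases <;> cases j using Fin.lastCases <;>
        cases k using Fin.lastCases <;> cases l using Fin.lastCases <;> simp [← cl_anticomm]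
  · intro i
    cases i using Fin.lastCases <;> simp [cl_edge_self]
  · intro i j
    cases i using Fin.lastCases <;> cases j using Fin.lastCases <;> simp
    exact cl_edge_symm _ _
  · intro c i j
    cases i using Fin.lastCases <;> cases j using Fin.lastCases <;> simp
    exact cl_cls_edge _ _ _
  · intro i j k
    cases i using Fin.lastCases <;> cases j using Fin.lastCases <;>
      cases k using Fin.lastCases <;> simp
    exact cl_arnold _ _ _

/-- There is a homomorphism that sends the classes `x` and `y` of the last point to nilpotent
matrices, is triangular with diagonal entry `a` on `addPoint n a`, and kills the divisors through the
last point. Its matrix entries are the iterated contractions with the dual basis of `x, y` at the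
last point. -/
theorem exists_killEdges (n : ℕ) : ∃ Φ : E2Alg (n + 1) →ₐ[ℚ]
    Matrix (Fin 2) (Fin 2) (Matrix (Fin 2) (Fin 2) (E2Alg n)),
    (∀ a, Φ (addPoint n a) 0 1 = 0 ∧ Φ (addPoint n a) 0 0 0 1 = 0 ∧
      Φ (addPoint n a) 0 0 0 0 = a) ∧
    (∀ i, Φ (cl (.edge i (Fin.last n))) = 0) ∧
    Φ (cl (.cls 0 (Fin.last n))) = !![!![0, 1; 0, 0], 0; 0, !![0, -1; 0, 0]] ∧
    Φ (cl (.cls 1 (Fin.last n))) = !![0, 1; 0, 0] := by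
  have h1 := (isE2Family_kill n).extend (fun g => match g with
    | .cls c i => if c = 0 ∧ i = Fin.last n then 1 else 0
    | .edge _ _ => 0) (fun _ => rfl) (fun _ _ => rfl) (fun d i j => by
      simp only [zero_smul, zero_sub, neg_inj]
      cases i using Fin.lastCases <;> cases j using Fin.lastCases <;> simp) (fun _ _ _ => by simp)
  have hz : (!![0, 0; 0, 0] : Matrix (Fin 2) (Fin 2) (E2Alg n)) = 0 := by
    ext a b
    fin_cases a <;> fin_cases b <;> rfl
  have h2 := h1.extend (fun g => match g with
    | .cls c i => if c = 1 ∧ i = Fin.last n then 1 else 0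
    | .edge _ _ => 0) (fun _ => rfl) (fun _ _ => rfl) (fun d i j => by
      simp only [zero_smul, zero_sub, neg_inj]
      cases i using Fin.lastCases <;> cases j using Fin.lastCases <;> simp [hz])
    (fun _ _ _ => by simp)
  obtain ⟨Φ, hΦ⟩ := h2.exists_lift
  refine ⟨Φ, ?_, ?_, ?_, ?_⟩
  · intro a
    induction a using E2Alg.induction with
    | algebraMap r => simp [Matrix.algebraMap_matrix_apply]
    | cl g =>
      rw [addPoint, IsE2Family.lift_cl, hΦ]
      cases g with
      | cls c i => simp [Gen.map, (Fin.castSucc_lt_last i).ne]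
      | edge i j => simp [Gen.map]
    | mul a b ha hb =>
      obtain ⟨ha1, ha2, ha3⟩ := ha
      obtain ⟨hb1, hb2, hb3⟩ := hb
      simp [Matrix.mul_apply, Fin.sum_univ_two, ha1, ha2, ha3, hb1, hb2, hb3]
    | add a b ha hb => simp [ha, hb]
  · intro i
    rw [hΦ]
    ext a b c d
    cases i using Fin.lastCases <;> fin_cases a <;> fin_cases b <;> fin_cases c <;> fin_cases d <;>
      simp
  · rw [hΦ]
    ext a b c d
    fin_cases a <;> fin_cases b <;> fin_cases c <;> fin_cases d <;> simp
  · rw [hΦ]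
    ext a b c d
    fin_cases a <;> fin_cases b <;> fin_cases c <;> fin_cases d <;> simp

/-- The elements `1, x, y, xy` of the last point and the `ω_{i,n+1}`, which form a basis of
`E2Alg (n + 1)` over `E2Alg n`; only their independence is used. -/
def pointBasis (n : ℕ) : Fin 4 ⊕ Fin n → E2Alg (n + 1)
  | .inl 0 => 1
  | .inl 1 => cl (.cls 0 (Fin.last n))
  | .inl 2 => cl (.cls 1 (Fin.last n))
  | .inl 3 => cl (.cls 0 (Fin.last n)) * cl (.cls 1 (Fin.last n))
  | .inr i => cl (.edge i.castSucc (Fin.last n))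

/-- The algebra for `n + 1` points contains a free module of rank `n + 4` over that for `n`. -/
theorem pointBasis_injective (n : ℕ) (v : Fin 4 ⊕ Fin n → E2Alg n)
    (hv : ∑ s, addPoint n (v s) * pointBasis n s = 0) : v = 0 := by
  rw [Fintype.sum_sum_type] at hv
  have hinl : ∀ s, v (.inl s) = 0 := by
    obtain ⟨Φ, h1, h2, h3, h4⟩ := exists_killEdges n
    have h5 := congrArg Φ hv
    rw [map_add, map_sum, map_sum, Finset.sum_eq_zero (s := (Finset.univ : Finset (Fin n)))] at h5
    · simp only [Fin.sum_univ_four, pointBasis, map_mul, h3, h4, map_one, mul_one, add_zero,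
        map_zero] at h5
      have e : ∀ i j, _ := fun i j => congrFun (congrFun (congrFun (congrFun h5 0) i) 0) j
      intro s
      have e00 := e 0 0
      have e01 := e 0 1
      have e10 := e 1 0
      have e11 := e 1 1
      simp [Matrix.mul_apply, Fin.sum_univ_two, h1] at e00 e01 e10 e11
      fin_cases s
      · exact e00
      · exact e01
      · exact e10
      · exact e11
    · intro i _
      rw [map_mul, pointBasis, h2, mul_zero]
  funext s
  rcases s with s | i
  · exact hinl s
  · have h5 := congrArg (isE2Family_residue i).lift hv
    simp only [hinl, map_zero, zero_mul, Finset.sum_const_zero, zero_add, map_sum, map_mul] at h5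
    have hg : ∀ g, ((isE2Family_residue i).lift.comp (addPoint n)) (cl g) 0 1 = 0 := by
      rintro (⟨c, j⟩ | ⟨j, k⟩)
      · simp [addPoint, Gen.map]
      · simp [addPoint, Gen.map, (Fin.castSucc_lt_last _).ne]
    have h00 := map_apply_zero_zero ((isE2Family_residue i).lift.comp (addPoint n)) hg
      (AlgHom.id ℚ _) (by
        rintro (⟨c, j⟩ | ⟨j, k⟩)
        · simp [addPoint, Gen.map]
        · simp [addPoint, Gen.map])
    have h01 := map_apply_zero_one ((isE2Family_residue i).lift.comp (addPoint n)) hg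
    have h6 := congrFun (congrFun h5 0) 1
    rw [Matrix.sum_apply] at h6
    simp only [Matrix.mul_apply, Fin.sum_univ_two] at h6
    simp only [AlgHom.comp_apply, AlgHom.id_apply] at h00 h01
    simp only [h00, h01, pointBasis, IsE2Family.lift_cl, zero_mul, add_zero] at h6
    simpa [apply_ite] using h6

/-- The lower bound `4 · 5 ⋯ (n + 3)` for the dimension of `E2Alg n`. -/
theorem le_finrank_E2Alg (hfin : ∀ n, Module.Finite ℚ (E2Alg n)) (n : ℕ) :
    ∏ i ∈ Finset.range n, (4 + i) ≤ Module.finrank ℚ (E2Alg n) := by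
  induction n with
  | zero =>
    have h : IsE2Family (fun _ : Gen 0 => (0 : ℚ)) := by constructor <;> simp
    have : Nontrivial (E2Alg 0) := h.lift.toRingHom.domain_nontrivial
    simpa using Nat.one_le_iff_ne_zero.2 Module.finrank_pos.ne'
  | succ n ih =>
    have hf := hfin n
    have hf' := hfin (n + 1)
    let Θ : (Fin 4 ⊕ Fin n → E2Alg n) →ₗ[ℚ] E2Alg (n + 1) :=
      ∑ s, (LinearMap.mulRight ℚ (pointBasis n s)).comp
        ((addPoint n).toLinearMap.comp (LinearMap.proj s))
    have hΘ : Function.Injective Θ := by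
      rw [injective_iff_map_eq_zero]
      intro v hv
      refine pointBasis_injective n v ?_
      simpa [Θ, LinearMap.sum_apply] using hv
    have h1 := LinearMap.finrank_le_finrank_of_injective hΘ
    rw [Module.finrank_pi_fintype] at h1
    simp only [Finset.sum_const, Finset.card_univ, Fintype.card_sum, Fintype.card_fin,
      smul_eq_mul] at h1
    rw [Finset.prod_range_succ, mul_comm]
    exact (Nat.mul_le_mul_left _ ih).trans h1

end

/-! ### Counting labelled permutations -/

instance : Fintype Label where
  elems := {.one, .x, .y, .xy}
  complete l := by cases l <;> simp

/-- The permutations with a label on each cycle. -/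
abbrev LabelledPerm (n : ℕ) : Type :=
  {x : Equiv.Perm (Fin n) × (Fin n → Label) // ∀ i, x.2 (x.1 i) = x.2 i}

/-- Removing a point from a labelled permutation leaves `n + 4` possibilities: it is a fixed point
with one of four labels, or it precedes one of the other `n` points in its cycle. -/
theorem card_labelledPerm_le (n : ℕ) :
    Nat.card (LabelledPerm n) ≤ ∏ i ∈ Finset.range n, (4 + i) := by
  induction n with
  | zero =>
    have : Subsingleton (LabelledPerm 0) := ⟨fun a b => Subtype.ext (Subsingleton.elim _ _)⟩
    simpa using Finite.card_le_one_iff_subsingleton.2 this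
  | succ n ih =>
    let D : Equiv.Perm (Fin (n + 1)) ≃ Fin (n + 1) × Equiv.Perm (Fin n) := Equiv.Perm.decomposeFin
    have h0 : ∀ σ, σ 0 = (D σ).1 := fun σ => by
      conv_lhs => rw [← D.symm_apply_apply σ]
      exact Equiv.Perm.decomposeFin_symm_apply_zero _ _
    have hs : ∀ σ i, σ (Fin.succ i) = Equiv.swap 0 (D σ).1 ((D σ).2 i).succ := fun σ i => by
      conv_lhs => rw [← D.symm_apply_apply σ]
      exact Equiv.Perm.decomposeFin_symm_apply_succ _ _ _
    let f : LabelledPerm (n + 1) → (Label ⊕ Fin n) × LabelledPerm n := fun x =>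
      ((Fin.cases (motive := fun _ => Label ⊕ Fin n) (.inl (x.1.2 0)) (fun p => .inr p)
        (D x.1.1).1), ⟨((D x.1.1).2, fun i => x.1.2 i.succ), fun i => by
          have h1 := x.2 i.succ
          have h2 := x.2 0
          rw [hs] at h1
          rw [h0] at h2
          dsimp only
          rw [← h1]
          by_cases h : ((D x.1.1).2 i).succ = (D x.1.1).1
          · rw [h, Equiv.swap_apply_right, h2]
          · rw [Equiv.swap_apply_of_ne_of_ne (Fin.succ_ne_zero _) h]⟩)
    have hf : Function.Injective f := by
      rintro ⟨⟨σ, ℓ⟩, hx⟩ ⟨⟨τ, m⟩, hy⟩ h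
      simp only [f, Prod.mk.injEq, Subtype.mk.injEq] at h
      obtain ⟨h1, h2, h3⟩ := h
      have hx0 : ℓ (D σ).1 = ℓ 0 := by rw [← h0]; exact hx 0
      have hy0 : m (D τ).1 = m 0 := by rw [← h0]; exact hy 0
      have hp : (D σ).1 = (D τ).1 ∧ ℓ 0 = m 0 := by
        rcases Fin.eq_zero_or_eq_succ (D σ).1 with hp | ⟨p, hp⟩ <;>
          rcases Fin.eq_zero_or_eq_succ (D τ).1 with hq | ⟨q, hq⟩ <;>
          rw [hp, hq] at h1 ⊢ <;> simp at h1
        · exact ⟨rfl, h1⟩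
        · rw [hp] at hx0
          rw [hq] at hy0
          rw [← hx0, ← hy0, h1]
          exact ⟨rfl, congrFun h3 q⟩
      refine Subtype.ext (Prod.ext (D.injective (Prod.ext hp.1 h2)) ?_)
      funext i
      rcases Fin.eq_zero_or_eq_succ i with rfl | ⟨i, rfl⟩
      · exact hp.2
      · exact congrFun h3 i
    have h4 := Nat.card_le_card_of_injective f hf
    have h5 : Nat.card (Label ⊕ Fin n) = 4 + n := by
      rw [Nat.card_eq_fintype_card, Fintype.card_sum, Fintype.card_fin]
      rfl
    rw [Nat.card_prod, h5] at h4
    rw [Finset.prod_range_succ, mul_comm]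
    exact h4.trans (Nat.mul_le_mul_left _ ih)

section

variable {n : ℕ}

instance (L : LabelledPartition n) (c : L.blocks.toFinset) : NeZero c.1.1 :=
  ⟨(L.pos c.1 (Multiset.mem_toFinset.1 c.2)).ne'⟩

/-- The permutation `u ↦ u + 1` of each block. -/
def shift (L : LabelledPartition n) : Equiv.Perm (Points L) :=
  Equiv.sigmaCongrRight fun _ => Equiv.prodCongr (Equiv.refl _) (Equiv.addRight 1)

theorem shift_pow_apply (L : LabelledPartition n) (m : ℕ) (c : L.blocks.toFinset)
    (j : Fin (L.blocks.count c.1)) (u : ZMod c.1.1) :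
    (shift L ^ m) ⟨c, j, u⟩ = ⟨c, j, u + m⟩ := by
  induction m with
  | zero => simp
  | succ m ih =>
    rw [pow_succ', Equiv.Perm.mul_apply, ih]
    simp [shift, add_assoc]

/-- The labelled permutation of `{1, …, n}` given by a numbering of the points. -/
def toLabelledPerm (L : LabelledPartition n) (e : Points L ≃ Fin n) : LabelledPerm n :=
  ⟨(e.permCongr (shift L), fun i => (e.symm i).1.1.2), fun i => by
    simp [shift, Equiv.permCongr_apply]⟩

theorem toLabelledPerm_pow (L : LabelledPartition n) (e : Points L ≃ Fin n) (m : ℕ) (x : Points L) :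
    ((toLabelledPerm L e).1.1 ^ m) (e x) = e ((shift L ^ m) x) := by
  induction m generalizing x with
  | zero => simp
  | succ m ih =>
    rw [pow_succ, pow_succ, Equiv.Perm.mul_apply, Equiv.Perm.mul_apply, ← ih]
    simp [toLabelledPerm, Equiv.permCongr_apply]

/-- The size and the label of the block of a point are determined by the labelled permutation. -/
theorem type_iff (L : LabelledPartition n) (e : Points L ≃ Fin n) (x : Points L) (b : ℕ × Label) :
    x.1.1 = b ↔ (∀ m : ℕ, ((toLabelledPerm L e).1.1 ^ m) (e x) = e x ↔ b.1 ∣ m) ∧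
      (toLabelledPerm L e).1.2 (e x) = b.2 := by
  obtain ⟨c, j, u⟩ := x
  have h : ∀ m : ℕ, ((toLabelledPerm L e).1.1 ^ m) (e ⟨c, j, u⟩) = e ⟨c, j, u⟩ ↔ c.1.1 ∣ m := by
    intro m
    rw [toLabelledPerm_pow, shift_pow_apply, e.apply_eq_iff_eq]
    simp [ZMod.natCast_eq_zero_iff]
  have h2 : (toLabelledPerm L e).1.2 (e ⟨c, j, u⟩) = c.1.2 := by simp [toLabelledPerm]
  rw [h2]
  simp only [h]
  constructor
  · rintro rfl
    simp
  · rintro ⟨h3, h4⟩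
    exact Prod.ext (Nat.dvd_antisymm ((h3 _).2 dvd_rfl) ((h3 _).1 dvd_rfl)) h4

theorem card_points_of_type (L : LabelledPartition n) (b : ℕ × Label) :
    Nat.card {x : Points L // x.1.1 = b} = b.1 * L.blocks.count b := by
  classical
  rw [Nat.card_eq_fintype_card, Fintype.card_subtype, Finset.card_filter, Fintype.sum_sigma]
  have : ∀ c : L.blocks.toFinset, (∑ _y : Fin (L.blocks.count c.1) × ZMod c.1.1,
      if c.1 = b then 1 else 0) = if c.1 = b then c.1.1 * L.blocks.count c.1 else 0 := by
    intro c
    rw [Finset.sum_const, Finset.card_univ, Fintype.card_prod, Fintype.card_fin, ZMod.card]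
    split_ifs <;> simp [mul_comm]
  rw [Finset.sum_congr rfl fun c _ => this c,
    Finset.sum_coe_sort L.blocks.toFinset fun c => if c = b then c.1 * L.blocks.count c else 0,
    Finset.sum_ite_eq']
  split_ifs with h
  · rfl
  · rw [Multiset.count_eq_zero.2 fun h' => h (Multiset.mem_toFinset.2 h'), mul_zero]

theorem eq_of_toLabelledPerm_eq {L L' : LabelledPartition n} {e : Points L ≃ Fin n}
    {e' : Points L' ≃ Fin n} (h : toLabelledPerm L e = toLabelledPerm L' e') : L = L' := by
  have hcount : ∀ b : ℕ × Label, b.1 * L.blocks.count b = b.1 * L'.blocks.count b := by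
    intro b
    rw [← card_points_of_type, ← card_points_of_type]
    refine Nat.card_congr ((e.trans e'.symm).subtypeEquiv fun x => ?_)
    rw [type_iff L e, type_iff L' e', h]
    simp
  refine DecoratedPartition.ext (Multiset.ext.2 fun b => ?_)
  rcases Nat.eq_zero_or_pos b.1 with hb | hb
  · rw [Multiset.count_eq_zero.2 fun h' => (L.pos b h').ne' hb,
      Multiset.count_eq_zero.2 fun h' => (L'.pos b h').ne' hb]
  · exact Nat.eq_of_mul_eq_mul_left hb (hcount b)

/-- A permutation of the points that commutes with the shift and preserves the labels belongs to
`Z(λ, s)`. -/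
theorem mem_Z_of_toLabelledPerm_eq {L : LabelledPartition n} {e e' : Points L ≃ Fin n}
    (h : toLabelledPerm L e = toLabelledPerm L e') : e'.trans e.symm ∈ Z L := by
  set γ : Equiv.Perm (Points L) := e'.trans e.symm with hγ
  have heγ : ∀ x, e (γ x) = e' x := fun x => by simp [hγ]
  have htype : ∀ x : Points L, (γ x).1 = x.1 := by
    intro x
    apply Subtype.ext
    rw [type_iff L e, heγ, h, ← type_iff L e']
  have hcomm : ∀ (m : ℕ) (x : Points L), γ ((shift L ^ m) x) = (shift L ^ m) (γ x) := by
    intro m x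
    apply e.injective
    rw [heγ, ← toLabelledPerm_pow, ← toLabelledPerm_pow, heγ, h]
  have hex : ∀ (c : L.blocks.toFinset) (j : Fin (L.blocks.count c.1)),
      ∃ y : Fin (L.blocks.count c.1) × ZMod c.1.1, γ ⟨c, j, 0⟩ = ⟨c, y⟩ := by
    intro c j
    have h1 := htype ⟨c, j, 0⟩
    generalize γ ⟨c, j, 0⟩ = z at h1
    obtain ⟨c', y⟩ := z
    dsimp only at h1
    subst h1
    exact ⟨y, rfl⟩
  choose y hy using hex
  have hγ' : ∀ c j u, γ ⟨c, j, u⟩ = ⟨c, (y c j).1, u + (y c j).2⟩ := by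
    intro c j u
    have h1 := hcomm u.val ⟨c, j, 0⟩
    rw [shift_pow_apply, hy, shift_pow_apply] at h1
    simpa [add_comm] using h1
  have hinj : ∀ c, Function.Injective fun j => (y c j).1 := by
    intro c j j' hj
    have h1 := hγ' c j (-(y c j).2)
    have h2 := hγ' c j' (-(y c j').2)
    dsimp only at hj
    rw [neg_add_cancel] at h1 h2
    rw [hj, ← h2] at h1
    have := γ.injective h1
    simp only [Sigma.mk.injEq, heq_eq_eq, true_and, Prod.mk.injEq] at this
    exact this.1
  exact ⟨fun c => Equiv.ofBijective _ (Finite.injective_iff_bijective.1 (hinj c)),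
    fun c j => (y c j).2, hγ'⟩

/-- Labelled partitions with a coset of `Z(λ, s)` are distinguished by their labelled
permutations. -/
theorem injective_coset_labelledPerm (e : ∀ L : LabelledPartition n, Points L ≃ Fin n) :
    Function.Injective fun x : Σ L : LabelledPartition n,
      Equiv.Perm (Fin n) ⧸ (ZHom L (e L)).range =>
        toLabelledPerm x.1 ((e x.1).trans x.2.out) := by
  rintro ⟨L, x⟩ ⟨L', x'⟩ h
  dsimp only at h
  obtain rfl := eq_of_toLabelledPerm_eq h
  have h1 := mem_Z_of_toLabelledPerm_eq h
  congr 1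
  rw [← x.out_eq', ← x'.out_eq']
  refine QuotientGroup.eq.2 ⟨⟨_, h1⟩, ?_⟩
  ext i
  simp [ZHom, Equiv.permCongrHom, Equiv.permCongr_apply]

theorem finite_labelledPartition (n : ℕ) : Finite (LabelledPartition n) := by
  let e := fun L : LabelledPartition n => (nonempty_points_equiv L).some
  exact Finite.of_injective (fun L => toLabelledPerm L (e L)) fun _ _ h => eq_of_toLabelledPerm_eq h

instance (n : ℕ) : Fintype (LabelledPartition n) :=
  @Fintype.ofFinite _ (finite_labelledPartition n)

/-- The cosets of the groups `Z(λ,s)` correspond to the permutations with labelled cycles, and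
inserting the points one at a time builds each of them with at most `4 + i` choices for the point
`i`: it opens a cycle with one of the four labels or follows one of the `i` earlier points. -/
theorem sum_index_le (e : ∀ L : LabelledPartition n, Points L ≃ Fin n) :
    ∑ L, (ZHom L (e L)).range.index ≤ ∏ i ∈ Finset.range n, (4 + i) := by
  have h := Nat.card_le_card_of_injective _ (injective_coset_labelledPerm e)
  rw [Nat.card_sigma] at h
  exact h.trans (card_labelledPerm_le n)

end

/-! ### Forests and systems of words -/

/-- The classes `ω_{i,j}`. -/
def omega (n : ℕ) : Fin n → Fin n → E2Alg n := fun i j => cl (.edge i j)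

theorem cl_mul_self {n : ℕ} (g : Gen n) : cl g * cl g = 0 := by
  have h := cl_anticomm g g
  have h2 : (2 : ℚ) • (cl g * cl g) = 0 := by
    rw [two_smul]
    nth_rewrite 1 [h]
    exact neg_add_cancel _
  exact (smul_eq_zero_iff_right (two_ne_zero)).1 h2

theorem isEdgeSystem_omega (n : ℕ) : IsEdgeSystem (omega n) :=
  ⟨cl_edge_symm, cl_edge_self, fun _ _ _ _ => cl_anticomm _ _, fun _ _ => cl_mul_self _, cl_arnold⟩

/-- A nonempty word, given by its first letter and the remaining ones. -/
abbrev Word (n : ℕ) : Type := Fin n × List (Fin n)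

/-- The letters of a word. -/
def Word.letters {n : ℕ} (w : Word n) : List (Fin n) := w.1 :: w.2

/-- The class of a word. -/
def Word.val {n : ℕ} (w : Word n) : E2Alg n := path (omega n) w.1 w.2

/-- Two points lie in the same word. -/
def SameWord {n : ℕ} (us : List (Word n)) (u v : Fin n) : Prop :=
  ∃ w ∈ us, u ∈ w.letters ∧ v ∈ w.letters

/-- The product of the classes of the words. -/
def wordsVal {n : ℕ} (us : List (Word n)) : E2Alg n := (us.map Word.val).prod

/-- The words use every point exactly once. -/
def IsWordSystem {n : ℕ} (us : List (Word n)) : Prop :=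
  (us.flatMap Word.letters).Perm (List.finRange n)

section

variable {n : ℕ}

theorem signComm_path_cl (a : Fin n) (w : List (Fin n)) (g : Gen n) :
    SignComm (path (omega n) a w) (cl g) := by
  induction w generalizing a with
  | nil => exact (SignComm.one_right _).symm
  | cons b w ih => exact (signComm_cl _ _).mul_left (ih b)

theorem signComm_path_path (a b : Fin n) (w z : List (Fin n)) :
    SignComm (path (omega n) a w) (path (omega n) b z) := by
  induction z generalizing b with
  | nil => exact SignComm.one_right _
  | cons c z ih => exact (signComm_path_cl _ _ _).mul_right (ih c)

theorem signComm_path_label (a : Fin n) (w : List (Fin n)) (l : Label) (i : Fin n) :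
    SignComm (path (omega n) a w) (labelClass l i) := by
  induction w generalizing a with
  | nil => exact (SignComm.one_right _).symm
  | cons b w ih => exact (signComm_label_cl _ _ _).symm.mul_left (ih b)

theorem wordsVal_perm {us vs : List (Word n)} (h : us.Perm vs) :
    wordsVal us = wordsVal vs ∨ wordsVal us = -wordsVal vs := by
  refine prod_perm (h.map _) ?_
  intro a ha b hb
  obtain ⟨_, _, rfl⟩ := List.mem_map.1 ha
  obtain ⟨_, _, rfl⟩ := List.mem_map.1 hb
  exact signComm_path_path _ _ _ _

theorem isWordSystem_perm {us vs : List (Word n)} (h : us.Perm vs) (hus : IsWordSystem us) :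
    IsWordSystem vs := (h.flatMap_right _).symm.trans hus

theorem sameWord_perm {us vs : List (Word n)} (h : us.Perm vs) (u v : Fin n) :
    SameWord us u v ↔ SameWord vs u v := by
  simp only [SameWord, h.mem_iff]

/-- Joining two words by an edge gives words that start at an end of the edge. -/
theorem omega_mul_mem_span {u v : Fin n} {w z : Word n} (hu : u ∈ w.letters) (hv : v ∈ z.letters) :
    omega n u v * (w.val * z.val) ∈ Submodule.span ℚ {x | ∃ m : List (Fin n),
      (u :: m).Perm (w.letters ++ z.letters) ∧ x = path (omega n) u m} := by
  have h := isEdgeSystem_omega n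
  obtain ⟨m₁, hm₁, hw⟩ := h.path_mem_reroot ℚ hu
  obtain ⟨m₂, hm₂, hz⟩ := h.path_mem_reroot ℚ hv
  have key : ∀ a ∈ Submodule.span ℚ {z | ∃ w', List.Perm w' m₁ ∧ z = path (omega n) u w'},
      ∀ b ∈ Submodule.span ℚ {z | ∃ w', List.Perm w' m₂ ∧ z = path (omega n) v w'},
      omega n u v * (a * b) ∈ Submodule.span ℚ {x | ∃ m : List (Fin n),
      (u :: m).Perm (w.letters ++ z.letters) ∧ x = path (omega n) u m} := by
    intro a ha b hb
    induction ha, hb using Submodule.span_induction₂ with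
    | mem_mem x y hx hy =>
      obtain ⟨w₁, hw₁, rfl⟩ := hx
      obtain ⟨w₂, hw₂, rfl⟩ := hy
      have h1 := h.path_mul_path_mem ℚ u w₁ (v :: w₂)
      have h2 : Submodule.span ℚ {z | ∃ w : List (Fin n), w.Perm (w₁ ++ v :: w₂) ∧
          z = path (omega n) u w} ≤ Submodule.span ℚ {x | ∃ m : List (Fin n),
          (u :: m).Perm (w.letters ++ z.letters) ∧ x = path (omega n) u m} := by
        refine Submodule.span_mono ?_
        rintro _ ⟨m, hm, rfl⟩
        refine ⟨m, (hm.cons u).trans ?_, rfl⟩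
        exact ((hw₁.cons u).trans hm₁).append ((hw₂.cons v).trans hm₂)
      have h3 := h2 h1
      rw [path_cons, ← mul_assoc, h.path_mul] at h3
      rcases neg_one_pow_eq_or (E2Alg n) w₁.length with e | e <;> rw [e] at h3
      · simpa [mul_assoc] using h3
      · simpa [mul_assoc] using Submodule.neg_mem _ h3
    | zero_left => simp
    | zero_right => simp
    | add_left x y z _ _ _ h1 h2 => rw [add_mul, mul_add]; exact Submodule.add_mem _ h1 h2
    | add_right x y z _ _ _ h1 h2 => rw [mul_add, mul_add]; exact Submodule.add_mem _ h1 h2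
    | smul_left r x y _ _ h => rw [smul_mul_assoc, mul_smul_comm]; exact Submodule.smul_mem _ r h
    | smul_right r x y _ _ h => rw [mul_smul_comm, mul_smul_comm]; exact Submodule.smul_mem _ r h
  exact key _ hw _ hz

/-! ### Adding an edge to a forest -/

/-- A path in the graph with the edge `uv` added either avoids that edge or crosses it once, in one
of the two directions. -/
theorem reachable_sup_edge {G : SimpleGraph (Fin n)} {u v : Fin n} (huv : u ≠ v) (a b : Fin n) :
    (G ⊔ SimpleGraph.edge u v).Reachable a b ↔ G.Reachable a b ∨
      (G.Reachable a u ∧ G.Reachable v b) ∨ (G.Reachable a v ∧ G.Reachable u b) := by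
  constructor
  · rintro ⟨w⟩
    induction w with
    | nil => exact Or.inl (SimpleGraph.Reachable.refl _)
    | cons h _ ih =>
      rw [SimpleGraph.sup_adj, SimpleGraph.edge_adj] at h
      rcases h with h | ⟨⟨rfl, rfl⟩ | ⟨rfl, rfl⟩, _⟩
      · have h' := h.reachable
        rcases ih with ih | ⟨h1, h2⟩ | ⟨h1, h2⟩
        · exact Or.inl (h'.trans ih)
        · exact Or.inr (Or.inl ⟨h'.trans h1, h2⟩)
        · exact Or.inr (Or.inr ⟨h'.trans h1, h2⟩)
      · rcases ih with ih | ⟨h1, h2⟩ | ⟨h1, h2⟩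
        · exact Or.inr (Or.inl ⟨SimpleGraph.Reachable.refl _, ih⟩)
        · exact Or.inr (Or.inl ⟨SimpleGraph.Reachable.refl _, h2⟩)
        · exact Or.inl h2
      · rcases ih with ih | ⟨h1, h2⟩ | ⟨h1, h2⟩
        · exact Or.inr (Or.inr ⟨SimpleGraph.Reachable.refl _, ih⟩)
        · exact Or.inl h2
        · exact Or.inr (Or.inr ⟨SimpleGraph.Reachable.refl _, h2⟩)
  · have hle : G ≤ G ⊔ SimpleGraph.edge u v := le_sup_left
    have hadj : (G ⊔ SimpleGraph.edge u v).Reachable u v := by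
      refine SimpleGraph.Adj.reachable ?_
      rw [SimpleGraph.sup_adj, SimpleGraph.edge_adj]
      exact Or.inr ⟨Or.inl ⟨rfl, rfl⟩, huv⟩
    rintro (h | ⟨h1, h2⟩ | ⟨h1, h2⟩)
    · exact h.mono hle
    · exact (h1.mono hle).trans (hadj.trans (h2.mono hle))
    · exact (h1.mono hle).trans (hadj.symm.trans (h2.mono hle))

theorem edgeMonomial_sup_edge {G : SimpleGraph (Fin n)} {u v : Fin n} (h : ¬G.Adj u v)
    (huv : u ≠ v) :
    omega n u v * edgeMonomial G = edgeMonomial (G ⊔ SimpleGraph.edge u v) ∨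
      omega n u v * edgeMonomial G = -edgeMonomial (G ⊔ SimpleGraph.edge u v) := by
  wlog hlt : u < v generalizing u v
  · have := this (fun h' => h h'.symm) huv.symm (lt_of_le_of_ne (not_lt.1 hlt) huv.symm)
    rwa [(isEdgeSystem_omega n).symm v u, SimpleGraph.edge_comm] at this
  have hperm : ((u, v) :: edges G).Perm (edges (G ⊔ SimpleGraph.edge u v)) := by
    rw [List.perm_ext_iff_of_nodup _ (nodup_edges _)]
    · rintro ⟨a, b⟩
      rw [List.mem_cons, mem_edges, mem_edges, SimpleGraph.sup_adj, SimpleGraph.edge_adj]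
      dsimp only
      constructor
      · rintro (h1 | ⟨h1, h2⟩)
        · obtain ⟨rfl, rfl⟩ := Prod.mk.inj h1
          exact ⟨hlt, Or.inr ⟨Or.inl ⟨rfl, rfl⟩, huv⟩⟩
        · exact ⟨h1, Or.inl h2⟩
      · rintro ⟨h1, h2 | ⟨⟨rfl, rfl⟩ | ⟨rfl, rfl⟩, _⟩⟩
        · exact Or.inr ⟨h1, h2⟩
        · exact Or.inl rfl
        · exact absurd h1 hlt.not_gt
    · rw [List.nodup_cons]
      exact ⟨fun h' => h (mem_edges.1 h').2, nodup_edges _⟩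
  have := prod_perm (hperm.map fun e => cl (.edge e.1 e.2)) (by
    intro a ha b hb
    obtain ⟨_, _, rfl⟩ := List.mem_map.1 ha
    obtain ⟨_, _, rfl⟩ := List.mem_map.1 hb
    exact signComm_cl _ _)
  simpa [edgeMonomial, omega] using this

/-- A system of disjoint words is a forest of paths. -/
theorem exists_forest_of_words (us : List (Word n)) (h : (us.flatMap Word.letters).Nodup) :
    ∃ G : SimpleGraph (Fin n), G.IsAcyclic ∧ (∀ u v, G.Reachable u v ↔ u = v ∨ SameWord us u v) ∧
      (wordsVal us = edgeMonomial G ∨ wordsVal us = -edgeMonomial G) := by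
  induction hN : (us.flatMap Word.letters).length generalizing us with
  | zero =>
    have : us = [] := by
      rcases us with _ | ⟨w, us⟩
      · rfl
      · simp [Word.letters] at hN
    subst this
    refine ⟨⊥, SimpleGraph.isAcyclic_bot, fun u v => ?_, Or.inl ?_⟩
    · simp [SameWord]
    · have : edges (⊥ : SimpleGraph (Fin n)) = [] := by
        rw [List.eq_nil_iff_forall_not_mem]
        exact fun e he => (mem_edges.1 he).2
      simp [wordsVal, edgeMonomial, this]
  | succ N ih =>
    rcases us with _ | ⟨⟨a, w⟩, us⟩
    · simp at hN
    rcases w with _ | ⟨b, w⟩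
    · have hnd : (us.flatMap Word.letters).Nodup := by
        rw [List.flatMap_cons] at h
        exact h.of_append_right
      obtain ⟨G, hG, hreach, hval⟩ := ih us hnd (by simpa [Word.letters] using hN)
      refine ⟨G, hG, fun u v => ?_, ?_⟩
      · rw [hreach]
        constructor
        · rintro (h | ⟨w, hw, h'⟩)
          · exact Or.inl h
          · exact Or.inr ⟨w, by simp [hw], h'⟩
        · rintro (h | ⟨w, hw, h1, h2⟩)
          · exact Or.inl h
          · rcases List.mem_cons.1 hw with rfl | hw
            · simp [Word.letters] at h1 h2
              exact Or.inl (h1.trans h2.symm)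
            · exact Or.inr ⟨w, hw, h1, h2⟩
      · simpa [wordsVal, Word.val] using hval
    · have h' : a ∉ ((b, w) :: us : List (Word n)).flatMap Word.letters ∧
          (((b, w) :: us : List (Word n)).flatMap Word.letters).Nodup := by
        simpa [Word.letters, List.flatMap_cons] using h
      obtain ⟨ha, hnd⟩ := h'
      obtain ⟨G, hG, hreach, hval⟩ := ih ((b, w) :: us) hnd (by
        simpa [Word.letters, List.flatMap_cons] using hN)
      have hra : ∀ x, G.Reachable a x ↔ x = a := by
        intro x
        rw [hreach]
        constructor
        · rintro (h | ⟨z, hz, h1, -⟩)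
          · exact h.symm
          · exact absurd (List.mem_flatMap.2 ⟨z, hz, h1⟩) ha
        · rintro rfl
          exact Or.inl rfl
      have hrb : ∀ x, G.Reachable b x ↔ x ∈ b :: w := by
        intro x
        rw [hreach]
        constructor
        · rintro (h | ⟨z, hz, h1, h2⟩)
          · simp [h]
          · rcases List.mem_cons.1 hz with rfl | hz
            · exact h2
            · rw [List.flatMap_cons, List.nodup_append] at hnd
              exact absurd rfl (hnd.2.2 b (by simp [Word.letters]) b
                (List.mem_flatMap.2 ⟨z, hz, h1⟩))
        · intro hx
          exact Or.inr ⟨(b, w), by simp, by simp [Word.letters], hx⟩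
      have hab : a ≠ b := by
        rintro rfl
        exact ha (by simp [Word.letters])
      have hnr : ¬G.Reachable a b := fun h => hab ((hra b).1 h).symm
      refine ⟨G ⊔ SimpleGraph.edge a b, hG.sup_edge_of_not_reachable hnr, fun u v => ?_, ?_⟩
      · rw [reachable_sup_edge hab, SimpleGraph.reachable_comm (u := u) (v := a),
          SimpleGraph.reachable_comm (u := u) (v := b), hra, hrb, hra, hrb, hreach]
        have e1 : SameWord ((a, b :: w) :: us) u v ↔ (u ∈ a :: b :: w ∧ v ∈ a :: b :: w) ∨
            SameWord us u v := by
          simp [SameWord, Word.letters]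
        have e2 : SameWord ((b, w) :: us) u v ↔ (u ∈ b :: w ∧ v ∈ b :: w) ∨ SameWord us u v := by
          simp [SameWord, Word.letters]
        rw [e1, e2, List.mem_cons (a := u) (b := a), List.mem_cons (a := v) (b := a)]
        clear * -
        by_cases hu : u = a <;> by_cases hv : v = a <;> simp only [hu, hv] <;> tauto
      · have e : wordsVal ((a, b :: w) :: us) = omega n a b * wordsVal ((b, w) :: us) := by
          simp [wordsVal, Word.val, mul_assoc]
        rw [e]
        rcases hval with hv | hv <;> rw [hv] <;>
          rcases edgeMonomial_sup_edge (fun h => hnr h.reachable) hab with h | h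
        · exact Or.inl h
        · exact Or.inr h
        · right; rw [mul_neg, h]
        · left; rw [mul_neg, h, neg_neg]

/-- Joining two words of a system by an edge. -/
theorem omega_mul_wordsVal_mem {us rest : List (Word n)} (hus : IsWordSystem us) {w z : Word n}
    (hperm : us.Perm (w :: z :: rest)) {u v : Fin n} (huw : u ∈ w.letters) (hvz : v ∈ z.letters) :
    omega n u v * wordsVal us ∈ Submodule.span ℚ {x | ∃ us' : List (Word n), IsWordSystem us' ∧
      (∀ a b, SameWord us' a b ↔ SameWord us a b ∨ (SameWord us u a ∧ SameWord us v b) ∨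
        (SameWord us v a ∧ SameWord us u b)) ∧ us'.length + 1 = us.length ∧ x = wordsVal us'} := by
  have hsys := isWordSystem_perm hperm hus
  have hnd : ((w :: z :: rest).flatMap Word.letters).Nodup :=
    hsys.nodup_iff.2 (List.nodup_finRange n)
  rw [List.flatMap_cons, List.flatMap_cons, List.nodup_append] at hnd
  obtain ⟨-, hnd2, hdis1⟩ := hnd
  rw [List.nodup_append] at hnd2
  obtain ⟨-, -, hdis2⟩ := hnd2
  have hru : ∀ x, SameWord us u x ↔ x ∈ w.letters := by
    intro x
    rw [sameWord_perm hperm]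
    constructor
    · rintro ⟨y, hy, h1, h2⟩
      rcases List.mem_cons.1 hy with rfl | hy
      · exact h2
      · exfalso
        refine hdis1 u huw u ?_ rfl
        rw [← List.flatMap_cons]
        exact List.mem_flatMap.2 ⟨y, hy, h1⟩
    · exact fun hx => ⟨w, by simp, huw, hx⟩
  have hrv : ∀ x, SameWord us v x ↔ x ∈ z.letters := by
    intro x
    rw [sameWord_perm hperm]
    constructor
    · rintro ⟨y, hy, h1, h2⟩
      rcases List.mem_cons.1 hy with rfl | hy
      · exfalso
        refine hdis1 v h1 v ?_ rfl
        exact List.mem_append_left _ hvz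
      · rcases List.mem_cons.1 hy with rfl | hy
        · exact h2
        · exfalso
          exact hdis2 v hvz v (List.mem_flatMap.2 ⟨y, hy, h1⟩) rfl
    · exact fun hx => ⟨z, by simp, hvz, hx⟩
  have hval : omega n u v * wordsVal (w :: z :: rest) ∈ Submodule.span ℚ
      {x | ∃ us' : List (Word n), IsWordSystem us' ∧
      (∀ a b, SameWord us' a b ↔ SameWord us a b ∨ (SameWord us u a ∧ SameWord us v b) ∨
        (SameWord us v a ∧ SameWord us u b)) ∧ us'.length + 1 = us.length ∧
        x = wordsVal us'} := by
    have e : omega n u v * wordsVal (w :: z :: rest)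
        = omega n u v * (w.val * z.val) * wordsVal rest := by
      simp [wordsVal, mul_assoc]
    rw [e]
    have h1 := omega_mul_mem_span huw hvz
    generalize omega n u v * (w.val * z.val) = x at h1 ⊢
    induction h1 using Submodule.span_induction with
    | mem x hx =>
      obtain ⟨m, hm, rfl⟩ := hx
      refine Submodule.subset_span ⟨(u, m) :: rest, ?_, fun a b => ?_, ?_, ?_⟩
      · refine List.Perm.trans ?_ hsys
        rw [List.flatMap_cons, List.flatMap_cons, List.flatMap_cons, ← List.append_assoc]
        exact hm.append_right _
      · have hmem : ∀ x, x ∈ u :: m ↔ x ∈ w.letters ∨ x ∈ z.letters := by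
          intro x
          rw [hm.mem_iff, List.mem_append]
        have e1 : SameWord (w :: z :: rest) a b ↔ (a ∈ w.letters ∧ b ∈ w.letters) ∨
            (a ∈ z.letters ∧ b ∈ z.letters) ∨ SameWord rest a b := by
          simp [SameWord]
        have e2 : SameWord ((u, m) :: rest) a b ↔ (a ∈ u :: m ∧ b ∈ u :: m) ∨
            SameWord rest a b := by
          simp [SameWord, Word.letters]
        rw [hru, hrv, hru, hrv, sameWord_perm hperm, e1, e2, hmem, hmem]
        by_cases h1 : a ∈ w.letters <;> by_cases h2 : b ∈ w.letters <;>
          by_cases h3 : a ∈ z.letters <;> by_cases h4 : b ∈ z.letters <;>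
          simp only [h1, h2, h3, h4, true_or, false_or, and_true, and_false, or_false, or_true,
            and_self, or_self]
      · rw [hperm.length_eq]; rfl
      · simp [wordsVal, Word.val]
    | zero => simp
    | add x y _ _ hx hy => rw [add_mul]; exact Submodule.add_mem _ hx hy
    | smul r x _ hx => rw [smul_mul_assoc]; exact Submodule.smul_mem _ r hx
  rcases wordsVal_perm hperm with e | e <;> rw [e]
  · exact hval
  · rw [mul_neg]; exact Submodule.neg_mem _ hval

theorem exists_perm_of_not_sameWord {us : List (Word n)} {u v : Fin n} (hu : SameWord us u u)
    (hv : SameWord us v v) (h : ¬SameWord us u v) :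
    ∃ w z rest, us.Perm (w :: z :: rest) ∧ u ∈ w.letters ∧ v ∈ z.letters := by
  obtain ⟨w, hw, huw, -⟩ := hu
  obtain ⟨z, hz, hvz, -⟩ := hv
  have hwz : z ≠ w := by
    rintro rfl
    exact h ⟨z, hw, huw, hvz⟩
  exact ⟨w, z, (us.erase w).erase z, (List.perm_cons_erase hw).trans
    ((List.perm_cons_erase ((List.mem_erase_of_ne hwz).2 hz)).cons w), huw, hvz⟩

/-- The class of a forest is a combination of systems of words on its trees. -/
theorem edgeMonomial_mem_span (G : SimpleGraph (Fin n)) (hG : G.IsAcyclic) :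
    edgeMonomial G ∈ Submodule.span ℚ {z | ∃ us : List (Word n), IsWordSystem us ∧
      (∀ u v, G.Reachable u v ↔ SameWord us u v) ∧ z = wordsVal us} := by
  induction hN : G.edgeSet.ncard using Nat.strong_induction_on generalizing G with
  | _ N ih =>
    by_cases hbot : G = ⊥
    · subst hbot
      refine Submodule.subset_span ⟨(List.finRange n).map fun i => (i, []), ?_, fun u v => ?_, ?_⟩
      · rw [IsWordSystem, List.flatMap_map]
        simp [Word.letters]
      · simp only [SimpleGraph.reachable_bot, SameWord, List.mem_map, List.mem_finRange, true_and]
        constructor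
        · rintro rfl
          exact ⟨(u, []), ⟨u, rfl⟩, by simp [Word.letters]⟩
        · rintro ⟨w, ⟨i, rfl⟩, h1, h2⟩
          simp [Word.letters] at h1 h2
          rw [h1, h2]
      · have : edges (⊥ : SimpleGraph (Fin n)) = [] := by
          rw [List.eq_nil_iff_forall_not_mem]
          exact fun e he => (mem_edges.1 he).2
        rw [edgeMonomial, this, wordsVal, List.map_map]
        symm
        refine List.prod_eq_one fun x hx => ?_
        obtain ⟨i, _, rfl⟩ := List.mem_map.1 hx
        rfl
    · obtain ⟨u, v, huv⟩ := SimpleGraph.ne_bot_iff_exists_adj.1 hbot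
      set G' := G.deleteEdges {s(u, v)} with hG'
      have hnr : ¬G'.Reachable u v :=
        (SimpleGraph.isAcyclic_iff_forall_isBridge.1 hG) (SimpleGraph.mem_edgeSet G |>.2 huv)
      have hle : G' ≤ G := SimpleGraph.deleteEdges_le _
      have hGG' : G' ⊔ SimpleGraph.edge u v = G := by
        ext a b
        rw [SimpleGraph.sup_adj, SimpleGraph.edge_adj, hG', SimpleGraph.deleteEdges_adj]
        constructor
        · rintro (h | ⟨⟨rfl, rfl⟩ | ⟨rfl, rfl⟩, _⟩)
          · exact h.1
          · exact huv
          · exact huv.symm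
        · intro h
          by_cases hab : s(a, b) = s(u, v)
          · right
            rw [Sym2.eq_iff] at hab
            exact ⟨hab, h.ne⟩
          · exact Or.inl ⟨h, hab⟩
      have hcard : G'.edgeSet.ncard < N := by
        rw [← hN]
        refine Set.ncard_lt_ncard ?_ (Set.toFinite _)
        refine ⟨SimpleGraph.edgeSet_mono hle, fun h => ?_⟩
        have := h ((SimpleGraph.mem_edgeSet G).2 huv)
        exact hnr (SimpleGraph.Adj.reachable this)
      have hmem := ih _ hcard G' (hG.anti hle) rfl
      have hmul : ∀ x ∈ Submodule.span ℚ {z | ∃ us : List (Word n), IsWordSystem us ∧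
          (∀ u v, G'.Reachable u v ↔ SameWord us u v) ∧ z = wordsVal us},
          omega n u v * x ∈ Submodule.span ℚ {z | ∃ us : List (Word n),
          IsWordSystem us ∧ (∀ u v, G.Reachable u v ↔ SameWord us u v) ∧ z = wordsVal us} := by
        intro x hx
        induction hx using Submodule.span_induction with
        | mem x hx =>
          obtain ⟨us, hus, hreach, rfl⟩ := hx
          obtain ⟨w, z, rest, hperm, huw, hvz⟩ := exists_perm_of_not_sameWord
            ((hreach u u).1 (SimpleGraph.Reachable.refl _))
            ((hreach v v).1 (SimpleGraph.Reachable.refl _)) (fun h => hnr ((hreach u v).2 h))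
          refine Submodule.span_mono ?_ (omega_mul_wordsVal_mem hus hperm huw hvz)
          rintro _ ⟨us', hus', hsame, -, rfl⟩
          refine ⟨us', hus', fun a b => ?_, rfl⟩
          rw [hsame, ← hGG', reachable_sup_edge huv.ne, SimpleGraph.reachable_comm (u := a) (v := u),
            SimpleGraph.reachable_comm (u := a) (v := v), hreach, hreach, hreach, hreach, hreach]
        | zero => simp
        | add x y _ _ hx hy => rw [mul_add]; exact Submodule.add_mem _ hx hy
        | smul r x _ hx => rw [mul_smul_comm]; exact Submodule.smul_mem _ r hx
      replace hmul := hmul _ hmem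
      rcases edgeMonomial_sup_edge (fun h => hnr h.reachable) huv.ne with e | e <;>
        rw [hGG'] at e
      · rwa [e] at hmul
      · rw [e] at hmul
        simpa using Submodule.neg_mem _ hmul

end

/-! ### Labelled words -/

/-- A labelled word. -/
abbrev LWord (n : ℕ) : Type := Label × Word n

/-- The class of a labelled word, with the label placed on the first letter. -/
def LWord.val {n : ℕ} (b : LWord n) : E2Alg n := labelClass b.1 b.2.1 * b.2.val

/-- The length and the label of a labelled word. -/
def LWord.type {n : ℕ} (b : LWord n) : ℕ × Label := (b.2.2.length + 1, b.1)

/-- The product of the classes of the labelled words. -/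
def sysVal {n : ℕ} (bs : List (LWord n)) : E2Alg n := (bs.map LWord.val).prod

/-- The product of the labels, placed on the first letters. -/
def labelsVal {n : ℕ} (bs : List (LWord n)) : E2Alg n :=
  (bs.map fun b => labelClass b.1 b.2.1).prod

/-- The words use every point exactly once. -/
def IsLWordSystem {n : ℕ} (bs : List (LWord n)) : Prop := IsWordSystem (bs.map Prod.snd)

section

variable {n : ℕ}

theorem signComm_lword (b c : LWord n) : SignComm b.val c.val :=
  ((signComm_label_label _ _ _ _).mul_right (signComm_path_label _ _ _ _).symm).mul_left
    ((signComm_path_label _ _ _ _).mul_right (signComm_path_path _ _ _ _))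

theorem sysVal_perm {bs cs : List (LWord n)} (h : bs.Perm cs) :
    sysVal bs = sysVal cs ∨ sysVal bs = -sysVal cs := by
  refine prod_perm (h.map _) ?_
  intro a ha b hb
  obtain ⟨_, _, rfl⟩ := List.mem_map.1 ha
  obtain ⟨_, _, rfl⟩ := List.mem_map.1 hb
  exact signComm_lword _ _

theorem isLWordSystem_perm {bs cs : List (LWord n)} (h : bs.Perm cs) (hbs : IsLWordSystem bs) :
    IsLWordSystem cs := isWordSystem_perm (h.map _) hbs

theorem sysVal_eq (bs : List (LWord n)) :
    sysVal bs = labelsVal bs * wordsVal (bs.map Prod.snd) ∨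
      sysVal bs = -(labelsVal bs * wordsVal (bs.map Prod.snd)) := by
  induction bs with
  | nil => left; simp [sysVal, labelsVal, wordsVal]
  | cons b bs ih =>
    have h1 : SignComm b.2.val (labelsVal bs) := by
      refine SignComm.prod_right fun x hx => ?_
      obtain ⟨c, _, rfl⟩ := List.mem_map.1 hx
      exact signComm_path_label _ _ _ _
    have e1 : sysVal (b :: bs) = labelClass b.1 b.2.1 * b.2.val * sysVal bs := rfl
    have e2 : labelsVal (b :: bs) * wordsVal ((b :: bs).map Prod.snd)
        = labelClass b.1 b.2.1 * (labelsVal bs * b.2.val) * wordsVal (bs.map Prod.snd) := by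
      simp [labelsVal, wordsVal, mul_assoc]
    rw [e1, e2]
    rcases ih with h | h <;> rw [h] <;> rcases h1 with h1 | h1
    · left; rw [← h1]; simp only [mul_assoc]
    · right; rw [← neg_eq_iff_eq_neg.2 h1]; simp only [mul_assoc, mul_neg, neg_mul, neg_neg]
    · right; rw [← h1]; simp only [mul_assoc, mul_neg]
    · left; rw [← neg_eq_iff_eq_neg.2 h1]; simp only [mul_assoc, mul_neg, neg_mul]

theorem IsWordSystem.mem {us : List (Word n)} (h : IsWordSystem us) (i : Fin n) :
    ∃ w ∈ us, i ∈ w.letters := by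
  have : i ∈ us.flatMap Word.letters := h.mem_iff.2 (List.mem_finRange i)
  exact List.mem_flatMap.1 this

theorem IsWordSystem.unique {us : List (Word n)} (h : IsWordSystem us) {w z : Word n} (hw : w ∈ us)
    (hz : z ∈ us) {i : Fin n} (hiw : i ∈ w.letters) (hiz : i ∈ z.letters) : w = z := by
  by_contra hne
  have hnd : (us.flatMap Word.letters).Nodup := h.nodup_iff.2 (List.nodup_finRange n)
  rw [List.nodup_flatMap] at hnd
  have : Std.Symm (Function.onFun List.Disjoint (Word.letters (n := n))) :=
    ⟨fun _ _ h => List.Disjoint.symm h⟩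
  exact hnd.2.forall hw hz hne hiw hiz

theorem IsWordSystem.nodup_letters {us : List (Word n)} (h : IsWordSystem us) {w : Word n}
    (hw : w ∈ us) : w.letters.Nodup := by
  have hnd : (us.flatMap Word.letters).Nodup := h.nodup_iff.2 (List.nodup_finRange n)
  rw [List.nodup_flatMap] at hnd
  exact hnd.1 w hw

theorem IsWordSystem.nodup {us : List (Word n)} (h : IsWordSystem us) :
    (us.map Prod.fst).Nodup := by
  have hnd : (us.flatMap Word.letters).Nodup := h.nodup_iff.2 (List.nodup_finRange n)
  rw [List.nodup_flatMap] at hnd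
  rw [List.Nodup, List.pairwise_map]
  refine hnd.2.imp fun {a b} h e => ?_
  exact h (by simp [Word.letters]) (a := a.1) (by rw [e]; simp [Word.letters])

/-- The words of a system on the trees of a labelled forest, with the labels of the trees. -/
def LabelledForest.words (F : LabelledForest n) (us : List (Word n)) : List (LWord n) :=
  us.map fun w => (F.label (F.graph.connectedComponentMk w.1), w)

theorem LabelledForest.shape_eq_words (F : LabelledForest n) {us : List (Word n)}
    (hus : IsWordSystem us) (h : ∀ u v, F.graph.Reachable u v ↔ SameWord us u v) :
    F.shape = ((F.words us).map LWord.type : List (ℕ × Label)) := by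
  classical
  let _ : Fintype F.graph.ConnectedComponent := Fintype.ofFinite _
  have hnd : (us.map fun w => F.graph.connectedComponentMk w.1).Nodup := by
    have := hus.nodup
    rw [List.Nodup, List.pairwise_map] at this ⊢
    refine List.Pairwise.imp_of_mem ?_ this
    intro a b ha hb hab e
    apply hab
    obtain ⟨w, hw, h1, h2⟩ := (h _ _).1 (SimpleGraph.ConnectedComponent.eq.1 e)
    rw [hus.unique ha hw (by simp [Word.letters]) h1, hus.unique hb hw (by simp [Word.letters]) h2]
  have huniv : (Finset.univ : Finset F.graph.ConnectedComponent).val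
      = (us.map fun w => F.graph.connectedComponentMk w.1 : List _) := by
    refine (Multiset.Nodup.ext Finset.univ.nodup (Multiset.coe_nodup.2 hnd)).2 fun c => ?_
    simp only [Finset.mem_val, Finset.mem_univ, true_iff, Multiset.mem_coe, List.mem_map]
    induction c using SimpleGraph.ConnectedComponent.ind with | _ v => ?_
    obtain ⟨w, hw, hv⟩ := hus.mem v
    exact ⟨w, hw, SimpleGraph.ConnectedComponent.eq.2
      ((h _ _).2 ⟨w, hw, by simp [Word.letters], hv⟩)⟩
  unfold LabelledForest.shape
  rw [huniv, Multiset.map_coe, List.map_map, LabelledForest.words, List.map_map]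
  congr 1
  refine List.map_congr_left fun w hw => ?_
  refine Prod.ext ?_ rfl
  have hsupp : (F.graph.connectedComponentMk w.1).supp = (w.letters.toFinset : Set (Fin n)) := by
    ext v
    rw [SimpleGraph.ConnectedComponent.mem_supp_iff, SimpleGraph.ConnectedComponent.eq,
      SimpleGraph.reachable_comm, h]
    simp only [List.coe_toFinset, Set.mem_ofPred_eq]
    constructor
    · rintro ⟨z, hz, h1, h2⟩
      rwa [hus.unique hw hz (by simp [Word.letters]) h1]
    · exact fun hv => ⟨w, hw, by simp [Word.letters], hv⟩
  change (F.graph.connectedComponentMk w.1).supp.ncard = w.2.length + 1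
  rw [hsupp, Set.ncard_coe_finset, List.toFinset_card_of_nodup (hus.nodup_letters hw)]
  rfl

/-- In a product with the class of the forest, the labels may be moved from the roots to the first
letters of words. -/
theorem LabelledForest.roots_mul_wordsVal (F : LabelledForest n) {us : List (Word n)}
    (hus : IsWordSystem us) (h : ∀ u v, F.graph.Reachable u v ↔ SameWord us u v) :
    ((roots F.graph).map fun i => labelClass (F.label (F.graph.connectedComponentMk i)) i).prod
        * wordsVal us = sysVal (F.words us) ∨
      ((roots F.graph).map fun i => labelClass (F.label (F.graph.connectedComponentMk i)) i).prod
        * wordsVal us = -sysVal (F.words us) := by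
  choose r hr hr' using exists_root F.graph
  obtain ⟨G, -, hG, hval⟩ := exists_forest_of_words us (hus.nodup_iff.2 (List.nodup_finRange n))
  have hreach : ∀ u v, F.graph.Reachable u v → G.Reachable u v := fun u v huv =>
    (hG u v).2 (Or.inr ((h u v).1 huv))
  set s : Fin n → Label := fun i => F.label (F.graph.connectedComponentMk i) with hs
  have hsr : ∀ i, s (r i) = s i := fun i =>
    congrArg F.label (SimpleGraph.ConnectedComponent.eq.2 (hr' i).symm)
  have hperm : (us.map fun w => r w.1).Perm (roots F.graph) := by
    rw [List.perm_ext_iff_of_nodup _ (nodup_roots _)]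
    · intro t
      rw [List.mem_map, mem_roots]
      constructor
      · rintro ⟨w, _, rfl⟩
        exact hr _
      · intro ht
        obtain ⟨w, hw, hv⟩ := hus.mem t
        refine ⟨w, hw, (hr _).unique ht ((hr' _).symm.trans ((h _ _).2 ⟨w, hw, ?_, hv⟩))⟩
        simp [Word.letters]
    · have := hus.nodup
      rw [List.Nodup, List.pairwise_map] at this ⊢
      refine List.Pairwise.imp_of_mem ?_ this
      intro a b ha hb hab e
      apply hab
      have hre : F.graph.Reachable a.1 b.1 := (hr' a.1).trans (e ▸ (hr' b.1).symm)
      obtain ⟨w, hw, h1, h2⟩ := (h _ _).1 hre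
      rw [hus.unique ha hw (by simp [Word.letters]) h1,
        hus.unique hb hw (by simp [Word.letters]) h2]
  have h1 := hperm.map fun i => labelClass (s i) i
  rw [List.map_map] at h1
  have h2 := prod_perm h1 (by
    intro a ha b hb
    obtain ⟨_, _, rfl⟩ := List.mem_map.1 ha
    obtain ⟨_, _, rfl⟩ := List.mem_map.1 hb
    exact signComm_label_label _ _ _ _)
  have h3 : (us.map fun w => labelClass (s w.1) (r w.1)).prod * wordsVal us
      = (us.map fun w => labelClass (s w.1) w.1).prod * wordsVal us := by
    have := prod_label_congr us (fun w => s w.1) (fun w => r w.1) (fun w => w.1) (G := G)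
      fun w _ => (hreach _ _ (hr' w.1)).symm
    rcases hval with e | e <;> rw [e]
    · exact this
    · rw [mul_neg, mul_neg, this]
  have h4 : (us.map ((fun i => labelClass (s i) i) ∘ fun w => r w.1)).prod
      = (us.map fun w => labelClass (s w.1) (r w.1)).prod := by
    congr 1
    refine List.map_congr_left fun w _ => ?_
    simp only [Function.comp_apply, hsr]
  have h5 : labelsVal (F.words us) = (us.map fun w => labelClass (s w.1) w.1).prod := by
    rw [labelsVal, LabelledForest.words, List.map_map]
    rfl
  have h6 : (F.words us).map Prod.snd = us := by
    rw [LabelledForest.words, List.map_map]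
    exact List.map_id _
  have h7 := sysVal_eq (F.words us)
  rw [h5, h6, ← h3, ← h4] at h7
  generalize (us.map ((fun i => labelClass (s i) i) ∘ fun w => r w.1)).prod = x at h2 h7
  generalize (List.map (fun i => labelClass (s i) i) (roots F.graph)).prod = y at h2 ⊢
  rcases h2 with rfl | rfl <;> rcases h7 with e | e <;> rw [e] <;> simp

theorem LabelledForest.isLWordSystem_words (F : LabelledForest n) {us : List (Word n)}
    (hus : IsWordSystem us) : IsLWordSystem (F.words us) := by
  rw [IsLWordSystem, LabelledForest.words, List.map_map]
  rwa [show (Prod.snd ∘ fun w : Word n => (F.label (F.graph.connectedComponentMk w.1), w)) = id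
    from rfl, List.map_id]

/-- `E(λ,s)` is spanned by the systems of labelled words of the given shape. -/
theorem ELabelled_eq_span (L : LabelledPartition n) : (ELabelled L).toSubmodule = Submodule.span ℚ
    {z | ∃ bs : List (LWord n), IsLWordSystem bs ∧ (bs.map LWord.type : List _) = L.blocks ∧
      z = sysVal bs} := by
  apply le_antisymm
  · refine Submodule.span_le.2 ?_
    rintro _ ⟨F, hF, rfl⟩
    have h := edgeMonomial_mem_span F.graph F.acyclic
    rw [SetLike.mem_coe, LabelledForest.monomial]
    generalize edgeMonomial F.graph = x at h ⊢
    induction h using Submodule.span_induction with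
    | mem x hx =>
      obtain ⟨us, hus, hreach, rfl⟩ := hx
      have hmem : sysVal (F.words us) ∈ Submodule.span ℚ
          {z | ∃ bs : List (LWord n), IsLWordSystem bs ∧
            (bs.map LWord.type : List _) = L.blocks ∧ z = sysVal bs} :=
        Submodule.subset_span ⟨_, F.isLWordSystem_words hus,
          (F.shape_eq_words hus hreach).symm.trans hF, rfl⟩
      rcases F.roots_mul_wordsVal hus hreach with e | e <;> rw [e]
      · exact hmem
      · exact Submodule.neg_mem _ hmem
    | zero => simp
    | add x y _ _ hx hy => rw [mul_add]; exact Submodule.add_mem _ hx hy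
    | smul r x _ hx => rw [mul_smul_comm]; exact Submodule.smul_mem _ r hx
  · refine Submodule.span_le.2 ?_
    rintro _ ⟨bs, hbs, hL, rfl⟩
    set us := bs.map Prod.snd with hus
    obtain ⟨G, hG, hreach, hval⟩ :=
      exists_forest_of_words us ((show IsWordSystem _ from hbs).nodup_iff.2 (List.nodup_finRange n))
    have hreach' : ∀ u v, G.Reachable u v ↔ SameWord us u v := by
      intro u v
      rw [hreach]
      refine ⟨?_, Or.inr⟩
      rintro (rfl | h)
      · obtain ⟨w, hw, h⟩ := IsWordSystem.mem hbs u
        exact ⟨w, hw, h, h⟩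
      · exact h
    have hlab : ∀ c : G.ConnectedComponent, ∃ l : Label, ∀ b ∈ bs,
        G.connectedComponentMk b.2.1 = c → b.1 = l := by
      intro c
      induction c using SimpleGraph.ConnectedComponent.ind with | _ v => ?_
      obtain ⟨w, hw, hv⟩ := IsWordSystem.mem hbs v
      obtain ⟨b, hb, rfl⟩ := List.mem_map.1 hw
      refine ⟨b.1, fun b' hb' e => ?_⟩
      obtain ⟨z, hz, h1, h2⟩ := (hreach' _ _).1 (SimpleGraph.ConnectedComponent.eq.1 e)
      have e1 : b'.2 = z := IsWordSystem.unique hbs (List.mem_map.2 ⟨b', hb', rfl⟩) hz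
        (by simp [Word.letters]) h1
      have e2 : b.2 = z := IsWordSystem.unique hbs hw hz hv h2
      have hnd : (bs.map fun b => b.2.1).Nodup := by
        have := IsWordSystem.nodup hbs
        rwa [List.map_map] at this
      exact congrArg Prod.fst (List.inj_on_of_nodup_map hnd hb' hb (by rw [e1, e2]))
    choose lab hlab using hlab
    let F : LabelledForest n := ⟨G, hG, lab⟩
    have hwords : F.words us = bs := by
      rw [LabelledForest.words, hus, List.map_map]
      conv_rhs => rw [← List.map_id bs]
      refine List.map_congr_left fun b hb => ?_
      exact Prod.ext (hlab _ b hb rfl).symm rfl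
    have hmem : F.monomial ∈ (ELabelled L).toSubmodule := by
      refine Submodule.subset_span ⟨F, ?_, rfl⟩
      rw [F.shape_eq_words hbs hreach', hwords, hL]
    have h2 := F.roots_mul_wordsVal hbs hreach'
    rw [hwords] at h2
    rw [LabelledForest.monomial] at hmem
    change _ * edgeMonomial G ∈ _ at hmem
    rw [SetLike.mem_coe]
    rcases hval with e | e <;> rw [e] at h2 <;> rcases h2 with h2 | h2
    · rwa [← h2]
    · rw [← neg_eq_iff_eq_neg.2 h2]; exact Submodule.neg_mem _ hmem
    · rw [← h2, mul_neg]; exact Submodule.neg_mem _ hmem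
    · rw [← neg_eq_iff_eq_neg.2 h2, mul_neg, neg_neg]; exact hmem

end

/-! ### The homogeneous components are sums of the spaces `E(λ,s)` -/

/-- The number of factors `x_i, y_i` in the class of a system of labelled words. -/
def labelDeg {n : ℕ} (bs : List (LWord n)) : ℕ := (bs.map fun b => (b.1.deg : ℕ)).sum

section

variable {n : ℕ}

/-- Graded commutativity for products of anticommuting elements. -/
theorem mul_comm_of_mem_pow {R B : Type*} [CommRing R] [Ring B] [Algebra R B] {W : Submodule R B}
    (hW : ∀ u ∈ W, ∀ v ∈ W, u * v = -(v * u)) {a b : ℕ} {x y : B} (hx : x ∈ W ^ a)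
    (hy : y ∈ W ^ b) : x * y = (-1) ^ (a * b) * (y * x) := by
  have h1 : ∀ (b : ℕ) (y : B), y ∈ W ^ b → ∀ u ∈ W, u * y = (-1) ^ b * (y * u) := by
    intro b y hy
    induction hy using Submodule.pow_induction_on_left' with
    | algebraMap r => intro u _; rw [pow_zero, one_mul, Algebra.commutes]
    | add x y i _ _ hx hy => intro u hu; rw [mul_add, hx u hu, hy u hu, add_mul, mul_add]
    | mem_mul m hm i x hx ih =>
      intro u hu
      rw [← mul_assoc, hW u hu m hm, neg_mul, mul_assoc, ih u hu, pow_succ, mul_assoc m x u]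
      rcases neg_one_pow_eq_or B i with h | h <;> rw [h] <;> simp
  induction hx using Submodule.pow_induction_on_left' with
  | algebraMap r => rw [zero_mul, pow_zero, one_mul, Algebra.commutes]
  | add x z i _ _ hx hz => rw [add_mul, hx, hz, mul_add, mul_add]
  | mem_mul m hm i x hx ih =>
    rw [mul_assoc, ih, Nat.succ_mul, pow_add, ← mul_assoc y m x]
    have h2 := h1 b y hy m hm
    rcases neg_one_pow_eq_or B (i * b) with h | h <;> rw [h] <;>
      rcases neg_one_pow_eq_or B b with h' | h' <;> rw [h'] at h2 ⊢ <;>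
      simp [← mul_assoc, h2]

/-- The span of all the generators. -/
def genSpan (n : ℕ) : Submodule ℚ (E2Alg n) := Submodule.span ℚ (Set.range (cl (n := n)))

theorem cl_mem_genSpan (g : Gen n) : cl g ∈ genSpan n := Submodule.subset_span ⟨g, rfl⟩

theorem clsSpan_le_genSpan (n : ℕ) : clsSpan n ≤ genSpan n := by
  refine Submodule.span_mono ?_
  rintro _ ⟨c, i, rfl⟩
  exact ⟨_, rfl⟩

theorem labelClass_mem (l : Label) (i : Fin n) : labelClass l i ∈ clsSpan n ^ (l.deg : ℕ) := by
  have h : ∀ c, cl (.cls c i) ∈ clsSpan n := fun c => Submodule.subset_span ⟨c, i, rfl⟩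
  cases l
  · exact Submodule.one_le.1 (pow_zero (clsSpan n)).ge
  · exact (pow_one (clsSpan n)).ge (h 0)
  · exact (pow_one (clsSpan n)).ge (h 1)
  · exact (pow_two (clsSpan n)).ge (Submodule.mul_mem_mul (h 0) (h 1))

theorem labelClass_mem_genSpan (l : Label) (i : Fin n) :
    labelClass l i ∈ genSpan n ^ (l.deg : ℕ) :=
  pow_le_pow_left' (clsSpan_le_genSpan n) _ (labelClass_mem l i)

theorem omega_mul_val_eq_zero {w : Word n} {u v : Fin n} (hu : u ∈ w.letters)
    (hv : v ∈ w.letters) : omega n u v * w.val = 0 := by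
  have h := isEdgeSystem_omega n
  obtain ⟨m, hm, hw⟩ := h.path_mem_reroot ℚ hu
  change path (omega n) w.1 w.2 ∈ _ at hw
  rw [Word.val]
  generalize path (omega n) w.1 w.2 = x at hw ⊢
  induction hw using Submodule.span_induction with
  | mem x hx =>
    obtain ⟨w', hw', rfl⟩ := hx
    have hv' : v ∈ u :: m := hm.mem_iff.2 hv
    rcases List.mem_cons.1 hv' with rfl | hv'
    · rw [h.self, zero_mul]
    · exact h.edge_mul_path_of_mem (hw'.mem_iff.2 hv')
  | zero => simp
  | add x y _ _ hx hy => rw [mul_add, hx, hy, add_zero]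
  | smul r x _ hx => rw [mul_smul_comm, hx, smul_zero]

theorem omega_mul_wordsVal_eq_zero {us : List (Word n)} {u v : Fin n} (h : SameWord us u v) :
    omega n u v * wordsVal us = 0 := by
  obtain ⟨w, hw, hu, hv⟩ := h
  refine mul_prod_eq_zero (List.mem_map.2 ⟨w, hw, rfl⟩) (omega_mul_val_eq_zero hu hv) ?_
  intro b hb
  obtain ⟨_, _, rfl⟩ := List.mem_map.1 hb
  exact (signComm_path_cl _ _ _).symm

theorem edgeSpan_pow_le (n q : ℕ) : edgeSpan n ^ q ≤ Submodule.span ℚ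
    {z | ∃ us : List (Word n), IsWordSystem us ∧ us.length + q = n ∧ z = wordsVal us} := by
  induction q with
  | zero =>
    rw [pow_zero, Submodule.one_le]
    refine Submodule.subset_span ⟨(List.finRange n).map fun i => (i, []), ?_, by simp, ?_⟩
    · rw [IsWordSystem, List.flatMap_map]
      simp [Word.letters]
    · rw [wordsVal, List.map_map]
      symm
      refine List.prod_eq_one fun x hx => ?_
      obtain ⟨i, _, rfl⟩ := List.mem_map.1 hx
      rfl
  | succ q ih =>
    rw [pow_succ']
    refine (mul_le_mul_right ih _).trans ?_
    rw [edgeSpan, Submodule.span_mul_span, Submodule.span_le]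
    rintro _ ⟨_, ⟨u, v, rfl⟩, _, ⟨us, hus, hlen, rfl⟩, rfl⟩
    change omega n u v * wordsVal us ∈ _
    have hmem : ∀ i, SameWord us i i := fun i => by
      obtain ⟨w, hw, hi⟩ := hus.mem i
      exact ⟨w, hw, hi, hi⟩
    by_cases huv : SameWord us u v
    · rw [omega_mul_wordsVal_eq_zero huv]
      exact Submodule.zero_mem _
    · obtain ⟨w, z, rest, hperm, huw, hvz⟩ := exists_perm_of_not_sameWord (hmem u) (hmem v) huv
      refine Submodule.span_mono ?_ (omega_mul_wordsVal_mem hus hperm huw hvz)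
      rintro _ ⟨us', hus', -, hlen', rfl⟩
      exact ⟨us', hus', by omega, rfl⟩

/-- The relations `x_i ω_{i,j} = x_j ω_{i,j}` move the class at any letter of a word to its first
letter. -/
theorem cls_mul_path (c : Fin 2) {i a : Fin n} {w : List (Fin n)} (hi : i ∈ a :: w) :
    cl (.cls c i) * path (omega n) a w = cl (.cls c a) * path (omega n) a w := by
  induction w generalizing a with
  | nil => rw [List.mem_singleton.1 hi]
  | cons b w ih =>
    rcases List.mem_cons.1 hi with rfl | hi
    · rfl
    · rw [path_cons, ← mul_assoc, ← mul_assoc, omega, cl_anticomm, neg_mul, mul_assoc, ih hi,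
        ← mul_assoc, ← neg_mul, ← cl_anticomm, cl_edge_symm a b, cl_cls_edge]

theorem label_mul_path (l : Label) {i a : Fin n} {w : List (Fin n)} (hi : i ∈ a :: w) :
    labelClass l i * path (omega n) a w = labelClass l a * path (omega n) a w := by
  cases l
  · rfl
  · exact cls_mul_path 0 hi
  · exact cls_mul_path 1 hi
  · simp only [labelClass]
    rw [mul_assoc, cls_mul_path 1 hi, ← mul_assoc, cl_anticomm, neg_mul,
      mul_assoc, cls_mul_path 0 hi, ← mul_assoc, ← neg_mul, ← cl_anticomm]

theorem cls_mul_labelClass (c : Fin 2) (l : Label) (a : Fin n) :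
    cl (.cls c a) * labelClass l a = 0 ∨ ∃ l' : Label, (l'.deg : ℕ) = l.deg + 1 ∧
      (cl (.cls c a) * labelClass l a = labelClass l' a ∨
        cl (.cls c a) * labelClass l a = -labelClass l' a) := by
  have h0 := cl_mul_self (Gen.cls 0 a)
  have h1 := cl_mul_self (Gen.cls 1 a)
  fin_cases c <;> cases l <;> simp only [labelClass, Fin.zero_eta, Fin.mk_one, Fin.isValue]
  · exact Or.inr ⟨.x, rfl, by simp⟩
  · exact Or.inl h0
  · exact Or.inr ⟨.xy, rfl, by simp⟩
  · left; rw [← mul_assoc, h0, zero_mul]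
  · exact Or.inr ⟨.y, rfl, by simp⟩
  · exact Or.inr ⟨.xy, rfl, Or.inr (cl_anticomm _ _)⟩
  · exact Or.inl h1
  · left; rw [cl_anticomm (.cls 0 a), mul_neg, ← mul_assoc, h1, zero_mul, neg_zero]

theorem cls_mul_sysVal_mem (c : Fin 2) (i : Fin n) {bs : List (LWord n)} (hbs : IsLWordSystem bs) :
    cl (.cls c i) * sysVal bs ∈ Submodule.span ℚ {z | ∃ bs' : List (LWord n), IsLWordSystem bs' ∧
      bs'.length = bs.length ∧ labelDeg bs' = labelDeg bs + 1 ∧ z = sysVal bs'} := by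
  obtain ⟨w, hw, hi⟩ := IsWordSystem.mem hbs i
  obtain ⟨b, hb, rfl⟩ := List.mem_map.1 hw
  have hperm := List.perm_cons_erase hb
  set rest := bs.erase b
  have key : cl (.cls c i) * sysVal (b :: rest) ∈ Submodule.span ℚ {z | ∃ bs' : List (LWord n),
      IsLWordSystem bs' ∧ bs'.length = bs.length ∧ labelDeg bs' = labelDeg bs + 1 ∧
        z = sysVal bs'} := by
    have e1 : cl (.cls c i) * LWord.val b = cl (.cls c b.2.1) * labelClass b.1 b.2.1 * b.2.val := by
      have h1 := fun i => mul_comm_of_mem_pow (a := 1) (fun u hu v hv => anticomm_span hu hv)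
        ((pow_one (genSpan n)).ge (cl_mem_genSpan (.cls c i))) (labelClass_mem_genSpan b.1 b.2.1)
      have h3 : cl (.cls c i) * b.2.val = cl (.cls c b.2.1) * b.2.val := cls_mul_path c hi
      rw [LWord.val, ← mul_assoc, h1, h1]
      simp only [mul_assoc, h3]
    have e : cl (.cls c i) * sysVal (b :: rest)
        = cl (.cls c b.2.1) * labelClass b.1 b.2.1 * (b.2.val * sysVal rest) := by
      rw [← mul_assoc, ← e1, mul_assoc]
      rfl
    rw [e]
    have hmem : ∀ l' : Label, (l'.deg : ℕ) = b.1.deg + 1 →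
        labelClass l' b.2.1 * (b.2.val * sysVal rest) ∈ Submodule.span ℚ
        {z | ∃ bs' : List (LWord n), IsLWordSystem bs' ∧ bs'.length = bs.length ∧
          labelDeg bs' = labelDeg bs + 1 ∧ z = sysVal bs'} := by
      intro l' hl'
      refine Submodule.subset_span ⟨(l', b.2) :: rest, ?_, ?_, ?_, ?_⟩
      · exact isWordSystem_perm (hperm.map Prod.snd) hbs
      · rw [hperm.length_eq]; rfl
      · have : labelDeg bs = labelDeg (b :: rest) := (hperm.map _).sum_eq
        rw [this]
        simp only [labelDeg, List.map_cons, List.sum_cons, hl']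
        omega
      · rw [← mul_assoc]; rfl
    rcases cls_mul_labelClass c b.1 b.2.1 with h | ⟨l', hl', h | h⟩ <;> rw [h]
    · rw [zero_mul]; exact Submodule.zero_mem _
    · exact hmem l' hl'
    · rw [neg_mul]; exact Submodule.neg_mem _ (hmem l' hl')
  rcases sysVal_perm hperm with h | h <;> rw [h]
  · exact key
  · rw [mul_neg]; exact Submodule.neg_mem _ key

theorem labelsVal_mem (bs : List (LWord n)) : labelsVal bs ∈ clsSpan n ^ labelDeg bs := by
  induction bs with
  | nil => exact Submodule.one_le.1 (pow_zero (clsSpan n)).ge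
  | cons b bs ih =>
    rw [labelDeg, List.map_cons, List.sum_cons, pow_add]
    exact Submodule.mul_mem_mul (labelClass_mem _ _) ih

theorem path_mem_edgeSpan (a : Fin n) (w : List (Fin n)) :
    path (omega n) a w ∈ edgeSpan n ^ w.length := by
  induction w generalizing a with
  | nil => exact Submodule.one_le.1 (pow_zero (edgeSpan n)).ge
  | cons b w ih =>
    rw [path_cons, List.length_cons, pow_succ']
    exact Submodule.mul_mem_mul (Submodule.subset_span ⟨a, b, rfl⟩) (ih b)

theorem wordsVal_mem {us : List (Word n)} {q : ℕ} (hus : IsWordSystem us)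
    (hq : us.length + q = n) : wordsVal us ∈ edgeSpan n ^ q := by
  have h1 : ∀ us : List (Word n), wordsVal us ∈ edgeSpan n ^ (us.map fun w => w.2.length).sum := by
    intro us
    induction us with
    | nil => exact Submodule.one_le.1 (pow_zero (edgeSpan n)).ge
    | cons w us ih =>
      rw [List.map_cons, List.sum_cons, pow_add]
      exact Submodule.mul_mem_mul (path_mem_edgeSpan _ _) ih
  have h2 : ∀ us : List (Word n), (us.flatMap Word.letters).length
      = us.length + (us.map fun w => w.2.length).sum := by
    intro us
    induction us with
    | nil => rfl
    | cons w us ih =>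
      rw [List.flatMap_cons, List.length_append, ih]
      simp only [Word.letters, List.length_cons, List.map_cons, List.sum_cons]
      omega
  have h3 := hus.length_eq
  rw [h2, List.length_finRange] at h3
  have : q = (us.map fun w => w.2.length).sum := by omega
  rw [this]
  exact h1 us

/-- Multiplying a labelled system by a generator gives a combination of labelled systems: a class of
degree one changes the label of one word, and an edge class joins two words or gives zero. -/
theorem E2_eq_span (n p q : ℕ) : (E2 n p q).toSubmodule = Submodule.span ℚ
    {z | ∃ bs : List (LWord n), IsLWordSystem bs ∧ bs.length + q = n ∧ labelDeg bs = p ∧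
      z = sysVal bs} := by
  apply le_antisymm
  · change clsSpan n ^ p * edgeSpan n ^ q ≤ _
    induction p with
    | zero =>
      rw [pow_zero, one_mul]
      refine (edgeSpan_pow_le n q).trans (Submodule.span_mono ?_)
      rintro _ ⟨us, hus, hlen, rfl⟩
      refine ⟨us.map fun w => (.one, w), ?_, by simpa using hlen, ?_, ?_⟩
      · rw [IsLWordSystem, List.map_map]
        rwa [show (Prod.snd ∘ fun w : Word n => (Label.one, w)) = id from rfl, List.map_id]
      · rw [labelDeg, List.map_map]
        refine List.sum_eq_zero fun x hx => ?_
        obtain ⟨_, _, rfl⟩ := List.mem_map.1 hx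
        rfl
      · rw [sysVal, wordsVal, List.map_map]
        congr 1
        refine List.map_congr_left fun w _ => ?_
        simp [LWord.val, labelClass]
    | succ p ih =>
      rw [pow_succ', mul_assoc]
      refine (mul_le_mul_right ih _).trans ?_
      rw [clsSpan, Submodule.span_mul_span, Submodule.span_le]
      rintro _ ⟨_, ⟨c, i, rfl⟩, _, ⟨bs, hbs, hlen, hdeg, rfl⟩, rfl⟩
      refine Submodule.span_mono ?_ (cls_mul_sysVal_mem c i hbs)
      rintro _ ⟨bs', hbs', hlen', hdeg', rfl⟩
      exact ⟨bs', hbs', by omega, by omega, rfl⟩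
  · refine Submodule.span_le.2 ?_
    rintro _ ⟨bs, hbs, hlen, rfl, rfl⟩
    have hmem : labelsVal bs * wordsVal (bs.map Prod.snd) ∈ (E2 n (labelDeg bs) q).toSubmodule :=
      Submodule.mul_mem_mul (labelsVal_mem bs) (wordsVal_mem hbs (by simpa using hlen))
    rcases sysVal_eq bs with h | h <;> rw [h]
    · exact hmem
    · exact Submodule.neg_mem _ hmem

/-- The shape of a system of labelled words. -/
def sysShape (bs : List (LWord n)) (h : IsLWordSystem bs) : LabelledPartition n where
  blocks := (bs.map LWord.type : List _)
  pos := by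
    intro b hb
    obtain ⟨c, _, rfl⟩ := List.mem_map.1 (Multiset.mem_coe.1 hb)
    exact Nat.succ_pos _
  sum_eq := by
    have h1 := List.Perm.length_eq h
    rw [List.length_finRange, List.length_flatMap, List.map_map] at h1
    rw [Multiset.map_coe, Multiset.sum_coe, List.map_map]
    exact h1

theorem totalWeight_toWeighted (L : LabelledPartition n) {bs : List (LWord n)}
    (h : (bs.map LWord.type : List _) = L.blocks) :
    totalWeight (toWeighted L) = labelDeg bs := by
  simp only [totalWeight, toWeighted, ← h, Multiset.map_coe, Multiset.sum_coe, List.map_map]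
  rfl

theorem numBlocks_toWeighted (L : LabelledPartition n) {bs : List (LWord n)}
    (h : (bs.map LWord.type : List _) = L.blocks) : numBlocks (toWeighted L) = bs.length := by
  simp [numBlocks, toWeighted, ← h]

/-- The homogeneous component of bidegree `(p,q)` is the sum of the spaces `E(λ,s)` with `n - q`
blocks and total degree `p`. -/
theorem E2_eq_iSup (n p q : ℕ) : (E2 n p q).toSubmodule = ⨆ L : LabelledPartition n,
    ⨆ _ : numBlocks (toWeighted L) + q = n ∧ totalWeight (toWeighted L) = p,
      (ELabelled L).toSubmodule := by
  apply le_antisymm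
  · rw [E2_eq_span, Submodule.span_le]
    rintro _ ⟨bs, hbs, hlen, hdeg, rfl⟩
    have h1 := numBlocks_toWeighted (sysShape bs hbs) rfl
    have h2 := totalWeight_toWeighted (sysShape bs hbs) rfl
    refine Submodule.mem_iSup_of_mem (sysShape bs hbs) (Submodule.mem_iSup_of_mem
      ⟨by rw [h1, hlen], by rw [h2, hdeg]⟩ ?_)
    rw [ELabelled_eq_span]
    exact Submodule.subset_span ⟨bs, hbs, rfl, rfl⟩
  · refine iSup₂_le fun L hL => ?_
    rw [ELabelled_eq_span, E2_eq_span]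
    refine Submodule.span_mono ?_
    rintro _ ⟨bs, hbs, hL', rfl⟩
    refine ⟨bs, hbs, ?_, ?_, rfl⟩
    · rw [← numBlocks_toWeighted L hL']; exact hL.1
    · rw [← totalWeight_toWeighted L hL']; exact hL.2

theorem iSup_E2 (n : ℕ) : ⨆ pq : ℕ × ℕ, (E2 n pq.1 pq.2).toSubmodule = ⊤ := by
  rw [eq_top_iff]
  rintro x -
  have hanti : edgeSpan n * clsSpan n ≤ clsSpan n * edgeSpan n := by
    rw [edgeSpan, clsSpan, Submodule.span_mul_span, Submodule.span_le]
    rintro _ ⟨_, ⟨i, j, rfl⟩, _, ⟨c, k, rfl⟩, rfl⟩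
    change cl _ * cl _ ∈ _
    rw [cl_anticomm]
    exact Submodule.neg_mem _ (Submodule.mul_mem_mul (Submodule.subset_span ⟨c, k, rfl⟩)
      (Submodule.subset_span ⟨i, j, rfl⟩))
  have hanti' : ∀ p, edgeSpan n * clsSpan n ^ p ≤ clsSpan n ^ p * edgeSpan n := by
    intro p
    induction p with
    | zero => rw [pow_zero, mul_one, one_mul]
    | succ p ih =>
      calc edgeSpan n * clsSpan n ^ (p + 1) = (edgeSpan n * clsSpan n) * clsSpan n ^ p := by
            rw [pow_succ', mul_assoc]
        _ ≤ (clsSpan n * edgeSpan n) * clsSpan n ^ p := mul_le_mul_left hanti _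
        _ = clsSpan n * (edgeSpan n * clsSpan n ^ p) := mul_assoc _ _ _
        _ ≤ clsSpan n * (clsSpan n ^ p * edgeSpan n) := mul_le_mul_right ih _
        _ = clsSpan n ^ (p + 1) * edgeSpan n := by rw [pow_succ' (clsSpan n), mul_assoc]
  have hmul : ∀ (g : Gen n), ∀ y ∈ ⨆ pq : ℕ × ℕ, (E2 n pq.1 pq.2).toSubmodule,
      cl g * y ∈ ⨆ pq : ℕ × ℕ, (E2 n pq.1 pq.2).toSubmodule := by
    intro g y hy
    induction hy using Submodule.iSup_induction' with
    | mem pq y hy =>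
      change y ∈ clsSpan n ^ pq.1 * edgeSpan n ^ pq.2 at hy
      cases g with
      | cls c i =>
        refine Submodule.mem_iSup_of_mem (pq.1 + 1, pq.2) ?_
        change _ ∈ clsSpan n ^ (pq.1 + 1) * edgeSpan n ^ pq.2
        rw [pow_succ', mul_assoc]
        exact Submodule.mul_mem_mul (Submodule.subset_span ⟨c, i, rfl⟩) hy
      | edge i j =>
        refine Submodule.mem_iSup_of_mem (pq.1, pq.2 + 1) ?_
        change _ ∈ clsSpan n ^ pq.1 * edgeSpan n ^ (pq.2 + 1)
        have h1 := Submodule.mul_mem_mul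
          (show cl (.edge i j) ∈ edgeSpan n from Submodule.subset_span ⟨i, j, rfl⟩) hy
        rw [← mul_assoc] at h1
        rw [pow_succ', ← mul_assoc]
        exact mul_le_mul_left (hanti' _) _ h1
    | zero => simp
    | add x y _ _ hx hy => rw [mul_add]; exact Submodule.add_mem _ hx hy
  have hone : (1 : E2Alg n) ∈ ⨆ pq : ℕ × ℕ, (E2 n pq.1 pq.2).toSubmodule := by
    refine Submodule.mem_iSup_of_mem (0, 0) ?_
    change _ ∈ clsSpan n ^ 0 * edgeSpan n ^ 0
    rw [pow_zero, pow_zero, one_mul]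
    exact Submodule.one_le.1 le_rfl
  have hx : ∀ y ∈ ⨆ pq : ℕ × ℕ, (E2 n pq.1 pq.2).toSubmodule,
      x * y ∈ ⨆ pq : ℕ × ℕ, (E2 n pq.1 pq.2).toSubmodule := by
    induction x using E2Alg.induction with
    | algebraMap r => intro y hy; rw [← Algebra.smul_def]; exact Submodule.smul_mem _ r hy
    | cl g => exact hmul g
    | mul x y hx hy => intro z hz; rw [mul_assoc]; exact hx _ (hy _ hz)
    | add x y hx hy => intro z hz; rw [add_mul]; exact Submodule.add_mem _ (hx _ hz) (hy _ hz)
  simpa using hx 1 hone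

theorem iSup_ELabelled (n : ℕ) : ⨆ L : LabelledPartition n, (ELabelled L).toSubmodule = ⊤ := by
  rw [eq_top_iff, ← iSup_E2]
  refine iSup_le fun pq => ?_
  rw [E2_eq_iSup]
  exact iSup_le fun L => iSup_le fun _ => le_iSup (fun L => (ELabelled L).toSubmodule) L

end

/-! ### Monomials and eigenvectors attached to a numbering of the points -/

/-- The blocks of `(λ,s)`. -/
abbrev BlockIdx {n : ℕ} (L : LabelledPartition n) : Type :=
  Σ c : L.blocks.toFinset, Fin (L.blocks.count c.1)

/-- The blocks of `(λ,s)`, in some order. -/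
def blockList {n : ℕ} (L : LabelledPartition n) : List (BlockIdx L) := Finset.univ.toList

/-- The numbering of the points of a block. -/
def blockFun {n : ℕ} {L : LabelledPartition n} (e : Points L ≃ Fin n) (b : BlockIdx L) :
    ZMod b.1.1.1 → Fin n := fun u => e ⟨b.1, b.2, u⟩

/-- The classes `ω_{i,j}` with complex coefficients. -/
def omegaC (n : ℕ) : Fin n → Fin n → ℂ ⊗[ℚ] E2Alg n := fun i j => 1 ⊗ₜ omega n i j

/-- The inclusion of the rational algebra in the complex one. -/
def inclC (n : ℕ) : E2Alg n →ₐ[ℚ] ℂ ⊗[ℚ] E2Alg n := Algebra.TensorProduct.includeRight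

/-- The labelled path `f 0, f 1, …, f (k-1)`. -/
def labelledPath {n : ℕ} (l : Label) {k : ℕ} (f : ZMod k → Fin n) : E2Alg n :=
  labelClass l (f 0) * pathWord (omega n) (cyclicWord k f)

/-- The labelled eigenvector for the rotations of the block `f`. -/
def labelledCycle {n : ℕ} (ζ : ∀ k : ℕ, AddChar (ZMod k) ℂ) (l : Label) {k : ℕ} [NeZero k]
    (f : ZMod k → Fin n) : ℂ ⊗[ℚ] E2Alg n :=
  inclC n (labelClass l (f 0)) * cyclicVector (omegaC n) (ζ k) f

/-- The product of the labelled paths of all blocks. -/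
def monomialVec {n : ℕ} (L : LabelledPartition n) (e : Points L ≃ Fin n) : E2Alg n :=
  ((blockList L).map fun b => labelledPath b.1.1.2 (blockFun e b)).prod

/-- The product of the labelled eigenvectors of all blocks. -/
def eigenVec {n : ℕ} (ζ : ∀ k : ℕ, AddChar (ZMod k) ℂ) (L : LabelledPartition n)
    (e : Points L ≃ Fin n) : ℂ ⊗[ℚ] E2Alg n :=
  ((blockList L).map fun b => labelledCycle ζ b.1.1.2 (blockFun e b)).prod

section

variable {n : ℕ}

theorem isEdgeSystem_omegaC (n : ℕ) : IsEdgeSystem (omegaC n) :=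
  (isEdgeSystem_omega n).map (inclC n).toRingHom

theorem map_pathWord {ι B C : Type*} [Ring B] [Ring C] (φ : B →+* C) (ω : ι → ι → B) (w : List ι) :
    w ≠ [] → φ (pathWord ω w) = pathWord (fun i j => φ (ω i j)) w := by
  cases w with
  | nil => simp
  | cons a w => exact fun _ => map_path φ a w

theorem pathWord_comp {ι κ B : Type*} [Ring B] (ω : ι → ι → B) (f : κ → ι) (w : List κ) :
    w ≠ [] → pathWord (fun i j => ω (f i) (f j)) w = pathWord ω (w.map f) := by
  cases w with
  | nil => simp
  | cons a w => exact fun _ => path_comp f a w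

theorem cyclicWord_eq_cons {ι : Type*} {k : ℕ} [NeZero k] (f : ZMod k → ι) :
    cyclicWord k f = f 0 :: (cyclicWord k f).tail := by
  obtain ⟨m, rfl⟩ := Nat.exists_eq_succ_of_ne_zero (NeZero.ne k)
  rw [cyclicWord, List.range_succ_eq_map]
  simp

theorem cyclicWord_ne_nil {ι : Type*} {k : ℕ} [NeZero k] (f : ZMod k → ι) :
    cyclicWord k f ≠ [] := by
  rw [cyclicWord_eq_cons]
  simp

theorem mem_cyclicWord {ι : Type*} {k : ℕ} [NeZero k] (f : ZMod k → ι) (i : ι) :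
    i ∈ cyclicWord k f ↔ ∃ u, f u = i := by
  rw [cyclicWord, List.mem_map]
  constructor
  · rintro ⟨m, _, rfl⟩
    exact ⟨_, rfl⟩
  · rintro ⟨u, rfl⟩
    exact ⟨u.val, List.mem_range.2 (ZMod.val_lt u), by rw [ZMod.natCast_zmod_val]⟩

theorem nodup_cyclicWord {ι : Type*} {k : ℕ} [NeZero k] {f : ZMod k → ι}
    (hf : Function.Injective f) : (cyclicWord k f).Nodup := by
  refine List.Nodup.map_on ?_ List.nodup_range
  intro a ha b hb h
  have h1 := congrArg ZMod.val (hf h)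
  rwa [ZMod.val_cast_of_lt (List.mem_range.1 ha), ZMod.val_cast_of_lt (List.mem_range.1 hb)] at h1

theorem length_cyclicWord {ι : Type*} {k : ℕ} (f : ZMod k → ι) : (cyclicWord k f).length = k := by
  simp [cyclicWord]

theorem map_cyclicVector {ι κ B C : Type*} [Ring B] [Ring C] [Algebra ℂ B] [Algebra ℂ C]
    (φ : B →ₐ[ℂ] C) {ω : ι → ι → B} {ω' : κ → κ → C} (σ : ι → κ)
    (h : ∀ i j, φ (ω i j) = ω' (σ i) (σ j)) {k : ℕ} [NeZero k] (ζ : AddChar (ZMod k) ℂ)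
    (f : ZMod k → ι) : φ (cyclicVector ω ζ f) = cyclicVector ω' ζ (σ ∘ f) := by
  rw [cyclicVector, cyclicVector, map_sum]
  refine Finset.sum_congr rfl fun s _ => ?_
  rw [map_smul]
  congr 1
  have h1 := map_pathWord φ.toRingHom ω _ (cyclicWord_ne_nil fun u => f (u + s))
  refine h1.trans ?_
  rw [show (fun i j => φ.toRingHom (ω i j)) = fun i j => ω' (σ i) (σ j) from
    funext fun i => funext fun j => h i j, pathWord_comp _ _ _ (cyclicWord_ne_nil _)]
  rw [cyclicWord, cyclicWord, List.map_map]
  rfl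

theorem inclC_pathWord {k : ℕ} [NeZero k] (f : ZMod k → Fin n) :
    inclC n (pathWord (omega n) (cyclicWord k f)) = pathWord (omegaC n) (cyclicWord k f) :=
  map_pathWord (inclC n).toRingHom (omega n) _ (cyclicWord_ne_nil f)

theorem label_mul_pathWord (l : Label) {k : ℕ} [NeZero k] (f : ZMod k → Fin n) (u : ZMod k) :
    labelClass l (f u) * pathWord (omega n) (cyclicWord k f) = labelledPath l f := by
  have hu : f u ∈ f 0 :: (cyclicWord k f).tail := by
    rw [← cyclicWord_eq_cons, mem_cyclicWord]
    exact ⟨u, rfl⟩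
  rw [labelledPath, cyclicWord_eq_cons]
  exact label_mul_path l hu

theorem label_mul_pathWord_add (l : Label) {k : ℕ} [NeZero k] (f : ZMod k → Fin n) (u h : ZMod k) :
    labelClass l (f u) * pathWord (omega n) (cyclicWord k fun u => f (u + h))
      = labelledPath l (fun u => f (u + h)) := by
  have := label_mul_pathWord l (fun u => f (u + h)) (u - h)
  simpa using this

/-- The label of an eigenvector may be placed on any of its points. -/
theorem label_mul_cyclicVector (ζ : ∀ k : ℕ, AddChar (ZMod k) ℂ) (l : Label) {k : ℕ} [NeZero k]
    (f : ZMod k → Fin n) (u : ZMod k) :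
    inclC n (labelClass l (f u)) * cyclicVector (omegaC n) (ζ k) f = labelledCycle ζ l f := by
  rw [labelledCycle, cyclicVector, Finset.mul_sum, Finset.mul_sum]
  refine Finset.sum_congr rfl fun h _ => ?_
  rw [mul_smul_comm, mul_smul_comm, ← inclC_pathWord, ← map_mul, ← map_mul,
    label_mul_pathWord_add, label_mul_pathWord_add]

theorem labelledPath_mem_span {ζ : ∀ k : ℕ, AddChar (ZMod k) ℂ}
    (hζ : ∀ k : ℕ, 0 < k → Function.Injective (ζ k)) (l : Label) {k : ℕ} [NeZero k]
    (f : ZMod k → Fin n) : inclC n (labelledPath l f) ∈ Submodule.span ℂ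
      {z | ∃ σ : Equiv.Perm (ZMod k), z = labelledCycle ζ l (f ∘ σ)} := by
  have h := (isEdgeSystem_omegaC n).pathWord_mem_span_cyclicVector (ζ k)
    (hζ k (Nat.pos_of_ne_zero (NeZero.ne k))) f
  rw [labelledPath, map_mul, inclC_pathWord]
  generalize pathWord (omegaC n) (cyclicWord k f) = x at h
  induction h using Submodule.span_induction with
  | mem x hx =>
    obtain ⟨σ, rfl⟩ := hx
    refine Submodule.subset_span ⟨σ, ?_⟩
    rw [← label_mul_cyclicVector ζ l (f ∘ σ) (σ.symm 0)]
    simp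
  | zero => simp
  | add x y _ _ hx hy => rw [mul_add]; exact Submodule.add_mem _ hx hy
  | smul r x _ hx => rw [mul_smul_comm]; exact Submodule.smul_mem _ r hx

theorem labelledCycle_mem_span (ζ : ∀ k : ℕ, AddChar (ZMod k) ℂ) (l : Label) {k : ℕ} [NeZero k]
    (f : ZMod k → Fin n) : labelledCycle ζ l f ∈ Submodule.span ℂ
      {z | ∃ σ : Equiv.Perm (ZMod k), z = inclC n (labelledPath l (f ∘ σ))} := by
  rw [labelledCycle, cyclicVector, Finset.mul_sum]
  refine Submodule.sum_mem _ fun h _ => ?_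
  rw [mul_smul_comm, ← inclC_pathWord, ← map_mul, label_mul_pathWord_add]
  exact Submodule.smul_mem _ _ (Submodule.subset_span ⟨Equiv.addRight h, rfl⟩)

theorem list_prod_mem_span {I R B : Type*} {X : I → Type*} [∀ i, Nonempty (X i)] [CommRing R]
    [Ring B] [Algebra R B] (P : I → B) (C : ∀ i, X i → B)
    (h : ∀ i, P i ∈ Submodule.span R {z | ∃ x, z = C i x}) (l : List I) (hl : l.Nodup) :
    (l.map P).prod ∈ Submodule.span R
      {z | ∃ x : ∀ i, X i, z = (l.map fun i => C i (x i)).prod} := by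
  classical
  induction l with
  | nil => exact Submodule.subset_span ⟨fun i => Classical.arbitrary _, rfl⟩
  | cons i l ih =>
    rw [List.nodup_cons] at hl
    have h1 := Submodule.mul_mem_mul (h i) (ih hl.2)
    rw [Submodule.span_mul_span] at h1
    rw [List.map_cons, List.prod_cons]
    refine Submodule.span_mono ?_ h1
    rintro _ ⟨_, ⟨x, rfl⟩, _, ⟨y, rfl⟩, rfl⟩
    refine ⟨Function.update y i x, ?_⟩
    rw [List.map_cons, List.prod_cons, Function.update_self]
    dsimp only
    congr 2
    refine List.map_congr_left fun j hj => ?_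
    rw [Function.update_of_ne]
    rintro rfl
    exact hl.1 hj

/-- Permuting the points inside the blocks. -/
def blockwise {L : LabelledPartition n} (σ : ∀ b : BlockIdx L, Equiv.Perm (ZMod b.1.1.1)) :
    Equiv.Perm (Points L) :=
  Equiv.sigmaCongrRight fun c => Equiv.prodCongrRight fun j => σ ⟨c, j⟩

theorem nodup_blockList (L : LabelledPartition n) : (blockList L).Nodup := Finset.nodup_toList _

theorem mem_blockList {L : LabelledPartition n} (b : BlockIdx L) : b ∈ blockList L := by
  simp [blockList]

theorem inclC_monomialVec (L : LabelledPartition n) (e : Points L ≃ Fin n) :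
    inclC n (monomialVec L e)
      = ((blockList L).map fun b => inclC n (labelledPath b.1.1.2 (blockFun e b))).prod := by
  rw [monomialVec, map_list_prod, List.map_map]
  rfl

theorem span_eigenVec {ζ : ∀ k : ℕ, AddChar (ZMod k) ℂ}
    (hζ : ∀ k : ℕ, 0 < k → Function.Injective (ζ k)) (L : LabelledPartition n) :
    Submodule.span ℂ (Set.range (eigenVec ζ L))
      = Submodule.span ℂ (Set.range fun e => inclC n (monomialVec L e)) := by
  apply le_antisymm
  · rw [Submodule.span_le]
    rintro _ ⟨e, rfl⟩
    have h := list_prod_mem_span (R := ℂ)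
      (fun b : BlockIdx L => labelledCycle ζ b.1.1.2 (blockFun e b))
      (fun b (σ : Equiv.Perm (ZMod b.1.1.1)) => inclC n (labelledPath b.1.1.2 (blockFun e b ∘ σ)))
      (fun b => labelledCycle_mem_span ζ _ _) (blockList L) (nodup_blockList L)
    refine Submodule.span_mono ?_ h
    rintro _ ⟨σ, rfl⟩
    exact ⟨(blockwise σ).trans e, inclC_monomialVec L _⟩
  · rw [Submodule.span_le]
    rintro _ ⟨e, rfl⟩
    have h := list_prod_mem_span (R := ℂ)
      (fun b : BlockIdx L => inclC n (labelledPath b.1.1.2 (blockFun e b)))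
      (fun b (σ : Equiv.Perm (ZMod b.1.1.1)) => labelledCycle ζ b.1.1.2 (blockFun e b ∘ σ))
      (fun b => labelledPath_mem_span hζ _ _) (blockList L) (nodup_blockList L)
    rw [← inclC_monomialVec] at h
    refine Submodule.span_mono ?_ h
    rintro _ ⟨σ, rfl⟩
    exact ⟨(blockwise σ).trans e, rfl⟩

theorem map_blockList (L : LabelledPartition n) :
    ((blockList L).map fun b => b.1.1 : List (ℕ × Label)) = L.blocks := by
  ext b
  rw [← Multiset.map_coe, blockList, Finset.coe_toList, Multiset.count_map, ← Finset.filter_val,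
    Finset.card_val, Finset.card_filter, Fintype.sum_sigma]
  by_cases hb : b ∈ L.blocks
  · rw [Finset.sum_eq_single ⟨b, Multiset.mem_toFinset.2 hb⟩]
    · simp
    · intro c _ hc
      have : b ≠ c.1 := fun h => hc (Subtype.ext h.symm)
      simp [this]
    · simp
  · rw [Multiset.count_eq_zero_of_notMem hb]
    refine Finset.sum_eq_zero fun c _ => ?_
    have : b ≠ c.1 := fun h => hb (h ▸ Multiset.mem_toFinset.1 c.2)
    simp [this]

theorem exists_map_perm {α β γ : Type*} [Nonempty β] (f : α → γ) (g : β → γ) {l : List α}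
    (hl : l.Nodup) {m : List β} (h : (l.map f).Perm (m.map g)) :
    ∃ w : α → β, (l.map w).Perm m ∧ ∀ a ∈ l, g (w a) = f a := by
  classical
  induction l generalizing m with
  | nil =>
    have : m = [] := by simpa using h
    subst this
    exact ⟨fun _ => Classical.arbitrary _, by simp, by simp⟩
  | cons a l ih =>
    rw [List.nodup_cons] at hl
    have hmem : f a ∈ m.map g := h.mem_iff.1 (by simp)
    obtain ⟨b, hb, hba⟩ := List.mem_map.1 hmem
    have hperm := List.perm_cons_erase hb
    have h2 := h.trans (hperm.map g)
    rw [List.map_cons, List.map_cons, hba, List.perm_cons] at h2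
    obtain ⟨w, hw, hw'⟩ := ih hl.2 h2
    have hup : ∀ c ∈ l, Function.update w a b c = w c := fun c hc =>
      Function.update_of_ne (by rintro rfl; exact hl.1 hc) _ _
    refine ⟨Function.update w a b, ?_, fun c hc => ?_⟩
    · rw [List.map_cons, Function.update_self, List.map_congr_left hup]
      exact (hw.cons b).trans hperm.symm
    · rcases List.mem_cons.1 hc with rfl | hc
      · rw [Function.update_self, hba]
      · rw [hup c hc, hw' c hc]

/-- The labelled words attached to a numbering of the points. -/
def blockWords (L : LabelledPartition n) (e : Points L ≃ Fin n) : List (LWord n) :=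
  (blockList L).map fun b =>
    (b.1.1.2, (blockFun e b 0, (cyclicWord b.1.1.1 (blockFun e b)).tail))

theorem sysVal_blockWords (L : LabelledPartition n) (e : Points L ≃ Fin n) :
    sysVal (blockWords L e) = monomialVec L e := by
  rw [sysVal, blockWords, List.map_map, monomialVec]
  congr 1
  refine List.map_congr_left fun b _ => ?_
  rw [labelledPath, cyclicWord_eq_cons]
  rfl

theorem isLWordSystem_blockWords (L : LabelledPartition n) (e : Points L ≃ Fin n) :
    IsLWordSystem (blockWords L e) := by
  have h : ((blockWords L e).map Prod.snd).flatMap Word.letters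
      = (blockList L).flatMap fun b => cyclicWord b.1.1.1 (blockFun e b) := by
    rw [blockWords, List.map_map, List.flatMap_map]
    congr 1
    funext b
    exact (cyclicWord_eq_cons (blockFun e b)).symm
  rw [IsLWordSystem, IsWordSystem, h, List.perm_ext_iff_of_nodup _ (List.nodup_finRange n)]
  · intro i
    simp only [List.mem_flatMap, List.mem_finRange, iff_true]
    refine ⟨⟨(e.symm i).1, (e.symm i).2.1⟩, mem_blockList _, ?_⟩
    rw [mem_cyclicWord]
    exact ⟨(e.symm i).2.2, e.apply_symm_apply i⟩
  · rw [List.nodup_flatMap]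
    refine ⟨fun b _ => nodup_cyclicWord fun u v huv => ?_, ?_⟩
    · have := e.injective huv
      simpa using this
    · refine (nodup_blockList L).imp fun {b c} hbc i hi hj => ?_
      rw [mem_cyclicWord] at hi hj
      obtain ⟨u, hu⟩ := hi
      obtain ⟨v, hv⟩ := hj
      apply hbc
      have h1 := e.injective (hu.trans hv.symm)
      obtain ⟨c, j⟩ := c
      obtain ⟨b, i⟩ := b
      rw [Sigma.mk.injEq] at h1
      obtain ⟨rfl, h2⟩ := h1
      rw [heq_iff_eq, Prod.mk.injEq] at h2
      exact congrArg _ h2.1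

theorem map_type_blockWords (L : LabelledPartition n) (e : Points L ≃ Fin n) :
    ((blockWords L e).map LWord.type : List _) = L.blocks := by
  conv_rhs => rw [← map_blockList]
  rw [blockWords, List.map_map]
  congr 1
  refine List.map_congr_left fun b _ => ?_
  refine Prod.ext ?_ rfl
  change (cyclicWord b.1.1.1 (blockFun e b)).tail.length + 1 = _
  rw [List.length_tail, length_cyclicWord]
  exact Nat.succ_pred (NeZero.ne b.1.1.1)

/-- Every system of labelled words comes from a numbering of the points. -/
theorem exists_monomialVec (L : LabelledPartition n) {bs : List (LWord n)} (hbs : IsLWordSystem bs)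
    (h : (bs.map LWord.type : List _) = L.blocks) :
    ∃ e, sysVal bs = monomialVec L e ∨ sysVal bs = -monomialVec L e := by
  classical
  rcases bs with _ | ⟨b₀, bs⟩
  · have h1 := map_blockList L
    have h2 : blockList L = [] := by simpa using h1.trans h.symm
    obtain ⟨e⟩ := nonempty_points_equiv L
    exact ⟨e, Or.inl (by simp [sysVal, monomialVec, h2])⟩
  have : Nonempty (LWord n) := ⟨b₀⟩
  generalize b₀ :: bs = bs at hbs h
  rw [← map_blockList, Multiset.coe_eq_coe] at h
  obtain ⟨w, hw, hw'⟩ := exists_map_perm _ _ (nodup_blockList L) h.symm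
  have htype : ∀ b, LWord.type (w b) = b.1.1 := fun b => hw' b (mem_blockList b)
  have hlen : ∀ b, (w b).2.letters.length = b.1.1.1 := fun b => congrArg Prod.fst (htype b)
  let F : Points L → Fin n := fun x =>
    (w ⟨x.1, x.2.1⟩).2.letters.getD x.2.2.val (w ⟨x.1, x.2.1⟩).2.1
  have hsys := isLWordSystem_perm hw.symm hbs
  have hsurj : Function.Surjective F := by
    intro i
    obtain ⟨z, hz, hi⟩ := IsWordSystem.mem hsys i
    rw [List.map_map] at hz
    obtain ⟨b, -, rfl⟩ := List.mem_map.1 hz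
    obtain ⟨m, hm, hmi⟩ := List.getElem_of_mem hi
    have hm' : m < b.1.1.1 := by rw [← hlen b]; exact hm
    refine ⟨⟨b.1, b.2, (m : ZMod b.1.1.1)⟩, ?_⟩
    change m < (w b).2.letters.length at hm
    change (w b).2.letters.getD ((m : ZMod b.1.1.1)).val _ = i
    rw [ZMod.val_cast_of_lt hm', List.getD_eq_getElem _ _ hm]
    exact hmi
  have hbij : Function.Bijective F := by
    rw [Fintype.bijective_iff_surjective_and_card]
    exact ⟨hsurj, Fintype.card_congr (nonempty_points_equiv L).some⟩
  refine ⟨Equiv.ofBijective F hbij, ?_⟩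
  have hval : sysVal ((blockList L).map w) = monomialVec L (Equiv.ofBijective F hbij) := by
    rw [sysVal, List.map_map, monomialVec]
    congr 1
    refine List.map_congr_left fun b _ => ?_
    have hword : cyclicWord b.1.1.1 (blockFun (Equiv.ofBijective F hbij) b) = (w b).2.letters := by
      refine List.ext_getElem ?_ fun m h1 h2 => ?_
      · rw [length_cyclicWord, hlen]
      · have hm' : m < b.1.1.1 := by rw [← hlen b]; exact h2
        have : blockFun (Equiv.ofBijective F hbij) b (m : ZMod b.1.1.1)
            = (w b).2.letters.getD ((m : ZMod b.1.1.1)).val (w b).2.1 := rfl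
        rw [ZMod.val_cast_of_lt hm', List.getD_eq_getElem _ _ h2] at this
        simpa [cyclicWord] using this
    have h0 : blockFun (Equiv.ofBijective F hbij) b 0 = (w b).2.1 := by
      have h1 := cyclicWord_eq_cons (blockFun (Equiv.ofBijective F hbij) b)
      rw [hword] at h1
      exact (List.cons.inj h1).1.symm
    rw [labelledPath, hword, h0, ← htype b]
    rfl
  rw [← hval]
  exact sysVal_perm hw.symm

theorem baseChange_ELabelled (L : LabelledPartition n) :
    (ELabelled L).toSubmodule.baseChange ℂ
      = Submodule.span ℂ (Set.range fun e => inclC n (monomialVec L e)) := by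
  rw [ELabelled_eq_span, Submodule.baseChange_span]
  apply le_antisymm
  · rw [Submodule.span_le]
    rintro _ ⟨_, ⟨bs, hbs, h, rfl⟩, rfl⟩
    change inclC n (sysVal bs) ∈ _
    obtain ⟨e, he | he⟩ := exists_monomialVec L hbs h <;> rw [he]
    · exact Submodule.subset_span ⟨e, rfl⟩
    · rw [map_neg]
      exact Submodule.neg_mem _ (Submodule.subset_span ⟨e, rfl⟩)
  · refine Submodule.span_mono ?_
    rintro _ ⟨e, rfl⟩
    exact ⟨_, ⟨blockWords L e, isLWordSystem_blockWords L e, map_type_blockWords L e,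
      (sysVal_blockWords L e).symm⟩, rfl⟩

end

/-! ### The eigenvectors transform by the characters `sgn ⊗ ξ(λ,s)` -/

section

variable {R B : Type*} [CommRing R] [Ring B] [Algebra R B] {W : Submodule R B}

theorem list_prod_mem_pow {I : Type*} {f : I → B} {d : I → ℕ} (hf : ∀ i, f i ∈ W ^ d i)
    (l : List I) : (l.map f).prod ∈ W ^ (l.map d).sum := by
  induction l with
  | nil => exact Submodule.one_le.1 (pow_zero W).ge
  | cons i l ih =>
    rw [List.map_cons, List.map_cons, List.prod_cons, List.sum_cons, pow_add]
    exact Submodule.mul_mem_mul (hf i) ih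

/-- Exchanging two factors of the same degree `d` changes a product by `(-1)^d`, whatever stands
between them. -/
theorem list_prod_swap (hW : ∀ u ∈ W, ∀ v ∈ W, u * v = -(v * u)) {I : Type*} [DecidableEq I]
    {f : I → B} {d : I → ℕ} (hf : ∀ i, f i ∈ W ^ d i) {a b : I} (hab : a ≠ b) (hd : d a = d b)
    {l : List I} (hl : l.Nodup) (ha : a ∈ l) (hb : b ∈ l) :
    (l.map (f ∘ Equiv.swap a b)).prod = (-1) ^ d a * (l.map f).prod := by
  obtain ⟨l₁, l₂, rfl⟩ := List.append_of_mem ha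
  wlog hb' : b ∈ l₂ generalizing a b l₁ l₂
  · have hb₁ : b ∈ l₁ := by
      rcases List.mem_append.1 hb with h | h
      · exact h
      · exact absurd ((List.mem_cons.1 h).resolve_left hab.symm) hb'
    obtain ⟨l₃, l₄, rfl⟩ := List.append_of_mem hb₁
    have h := this hab.symm hd.symm l₃ (l₄ ++ a :: l₂) (by simpa using hl) (by simp)
      (by simp) (by simp)
    rw [Equiv.swap_comm, hd]
    simpa using h
  obtain ⟨l₃, l₄, rfl⟩ := List.append_of_mem hb'
  have hfix : ∀ m : List I, a ∉ m → b ∉ m → m.map (f ∘ Equiv.swap a b) = m.map f := by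
    intro m ham hbm
    refine List.map_congr_left fun i hi => ?_
    rw [Function.comp_apply, Equiv.swap_apply_of_ne_of_ne]
    · rintro rfl; exact ham hi
    · rintro rfl; exact hbm hi
  simp only [List.nodup_append, List.nodup_cons, List.mem_cons, List.mem_append] at hl
  obtain ⟨-, ⟨ha', -, ⟨hb₄, -⟩, h34⟩, hdis⟩ := hl
  have ha₁ : a ∉ l₁ := fun h => hdis a h a (Or.inl rfl) rfl
  have hb₁ : b ∉ l₁ := fun h => hdis b h b (Or.inr (Or.inr (Or.inl rfl))) rfl
  have hb₃ : b ∉ l₃ := fun h => h34 b h b (Or.inl rfl) rfl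
  have ha₃ : a ∉ l₃ := fun h => ha' (Or.inl h)
  have ha₄ : a ∉ l₄ := fun h => ha' (Or.inr (Or.inr h))
  have hx := list_prod_mem_pow hf l₃
  simp only [List.map_append, List.map_cons, List.prod_append, List.prod_cons,
    hfix l₁ ha₁ hb₁, hfix l₃ ha₃ hb₃, hfix l₄ ha₄ hb₄, Function.comp_apply, Equiv.swap_apply_left,
    Equiv.swap_apply_right]
  generalize (l₃.map f).prod = x at hx ⊢
  generalize (l₃.map d).sum = D at hx ⊢
  have e1 := mul_comm_of_mem_pow hW (hf b) hx
  have e2 := mul_comm_of_mem_pow hW (hf b) (hf a)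
  have e3 := mul_comm_of_mem_pow hW hx (hf a)
  rw [← hd] at e1 e2
  have key : f b * (x * f a) = (-1) ^ d a * (f a * (x * f b)) := by
    have hdd : (-1 : B) ^ (d a * d a) = (-1) ^ d a := by
      rcases Nat.even_or_odd (d a) with h | h
      · rw [h.neg_one_pow, (h.mul_right _).neg_one_pow]
      · rw [h.neg_one_pow, (h.mul h).neg_one_pow]
    rw [hdd] at e2
    rw [mul_comm D] at e3
    rw [← mul_assoc, e1, mul_assoc, mul_assoc, e2]
    rcases neg_one_pow_eq_or B (d a * D) with h | h <;> rw [h] at e3 ⊢ <;>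
      rcases neg_one_pow_eq_or B (d a) with h' | h' <;> rw [h'] <;>
      simp [← mul_assoc, e3]
  have hcomm : ∀ z : B, (-1) ^ d a * z = z * (-1) ^ d a := fun z => by
    rcases neg_one_pow_eq_or B (d a) with h | h <;> simp [h]
  calc _ = (l₁.map f).prod * ((f b * (x * f a)) * (l₄.map f).prod) := by simp only [mul_assoc]
    _ = _ := by
      rw [key, mul_assoc ((-1) ^ d a), ← mul_assoc _ ((-1) ^ d a), ← hcomm]
      simp only [mul_assoc]

theorem sigmaCongrRight_mulSingle_swap {κ : Type*} [DecidableEq κ] {J : κ → Type*}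
    [∀ c, DecidableEq (J c)] (c : κ) (j k : J c) :
    Equiv.sigmaCongrRight (Pi.mulSingle c (Equiv.swap j k) : ∀ c, Equiv.Perm (J c))
      = Equiv.swap ⟨c, j⟩ ⟨c, k⟩ := by
  apply Equiv.ext
  rintro ⟨c', i⟩
  by_cases hc : c' = c
  · subst hc
    rw [Equiv.sigmaCongrRight_apply]
    dsimp only
    rw [Pi.mulSingle_eq_same]
    by_cases hj : i = j
    · subst hj; simp
    · by_cases hk : i = k
      · subst hk; simp
      · rw [Equiv.swap_apply_of_ne_of_ne hj hk, Equiv.swap_apply_of_ne_of_ne] <;>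
          simp [hj, hk]
  · rw [Equiv.sigmaCongrRight_apply]
    dsimp only
    rw [Pi.mulSingle_eq_of_ne hc, Equiv.swap_apply_of_ne_of_ne]
    · rfl
    · exact fun h => hc (congrArg Sigma.fst h)
    · exact fun h => hc (congrArg Sigma.fst h)

theorem sign_sigmaCongrRight {κ : Type*} [Fintype κ] [DecidableEq κ] {J : κ → Type*}
    [∀ c, Fintype (J c)] [∀ c, DecidableEq (J c)] (π : ∀ c, Equiv.Perm (J c)) :
    Equiv.Perm.sign (Equiv.sigmaCongrRight π) = ∏ c, Equiv.Perm.sign (π c) := by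
  let F : (∀ c, Equiv.Perm (J c)) →* ℤˣ := Equiv.Perm.sign.comp
    (Equiv.Perm.sigmaCongrRightHom J)
  let G : (∀ c, Equiv.Perm (J c)) →* ℤˣ :=
    ∏ c, Equiv.Perm.sign.comp (Pi.evalMonoidHom _ c)
  have hG : ∀ π, G π = ∏ c, Equiv.Perm.sign (π c) := fun π => by
    simp [G, MonoidHom.finsetProd_apply]
  have h : π ∈ MonoidHom.eqLocus F G := by
    refine Subgroup.pi_mem_of_mulSingle_mem π fun c => ?_
    generalize π c = τ
    induction τ using Equiv.Perm.swap_induction_on with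
    | one => rw [Pi.mulSingle_one]; exact Subgroup.one_mem _
    | swap_mul τ j k hjk h =>
      rw [Pi.mulSingle_mul]
      refine Subgroup.mul_mem _ ?_ h
      have hne : (⟨c, j⟩ : Σ c, J c) ≠ ⟨c, k⟩ := fun h => hjk (by simpa using h)
      change Equiv.Perm.sign (Equiv.sigmaCongrRight _) = G _
      rw [sigmaCongrRight_mulSingle_swap, Equiv.Perm.sign_swap hne, hG, Finset.prod_eq_single c]
      · rw [Pi.mulSingle_eq_same, Equiv.Perm.sign_swap hjk]
      · intro c' _ hc'
        rw [Pi.mulSingle_eq_of_ne hc', Equiv.Perm.sign_one]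
      · simp
  exact (show F π = G π from h).trans (hG π)

/-- The sign rule for permuting the factors of a product within classes of factors of the same
degree. -/
theorem list_prod_sigma_perm (hW : ∀ u ∈ W, ∀ v ∈ W, u * v = -(v * u)) {κ : Type*}
    [Fintype κ] [DecidableEq κ] {J : κ → Type*} [∀ c, Fintype (J c)] [∀ c, DecidableEq (J c)]
    {d : κ → ℕ} (l : List (Σ c, J c)) (hl : l.Nodup) (hmem : ∀ i, i ∈ l)
    (π : ∀ c, Equiv.Perm (J c)) (f : (Σ c, J c) → B) (hf : ∀ i, f i ∈ W ^ d i.1) :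
    (l.map (f ∘ Equiv.sigmaCongrRight π)).prod
      = (∏ c, Equiv.Perm.sign (π c) ^ d c) • (l.map f).prod := by
  classical
  let H : Subgroup (∀ c, Equiv.Perm (J c)) :=
    { carrier := {π | ∀ f : (Σ c, J c) → B, (∀ i, f i ∈ W ^ d i.1) →
        (l.map (f ∘ Equiv.sigmaCongrRight π)).prod
          = (∏ c, Equiv.Perm.sign (π c) ^ d c) • (l.map f).prod}
      one_mem' := by
        intro f _
        simp
      mul_mem' := by
        intro π π' h h' f hf
        have h1 := h' (f ∘ Equiv.sigmaCongrRight π) fun i => hf ⟨i.1, π i.1 i.2⟩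
        have h2 : (f ∘ Equiv.sigmaCongrRight π) ∘ Equiv.sigmaCongrRight π'
            = f ∘ Equiv.sigmaCongrRight (π * π') := rfl
        rw [← h2, h1, h f hf, smul_smul, ← Finset.prod_mul_distrib]
        congr 1
        refine Finset.prod_congr rfl fun c _ => ?_
        rw [Pi.mul_apply, Equiv.Perm.sign_mul, mul_pow, mul_comm]
      inv_mem' := by
        intro π h f hf
        have h1 := h (f ∘ Equiv.sigmaCongrRight π⁻¹) fun i => hf ⟨i.1, π⁻¹ i.1 i.2⟩
        have h2 : (f ∘ Equiv.sigmaCongrRight π⁻¹) ∘ Equiv.sigmaCongrRight π = f := by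
          funext ⟨c, j⟩
          simp
        rw [h2] at h1
        rw [h1, smul_smul, ← Finset.prod_mul_distrib, Finset.prod_eq_one, one_smul]
        intro c _
        rw [Pi.inv_apply, Equiv.Perm.sign_inv, ← mul_pow, Int.units_mul_self, one_pow] }
  suffices h : π ∈ H from h f hf
  refine Subgroup.pi_mem_of_mulSingle_mem π fun c => ?_
  generalize π c = τ
  induction τ using Equiv.Perm.swap_induction_on with
  | one => rw [Pi.mulSingle_one]; exact H.one_mem
  | swap_mul τ j k hjk h =>
    rw [Pi.mulSingle_mul]
    refine H.mul_mem ?_ h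
    intro f hf
    have hne : (⟨c, j⟩ : Σ c, J c) ≠ ⟨c, k⟩ := fun h => hjk (by simpa using h)
    rw [sigmaCongrRight_mulSingle_swap, list_prod_swap hW (d := fun i => d i.1) hf hne rfl hl (hmem _) (hmem _),
      Finset.prod_eq_single c]
    · rw [Pi.mulSingle_eq_same, Equiv.Perm.sign_swap hjk]
      rcases neg_one_pow_eq_or ℤˣ (d c) with h | h <;>
        rcases neg_one_pow_eq_or B (d c) with h' | h' <;>
        rcases Nat.even_or_odd (d c) with h2 | h2 <;>
        simp [h2.neg_one_pow, Units.smul_def]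
    · intro c' _ hc'
      rw [Pi.mulSingle_eq_of_ne hc', Equiv.Perm.sign_one, one_pow]
    · simp

end

section

variable {n : ℕ}

/-- The complex span of the generators. -/
def genSpanC (n : ℕ) : Submodule ℂ (ℂ ⊗[ℚ] E2Alg n) :=
  Submodule.span ℂ (Set.range fun g => inclC n (cl g))

theorem genSpanC_anticomm : ∀ u ∈ genSpanC n, ∀ v ∈ genSpanC n, u * v = -(v * u) := by
  intro u hu v hv
  induction hu, hv using Submodule.span_induction₂ with
  | mem_mem x y hx hy =>
    obtain ⟨a, rfl⟩ := hx
    obtain ⟨b, rfl⟩ := hy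
    simp only [← map_mul, ← map_neg, cl_anticomm a b]
  | zero_left => simp
  | zero_right => simp
  | add_left x y z _ _ _ h1 h2 => rw [add_mul, mul_add, h1, h2]; abel
  | add_right x y z _ _ _ h1 h2 => rw [add_mul, mul_add, h1, h2]; abel
  | smul_left r x y _ _ h => rw [smul_mul_assoc, h, mul_smul_comm, smul_neg]
  | smul_right r x y _ _ h => rw [mul_smul_comm, h, smul_mul_assoc, smul_neg]

theorem inclC_label_mem (l : Label) (i : Fin n) :
    inclC n (labelClass l i) ∈ genSpanC n ^ (l.deg : ℕ) := by
  have h : ∀ c, inclC n (cl (.cls c i)) ∈ genSpanC n := fun c => Submodule.subset_span ⟨_, rfl⟩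
  cases l
  · rw [labelClass, map_one]; exact Submodule.one_le.1 (pow_zero (genSpanC n)).ge
  · exact (pow_one (genSpanC n)).ge (h 0)
  · exact (pow_one (genSpanC n)).ge (h 1)
  · rw [labelClass, map_mul]
    exact (pow_two (genSpanC n)).ge (Submodule.mul_mem_mul (h 0) (h 1))

theorem path_omegaC_mem (a : Fin n) (w : List (Fin n)) :
    path (omegaC n) a w ∈ genSpanC n ^ w.length := by
  induction w generalizing a with
  | nil => exact Submodule.one_le.1 (pow_zero (genSpanC n)).ge
  | cons b w ih =>
    rw [path_cons, List.length_cons, pow_succ']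
    exact Submodule.mul_mem_mul (Submodule.subset_span ⟨.edge a b, rfl⟩) (ih b)

theorem labelledCycle_mem (ζ : ∀ k : ℕ, AddChar (ZMod k) ℂ) (l : Label) {k : ℕ} [NeZero k]
    (f : ZMod k → Fin n) : labelledCycle ζ l f ∈ genSpanC n ^ ((l.deg : ℕ) + (k - 1)) := by
  rw [labelledCycle, pow_add]
  refine Submodule.mul_mem_mul (inclC_label_mem _ _) ?_
  rw [cyclicVector]
  refine Submodule.sum_mem _ fun h _ => Submodule.smul_mem _ _ ?_
  rw [cyclicWord_eq_cons]
  have := path_omegaC_mem (f (0 + h)) (cyclicWord k fun u => f (u + h)).tail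
  rwa [List.length_tail, length_cyclicWord] at this

theorem labelledCycle_rotate (ζ : ∀ k : ℕ, AddChar (ZMod k) ℂ) (l : Label) {k : ℕ} [NeZero k]
    (f : ZMod k → Fin n) (s : ZMod k) : labelledCycle ζ l (fun u => f (u + s))
      = (ζ k s * ((Equiv.Perm.sign (Equiv.addRight s) : ℤ) : ℂ)) • labelledCycle ζ l f := by
  rw [labelledCycle, cyclicVector_rotate, mul_smul_comm, label_mul_cyclicVector]

theorem list_prod_smul {I : Type*} {A : Type*} [Ring A] [Algebra ℂ A] (c : I → ℂ) (F : I → A)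
    (l : List I) :
    (l.map fun i => c i • F i).prod = (l.map c).prod • (l.map F).prod := by
  induction l with
  | nil => simp
  | cons i l ih => simp [ih, smul_smul, mul_comm]

theorem sign_of_isWreath {L : LabelledPartition n} {g : Equiv.Perm (Points L)}
    {π : ∀ c : L.blocks.toFinset, Equiv.Perm (Fin (L.blocks.count c.1))}
    {s : ∀ c : L.blocks.toFinset, Fin (L.blocks.count c.1) → ZMod c.1.1} (h : IsWreath L g π s) :
    Equiv.Perm.sign g = ∏ c : L.blocks.toFinset, (Equiv.Perm.sign (π c) ^ c.1.1 *
      ∏ j, Equiv.Perm.sign (Equiv.addRight (s c j))) := by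
  have hg : g = Equiv.sigmaCongrRight fun c =>
      (Equiv.prodCongrRight fun j => Equiv.addRight (s c j)).trans
        (Equiv.prodCongrLeft fun _ : ZMod c.1.1 => π c) := by
    apply Equiv.ext
    rintro ⟨c, j, u⟩
    rw [h]
    rfl
  rw [hg, sign_sigmaCongrRight]
  refine Finset.prod_congr rfl fun c _ => ?_
  rw [Equiv.Perm.sign_trans, Equiv.Perm.sign_prodCongrLeft, Equiv.Perm.sign_prodCongrRight]
  simp [ZMod.card]

/-- The group `Z(λ,s)` acts on the eigenvectors by `sgn ⊗ ξ(λ,s)`. -/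
theorem eigenVec_trans (ζ : ∀ k : ℕ, AddChar (ZMod k) ℂ) (L : LabelledPartition n) (g : Z L)
    (e : Points L ≃ Fin n) : eigenVec ζ L (g.1.trans e)
      = (((Equiv.Perm.sign g.1 : ℤ) : ℂ) * xi ζ L g) • eigenVec ζ L e := by
  classical
  set π := blockPerm g
  set s := blockShift g
  have hw : IsWreath L g.1 π s := isWreath_block g
  let F : BlockIdx L → ℂ ⊗[ℚ] E2Alg n := fun b => labelledCycle ζ b.1.1.2 (blockFun e b)
  have h1 : eigenVec ζ L (g.1.trans e) = ((blockList L).map fun b =>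
      (ζ b.1.1.1 (s b.1 b.2) * ((Equiv.Perm.sign (Equiv.addRight (s b.1 b.2)) : ℤ) : ℂ)) •
        (F ∘ Equiv.sigmaCongrRight π) b).prod := by
    rw [eigenVec]
    congr 1
    refine List.map_congr_left fun b _ => ?_
    rw [Function.comp_apply]
    change _ = _ • labelledCycle ζ b.1.1.2 (blockFun e ⟨b.1, π b.1 b.2⟩)
    rw [← labelledCycle_rotate]
    congr 1
    funext u
    exact congrArg e (hw b.1 b.2 u)
  have h2 := list_prod_sigma_perm genSpanC_anticomm
    (d := fun c : L.blocks.toFinset => (c.1.2.deg : ℕ) + (c.1.1 - 1)) (blockList L)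
    (nodup_blockList L) mem_blockList π F fun b => labelledCycle_mem ζ _ _
  rw [h1, list_prod_smul, h2]
  have h3 : ((∏ c : L.blocks.toFinset, Equiv.Perm.sign (π c) ^ ((c.1.2.deg : ℕ) + (c.1.1 - 1))) •
      ((blockList L).map F).prod) = ((∏ c : L.blocks.toFinset,
        ((Equiv.Perm.sign (π c) : ℤ) : ℂ) ^ ((c.1.2.deg : ℕ) + (c.1.1 - 1)))) • eigenVec ζ L e := by
    rw [Units.smul_def, ← Int.cast_smul_eq_zsmul ℂ]
    congr 1
    push_cast
    rfl
  rw [h3, smul_smul]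
  congr 1
  rw [blockList, Finset.prod_map_toList, Fintype.prod_sigma, sign_of_isWreath hw]
  change _ = _ * ∏ c : L.blocks.toFinset, (∏ j, ζ c.1.1 (s c j)) *
    ((Equiv.Perm.sign (π c) : ℤ) : ℂ) ^ ((c.1.2.deg : ℕ) + 1)
  push_cast
  rw [← Finset.prod_mul_distrib, ← Finset.prod_mul_distrib]
  refine Finset.prod_congr rfl fun c _ => ?_
  rw [Finset.prod_mul_distrib]
  have hk : 0 < c.1.1 := Nat.pos_of_ne_zero (NeZero.ne _)
  have hpow : ((Equiv.Perm.sign (π c) : ℤ) : ℂ) ^ c.1.1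
      * ((Equiv.Perm.sign (π c) : ℤ) : ℂ) ^ ((c.1.2.deg : ℕ) + 1)
      = ((Equiv.Perm.sign (π c) : ℤ) : ℂ) ^ ((c.1.2.deg : ℕ) + (c.1.1 - 1)) := by
    rw [← pow_add, show c.1.1 + ((c.1.2.deg : ℕ) + 1)
      = ((c.1.2.deg : ℕ) + (c.1.1 - 1)) + 2 by omega, pow_add, pow_two,
      intCast_sign_mul_self, mul_one]
  rw [← hpow]
  ring

/-- The action of a permutation on the complex algebra. -/
def actC (σ : Equiv.Perm (Fin n)) : ℂ ⊗[ℚ] E2Alg n →ₐ[ℂ] ℂ ⊗[ℚ] E2Alg n :=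
  Algebra.TensorProduct.map (AlgHom.id ℂ ℂ) (actHom (σ, (1 : SL(2, ℚ))))

theorem actC_inclC (σ : Equiv.Perm (Fin n)) (x : E2Alg n) :
    actC σ (inclC n x) = inclC n (symRep n σ x) := by
  change Algebra.TensorProduct.map _ _ ((1 : ℂ) ⊗ₜ[ℚ] x) = _
  rw [Algebra.TensorProduct.map_tmul]
  rfl

theorem actC_eigenVec (ζ : ∀ k : ℕ, AddChar (ZMod k) ℂ) (L : LabelledPartition n)
    (e : Points L ≃ Fin n) (σ : Equiv.Perm (Fin n)) :
    actC σ (eigenVec ζ L e) = eigenVec ζ L (e.trans σ) := by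
  rw [eigenVec, map_list_prod, List.map_map, eigenVec]
  congr 1
  refine List.map_congr_left fun b _ => ?_
  rw [Function.comp_apply, labelledCycle, map_mul, actC_inclC, labelledCycle]
  congr 1
  · exact congrArg _ (symRep_label σ _ _)
  · refine map_cyclicVector (actC σ) σ (fun i j => ?_) _ _
    refine (actC_inclC σ (omega n i j)).trans ?_
    change inclC n (actHom _ (cl _)) = _
    rw [actHom_cl]
    rfl

theorem trans_ZHom (L : LabelledPartition n) (e : Points L ≃ Fin n) (g : Z L) :
    e.trans (ZHom L e g) = g.1.trans e := by
  apply Equiv.ext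
  intro x
  simp [ZHom, Equiv.permCongrHom]

/-- The space `ℂ ⊗ E(λ,s)` is spanned by one eigenvector for each coset of `Z(λ,s)`. -/
theorem span_eigenVec_eq (ζ : ∀ k : ℕ, AddChar (ZMod k) ℂ) (L : LabelledPartition n)
    (e : Points L ≃ Fin n) : Submodule.span ℂ (Set.range (eigenVec ζ L))
      = Submodule.span ℂ (Set.range fun q : Equiv.Perm (Fin n) ⧸ (ZHom L e).range =>
        eigenVec ζ L (e.trans q.out)) := by
  apply le_antisymm
  · rw [Submodule.span_le]
    rintro _ ⟨e', rfl⟩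
    set σ : Equiv.Perm (Fin n) := e.symm.trans e' with hσ
    have he' : e' = e.trans σ := by
      apply Equiv.ext
      intro x
      simp [hσ]
    obtain ⟨⟨z, g, hg⟩, hz⟩ := QuotientGroup.mk_out_eq_mul (ZHom L e).range σ
    dsimp only at hz
    set τ : Equiv.Perm (Fin n) := (σ : Equiv.Perm (Fin n) ⧸ (ZHom L e).range).out with hτ
    have h1 : e' = (g⁻¹).1.trans (e.trans τ) := by
      have h2 : σ = τ * ZHom L e g⁻¹ := by rw [hz, ← hg, map_inv, mul_inv_cancel_right]
      rw [he', h2, Equiv.Perm.mul_def, ← Equiv.trans_assoc, trans_ZHom, Equiv.trans_assoc]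
    rw [h1, eigenVec_trans]
    exact Submodule.smul_mem _ _ (Submodule.subset_span ⟨_, rfl⟩)
  · refine Submodule.span_mono ?_
    rintro _ ⟨q, rfl⟩
    exact ⟨_, rfl⟩

/-- Subspaces that span are independent as soon as their dimensions add up to that of the whole
space. -/
theorem iSupIndep_of_sum_finrank_eq {K I U : Type*} [Field K] [AddCommGroup U] [Module K U]
    [Module.Finite K U] [Fintype I] {A : I → Submodule K U} (htop : ⨆ i, A i = ⊤)
    (h : ∑ i, Module.finrank K (A i) = Module.finrank K U) : iSupIndep A := by
  classical
  have hsurj : Function.Surjective (DirectSum.coeLinearMap A) := by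
    rw [← LinearMap.range_eq_top, DirectSum.range_coeLinearMap, htop]
  have hinj : Function.Injective (DirectSum.coeLinearMap A) := by
    rw [← Module.finrank_directSum] at h
    exact (LinearMap.injective_iff_surjective_of_finrank_eq_finrank h).2 hsurj
  exact DirectSum.IsInternal.submodule_iSupIndep ⟨hinj, hsurj⟩

theorem finite_ELabelled (L : LabelledPartition n) :
    Module.Finite ℚ (ELabelled L).toSubmodule := by
  classical
  rw [ELabelled_eq_span]
  have h : {z | ∃ bs : List (LWord n), IsLWordSystem bs ∧ (bs.map LWord.type : List _) = L.blocks ∧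
      z = sysVal bs} ⊆ Set.range (monomialVec L) ∪ Set.range fun e => -monomialVec L e := by
    rintro _ ⟨bs, hbs, hL, rfl⟩
    obtain ⟨e, he | he⟩ := exists_monomialVec L hbs hL
    · exact Or.inl ⟨e, he.symm⟩
    · exact Or.inr ⟨e, he.symm⟩
  exact FiniteDimensional.span_of_finite ℚ
    (((Set.finite_range _).union (Set.finite_range _)).subset h)

instance finite_E2Alg (n : ℕ) : Module.Finite ℚ (E2Alg n) := by
  have := fun L : LabelledPartition n => finite_ELabelled L
  have h := Submodule.finite_iSup fun L : LabelledPartition n => (ELabelled L).toSubmodule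
  rw [iSup_ELabelled] at h
  exact Module.finite_def.2 ((Module.Finite.iff_fg).1 h)

theorem injective_baseChange_subtype (S : Submodule ℚ (E2Alg n)) :
    Function.Injective (S.subtype.baseChange ℂ) :=
  Module.Flat.lTensor_preserves_injective_linearMap (M := ℂ) S.subtype S.subtype_injective

theorem range_baseChange_subtype (S : Submodule ℚ (E2Alg n)) :
    LinearMap.range (S.subtype.baseChange ℂ) = S.baseChange ℂ :=
  rfl

theorem finrank_baseChange_submodule (S : Submodule ℚ (E2Alg n)) :
    Module.finrank ℂ (S.baseChange ℂ) = Module.finrank ℚ S := by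
  rw [← range_baseChange_subtype, LinearMap.finrank_range_of_inj (injective_baseChange_subtype S),
    Module.finrank_baseChange]

/-- Over `ℂ` the space `E(λ,s)` is spanned by eigenvectors, one for each coset of `Z(λ,s)` up to
scalars. -/
theorem finrank_ELabelled_le {ζ : ∀ k : ℕ, AddChar (ZMod k) ℂ}
    (hζ : ∀ k : ℕ, 0 < k → Function.Injective (ζ k)) (L : LabelledPartition n)
    (e : Points L ≃ Fin n) :
    Module.finrank ℚ (ELabelled L).toSubmodule ≤ (ZHom L e).range.index := by
  classical
  rw [← finrank_baseChange_submodule, baseChange_ELabelled, ← span_eigenVec hζ,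
    span_eigenVec_eq ζ L e]
  have := Fintype.ofFinite (Equiv.Perm (Fin n) ⧸ (ZHom L e).range)
  refine (finrank_range_le_card _).trans ?_
  rw [Subgroup.index, Nat.card_eq_fintype_card]

/-- The indices of the groups `Z(λ,s)` bound the dimensions of the `E(λ,s)` from above, and their
sum is at most the lower bound for the dimension of the whole algebra; hence all the inequalities
are equalities. -/
theorem sum_finrank_ELabelled {ζ : ∀ k : ℕ, AddChar (ZMod k) ℂ}
    (hζ : ∀ k : ℕ, 0 < k → Function.Injective (ζ k))
    (e : ∀ L : LabelledPartition n, Points L ≃ Fin n) :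
    (∑ L : LabelledPartition n, Module.finrank ℚ (ELabelled L).toSubmodule
        = Module.finrank ℚ (E2Alg n)) ∧
      ∀ L : LabelledPartition n,
        Module.finrank ℚ (ELabelled L).toSubmodule = (ZHom L (e L)).range.index := by
  classical
  have h1 : Module.finrank ℚ (E2Alg n)
      ≤ ∑ L : LabelledPartition n, Module.finrank ℚ (ELabelled L).toSubmodule := by
    have := fun L : LabelledPartition n => finite_ELabelled L
    have hsurj : Function.Surjective
        (DirectSum.coeLinearMap fun L : LabelledPartition n => (ELabelled L).toSubmodule) := by
      rw [← LinearMap.range_eq_top, DirectSum.range_coeLinearMap, iSup_ELabelled]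
    have := LinearMap.finrank_le_finrank_of_surjective hsurj
    rwa [Module.finrank_directSum] at this
  have h2 := fun L : LabelledPartition n => finrank_ELabelled_le hζ L (e L)
  have h3 := Finset.sum_le_sum fun L (_ : L ∈ Finset.univ) => h2 L
  have h4 := sum_index_le e
  have h5 := le_finrank_E2Alg (fun n => finite_E2Alg n) n
  refine ⟨by omega, ?_⟩
  have h6 := (Finset.sum_eq_sum_iff_of_le fun L _ => h2 L).1 (le_antisymm h3 (by omega))
  exact fun L => h6 L (Finset.mem_univ L)

/-- The spaces `E(λ,s)` are independent. -/
theorem iSupIndep_ELabelled {ζ : ∀ k : ℕ, AddChar (ZMod k) ℂ}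
    (hζ : ∀ k : ℕ, 0 < k → Function.Injective (ζ k)) :
    iSupIndep fun L : LabelledPartition n => (ELabelled L).toSubmodule :=
  iSupIndep_of_sum_finrank_eq (iSup_ELabelled n)
    (sum_finrank_ELabelled hζ fun L => (nonempty_points_equiv L).some).1

end

/-! ### The induced representations -/

/-- Two representations with the same image in a common space are isomorphic. -/
theorem nonempty_equiv_of_range_eq {K G X Y U : Type*} [CommRing K] [Group G] [AddCommGroup X]
    [Module K X] [AddCommGroup Y] [Module K Y] [AddCommGroup U] [Module K U]
    {ρ : Representation K G X} {τ : Representation K G Y} (α : G → U →ₗ[K] U) {i : X →ₗ[K] U}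
    {j : Y →ₗ[K] U} (hi : Function.Injective i) (hj : Function.Injective j)
    (hi' : ∀ g x, i (ρ g x) = α g (i x)) (hj' : ∀ g y, j (τ g y) = α g (j y))
    (h : LinearMap.range i = LinearMap.range j) : Nonempty (ρ.Equiv τ) := by
  let E : X ≃ₗ[K] Y := (LinearEquiv.ofInjective i hi).trans
    ((LinearEquiv.ofEq _ _ h).trans (LinearEquiv.ofInjective j hj).symm)
  have hE : ∀ x, j (E x) = i x := by
    intro x
    have h1 : LinearEquiv.ofInjective j hj (E x)
        = LinearEquiv.ofEq _ _ h (LinearEquiv.ofInjective i hi x) := by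
      simp [E]
    have h2 := congrArg Subtype.val h1
    simpa using h2
  refine ⟨Representation.Equiv.mk E fun g => LinearMap.ext fun x => hj ?_⟩
  rw [LinearMap.comp_apply, LinearMap.comp_apply, LinearEquiv.coe_coe, hE, hj', hE, hi']

theorem injective_coeLinearMap_of_iSupIndep {K I U : Type*} [Field K] [AddCommGroup U] [Module K U]
    [DecidableEq I] {A : I → Submodule K U} (h : iSupIndep A) :
    Function.Injective (DirectSum.coeLinearMap A) := h.dfinsupp_lsum_injective

theorem finrank_iSup_of_iSupIndep {K I U : Type*} [Field K] [AddCommGroup U] [Module K U]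
    [Module.Finite K U] [Fintype I] {A : I → Submodule K U} (h : iSupIndep A) :
    Module.finrank K (⨆ i, A i : Submodule K U) = ∑ i, Module.finrank K (A i) := by
  classical
  rw [← DirectSum.range_coeLinearMap,
    LinearMap.finrank_range_of_inj (injective_coeLinearMap_of_iSupIndep h),
    Module.finrank_directSum]

section

variable {n : ℕ} (ζ : ∀ k : ℕ, AddChar (ZMod k) ℂ) (L : LabelledPartition n) (e : Points L ≃ Fin n)

theorem sign_ZHom (g : Z L) : Equiv.Perm.sign (ZHom L e g) = Equiv.Perm.sign g.1 :=
  Equiv.Perm.sign_permCongr e g.1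

/-- The image of `[σ] ⊗ 1` under the map from the induced representation. -/
def indVec (σ : Equiv.Perm (Fin n)) : ℂ ⊗[ℚ] E2Alg n :=
  ((Equiv.Perm.sign σ : ℤ) : ℂ) • eigenVec ζ L (e.trans σ⁻¹)

theorem indVec_ZHom_mul (g : Z L) (σ : Equiv.Perm (Fin n)) :
    xi ζ L g • indVec ζ L e (ZHom L e g * σ) = indVec ζ L e σ := by
  have h1 : e.trans (ZHom L e g * σ)⁻¹ = (g⁻¹).1.trans (e.trans σ⁻¹) := by
    rw [mul_inv_rev, ← map_inv, Equiv.Perm.mul_def, ← Equiv.trans_assoc, trans_ZHom,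
      Equiv.trans_assoc]
  have h2 : xi ζ L g * xi ζ L g⁻¹ = 1 := by rw [← map_mul, mul_inv_cancel, map_one]
  have h3 : ((Equiv.Perm.sign g.1 : ℤ) : ℂ) * ((Equiv.Perm.sign (g⁻¹).1 : ℤ) : ℂ) = 1 := by
    rw [Subgroup.coe_inv, Equiv.Perm.sign_inv, intCast_sign_mul_self]
  rw [indVec, h1, eigenVec_trans, Equiv.Perm.sign_mul, sign_ZHom, smul_smul, smul_smul, indVec]
  congr 1
  push_cast
  calc _ = (xi ζ L g * xi ζ L g⁻¹) * (((Equiv.Perm.sign g.1 : ℤ) : ℂ) *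
        ((Equiv.Perm.sign (g⁻¹).1 : ℤ) : ℂ)) * ((Equiv.Perm.sign σ : ℤ) : ℂ) := by
        rw [Subgroup.coe_inv]; ring
    _ = _ := by rw [h2, h3, one_mul, one_mul]

/-- The map from the induced representation (up to the sign) to the algebra. -/
def indToAlg : Representation.IndV (ZHom L e) (charRep (xi ζ L)) →ₗ[ℂ] ℂ ⊗[ℚ] E2Alg n :=
  Representation.Coinvariants.lift _
    (TensorProduct.lift ((LinearMap.lsmul ℂ _).flip ∘ₗ
      (Finsupp.linearCombination ℂ (indVec ζ L e)) ∘ₗ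
        (MonoidAlgebra.coeffLinearEquiv ℂ).toLinearMap)) fun g => by
    refine TensorProduct.ext <| MonoidAlgebra.lhom_ext' fun σ => LinearMap.ext_ring <|
      LinearMap.ext fun a => ?_
    have h := indVec_ZHom_mul ζ L e g σ
    simp [charRep, smul_smul, ← h]

/-- The element `[σ] ⊗ 1` of the induced representation. -/
def indMk (σ : Equiv.Perm (Fin n)) : Representation.IndV (ZHom L e) (charRep (xi ζ L)) :=
  Representation.IndV.mk _ _ σ 1

theorem indMk_hom_ext {W : Type*} [AddCommGroup W] [Module ℂ W]
    {f g : Representation.IndV (ZHom L e) (charRep (xi ζ L)) →ₗ[ℂ] W}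
    (h : ∀ σ, f (indMk ζ L e σ) = g (indMk ζ L e σ)) : f = g :=
  Representation.IndV.hom_ext _ _ fun σ => LinearMap.ext_ring (h σ)

theorem span_indMk : Submodule.span ℂ (Set.range (indMk ζ L e)) = ⊤ := by
  rw [← Submodule.ker_mkQ (Submodule.span ℂ (Set.range (indMk ζ L e))), LinearMap.ker_eq_top]
  refine indMk_hom_ext ζ L e fun σ => ?_
  rw [LinearMap.zero_apply, Submodule.mkQ_apply, Submodule.Quotient.mk_eq_zero]
  exact Submodule.subset_span ⟨σ, rfl⟩

theorem indToAlg_mk (σ : Equiv.Perm (Fin n)) :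
    indToAlg ζ L e (indMk ζ L e σ) = indVec ζ L e σ := by
  simp [indToAlg, indMk]

theorem indXi_indMk (σ h : Equiv.Perm (Fin n)) :
    indXi ζ L e σ (indMk ζ L e h) = indMk ζ L e (h * σ⁻¹) :=
  Representation.ind_mk _ _ _ _ _

theorem indMk_ZHom_mul (g : Z L) (h : Equiv.Perm (Fin n)) :
    indMk ζ L e h = xi ζ L g • indMk ζ L e (ZHom L e g * h) := by
  have h3 := Representation.Coinvariants.mk_self_apply
    (Representation.tprod ((Representation.leftRegular ℂ (Equiv.Perm (Fin n))).comp (ZHom L e))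
      (charRep (xi ζ L))) g (MonoidAlgebra.single h 1 ⊗ₜ[ℂ] 1)
  have h4 : xi ζ L g • indMk ζ L e (ZHom L e g * h)
      = Representation.IndV.mk _ _ (ZHom L e g * h) (xi ζ L g) := by
    rw [indMk, ← map_smul, smul_eq_mul, mul_one]
  rw [h4]
  refine h3.symm.trans ?_
  rw [Representation.tprod_apply, TensorProduct.map_tmul]
  have h5 : charRep (xi ζ L) g 1 = xi ζ L g := mul_one _
  have h6 : ((Representation.leftRegular ℂ (Equiv.Perm (Fin n))).comp (ZHom L e)) g
      (MonoidAlgebra.single h 1) = MonoidAlgebra.single (ZHom L e g * h) 1 := by simp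
  rw [h5, h6]
  rfl

theorem indToAlg_ind (σ : Equiv.Perm (Fin n))
    (x : Representation.IndV (ZHom L e) (charRep (xi ζ L))) :
    ((Equiv.Perm.sign σ : ℤ) : ℂ) • indToAlg ζ L e (indXi ζ L e σ x)
      = actC σ (indToAlg ζ L e x) := by
  have h : ((Equiv.Perm.sign σ : ℤ) : ℂ) • (indToAlg ζ L e ∘ₗ indXi ζ L e σ)
      = (actC σ).toLinearMap ∘ₗ indToAlg ζ L e := by
    refine indMk_hom_ext ζ L e fun h => ?_
    have h2 := intCast_sign_mul_self σ
    rw [LinearMap.smul_apply, LinearMap.comp_apply, LinearMap.comp_apply,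
      AlgHom.toLinearMap_apply, indXi_indMk, indToAlg_mk, indToAlg_mk, indVec, indVec, map_smul,
      actC_eigenVec, smul_smul, mul_inv_rev, inv_inv, Equiv.Perm.mul_def σ,
      ← Equiv.trans_assoc]
    congr 1
    rw [Equiv.Perm.sign_mul, Equiv.Perm.sign_inv]
    push_cast
    linear_combination ((Equiv.Perm.sign h : ℤ) : ℂ) * h2
  exact LinearMap.congr_fun h x

theorem range_indToAlg (hζ : ∀ k : ℕ, 0 < k → Function.Injective (ζ k)) :
    LinearMap.range (indToAlg ζ L e) = (ELabelled L).toSubmodule.baseChange ℂ := by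
  rw [baseChange_ELabelled, ← span_eigenVec hζ, ← Submodule.map_top, ← span_indMk ζ L e,
    Submodule.map_span, ← Set.range_comp]
  apply le_antisymm
  · rw [Submodule.span_le]
    rintro _ ⟨σ, rfl⟩
    rw [Function.comp_apply, indToAlg_mk]
    exact Submodule.smul_mem _ _ (Submodule.subset_span ⟨_, rfl⟩)
  · rw [Submodule.span_le]
    rintro _ ⟨e', rfl⟩
    set σ : Equiv.Perm (Fin n) := e.symm.trans e' with hσ
    have he' : e' = e.trans σ := by
      apply Equiv.ext
      intro x
      simp [hσ]
    have h1 : eigenVec ζ L e'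
        = ((Equiv.Perm.sign σ : ℤ) : ℂ) • indToAlg ζ L e (indMk ζ L e σ⁻¹) := by
      rw [indToAlg_mk, indVec, smul_smul, Equiv.Perm.sign_inv, intCast_sign_mul_self, one_smul,
        inv_inv, ← he']
    rw [h1]
    exact Submodule.smul_mem _ _ (Submodule.subset_span ⟨_, rfl⟩)

theorem span_indV : Submodule.span ℂ (Set.range fun q : Equiv.Perm (Fin n) ⧸ (ZHom L e).range =>
    indMk ζ L e q.out⁻¹) = ⊤ := by
  rw [← top_le_iff, ← span_indMk, Submodule.span_le]
  rintro _ ⟨h, rfl⟩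
  obtain ⟨⟨z, g, hg⟩, hz⟩ := QuotientGroup.mk_out_eq_mul (ZHom L e).range h⁻¹
  dsimp only at hz
  set τ : Equiv.Perm (Fin n) := ((h⁻¹ : Equiv.Perm (Fin n)) :
    Equiv.Perm (Fin n) ⧸ (ZHom L e).range).out with hτ
  have h1 : ZHom L e g⁻¹ * h = τ⁻¹ := by rw [hz, mul_inv_rev, inv_inv, ← hg, map_inv]
  rw [indMk_ZHom_mul ζ L e g⁻¹, h1]
  exact Submodule.smul_mem _ _ (Submodule.subset_span ⟨_, rfl⟩)

instance finite_indV : Module.Finite ℂ (Representation.IndV (ZHom L e) (charRep (xi ζ L))) :=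
  Module.Finite.of_fg_top (span_indV ζ L e ▸ Submodule.fg_span (Set.finite_range _))

theorem finrank_indV_le : Module.finrank ℂ (Representation.IndV (ZHom L e) (charRep (xi ζ L)))
    ≤ (ZHom L e).range.index := by
  classical
  have := Fintype.ofFinite (Equiv.Perm (Fin n) ⧸ (ZHom L e).range)
  rw [← finrank_top, ← span_indV]
  refine (finrank_range_le_card _).trans ?_
  rw [Subgroup.index, Nat.card_eq_fintype_card]

end

section

variable {n : ℕ} {ζ : ∀ k : ℕ, AddChar (ZMod k) ℂ}

theorem complexify_apply (S : Subrepresentation (symRep n)) (σ : Equiv.Perm (Fin n))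
    (x : ℂ ⊗[ℚ] S.toSubmodule) : S.toSubmodule.subtype.baseChange ℂ
      (complexify S.toRepresentation σ x) = actC σ (S.toSubmodule.subtype.baseChange ℂ x) := by
  induction x using TensorProduct.induction_on with
  | zero => simp
  | add x y hx hy => rw [map_add, map_add, hx, hy, map_add, map_add]
  | tmul c x => rfl

instance (T : WeightedPartition n) (a : ℤ) : Fintype (Labellings T a) := Fintype.ofFinite _

theorem EWeighted_eq_iSup (T : WeightedPartition n) (a : ℤ) :
    (EWeighted T a).toSubmodule = ⨆ L : Labellings T a, (ELabelled L.1).toSubmodule :=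
  iSup_subtype'

theorem finrank_EWeighted_eq_sum (hζ : ∀ k : ℕ, 0 < k → Function.Injective (ζ k))
    (T : WeightedPartition n) (a : ℤ) : Module.finrank ℚ (EWeighted T a).toSubmodule
      = ∑ L : Labellings T a, Module.finrank ℚ (ELabelled L.1).toSubmodule := by
  have hind : iSupIndep fun L : Labellings T a => (ELabelled L.1).toSubmodule :=
    (iSupIndep_ELabelled hζ).comp Subtype.val_injective
  rw [EWeighted_eq_iSup, finrank_iSup_of_iSupIndep hind]

theorem finrank_EWeighted (hζ : ∀ k : ℕ, 0 < k → Function.Injective (ζ k))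
    (e : ∀ L : LabelledPartition n, Points L ≃ Fin n)
    (T : WeightedPartition n) (a : ℤ) : Module.finrank ℚ (EWeighted T a).toSubmodule
      = ∑ L : Labellings T a, (ZHom L.1 (e L.1)).range.index := by
  rw [finrank_EWeighted_eq_sum hζ]
  exact Finset.sum_congr rfl fun L _ => (sum_finrank_ELabelled hζ e).2 L.1

theorem baseChange_iSup {I : Type*} (A : I → Submodule ℚ (E2Alg n)) :
    (⨆ i, A i).baseChange ℂ = ⨆ i, (A i).baseChange ℂ := by
  apply le_antisymm
  · rw [Submodule.baseChange_eq_span, Submodule.span_le]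
    rintro _ ⟨x, hx, rfl⟩
    have h : ⨆ i, A i ≤ ((⨆ i, (A i).baseChange ℂ).restrictScalars ℚ).comap
        (TensorProduct.mk ℚ ℂ (E2Alg n) 1) := by
      refine iSup_le fun i x hx => ?_
      exact Submodule.mem_iSup_of_mem (p := fun i => (A i).baseChange ℂ) i
        (Submodule.tmul_mem_baseChange_of_mem 1 hx)
    exact h hx
  · exact iSup_le fun i => Submodule.baseChange_mono _ (le_iSup A i)

theorem range_toModule {K I W : Type*} [DecidableEq I] [CommRing K] {X : I → Type*}
    [∀ i, AddCommGroup (X i)] [∀ i, Module K (X i)] [AddCommGroup W] [Module K W]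
    (f : ∀ i, X i →ₗ[K] W) :
    LinearMap.range (DirectSum.toModule K I W f) = ⨆ i, LinearMap.range (f i) := by
  apply le_antisymm
  · rintro _ ⟨x, rfl⟩
    induction x using DirectSum.induction_on with
    | zero => simp
    | of i x =>
      change DirectSum.toModule K I W f (DirectSum.lof K I X i x) ∈ _
      rw [DirectSum.toModule_lof]
      exact Submodule.mem_iSup_of_mem i ⟨x, rfl⟩
    | add x y hx hy => rw [map_add]; exact Submodule.add_mem _ hx hy
  · refine iSup_le fun i => ?_
    rintro _ ⟨x, rfl⟩
    exact ⟨DirectSum.lof K I X i x, DirectSum.toModule_lof _ _ _⟩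

/-- The decomposition of `ℂ ⊗ E(λ,t,a)` into induced representations. The sum of the maps
`indToAlg` is onto, and injective because the dimensions agree. -/
theorem nonempty_complexify_equiv (hζ : ∀ k : ℕ, 0 < k → Function.Injective (ζ k))
    (e : ∀ L : LabelledPartition n, Points L ≃ Fin n) (T : WeightedPartition n) (a : ℤ) :
    Nonempty ((complexify (EWeighted T a).toRepresentation).Equiv ((sgnRep n).tprod
      (Representation.directSum fun L : Labellings T a => indXi ζ L.1 (e L.1)))) := by
  classical
  let Φ' : (⨁ L : Labellings T a, Representation.IndV (ZHom L.1 (e L.1)) (charRep (xi ζ L.1)))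
      →ₗ[ℂ] ℂ ⊗[ℚ] E2Alg n :=
    DirectSum.toModule ℂ _ _ fun L : Labellings T a => indToAlg ζ L.1 (e L.1)
  let Φ := Φ' ∘ₗ (TensorProduct.lid ℂ (⨁ L : Labellings T a,
    Representation.IndV (ZHom L.1 (e L.1)) (charRep (xi ζ L.1)))).toLinearMap
  have hrange : LinearMap.range Φ = (EWeighted T a).toSubmodule.baseChange ℂ := by
    rw [LinearMap.range_comp_of_range_eq_top _ (LinearEquiv.range _), EWeighted_eq_iSup,
      baseChange_iSup, range_toModule]
    exact iSup_congr fun L => range_indToAlg ζ L.1 (e L.1) hζ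
  have hinj : Function.Injective Φ := by
    have hrank := LinearMap.finrank_range_add_finrank_ker Φ
    rw [hrange, finrank_baseChange_submodule, finrank_EWeighted hζ e,
      (TensorProduct.lid ℂ (⨁ L : Labellings T a,
        Representation.IndV (ZHom L.1 (e L.1)) (charRep (xi ζ L.1)))).finrank_eq,
      Module.finrank_directSum] at hrank
    have hle := Finset.sum_le_sum fun (L : Labellings T a) (_ : L ∈ Finset.univ) =>
      finrank_indV_le ζ L.1 (e L.1)
    exact LinearMap.ker_eq_bot.1 (Submodule.finrank_eq_zero.1 (by omega))
  refine nonempty_equiv_of_range_eq (fun σ => (actC σ).toLinearMap)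
    (injective_baseChange_subtype _) hinj (fun σ x => complexify_apply _ σ x) (fun σ x => ?_) ?_
  · have h : Φ ∘ₗ ((sgnRep n).tprod (Representation.directSum fun L : Labellings T a =>
        indXi ζ L.1 (e L.1)) σ) = (actC σ).toLinearMap ∘ₗ Φ := by
      refine TensorProduct.ext (LinearMap.ext_ring (DirectSum.linearMap_ext ℂ fun L =>
        LinearMap.ext fun x => ?_))
      have h1 : Φ' (((Equiv.Perm.sign σ : ℤ) : ℂ) • DirectSum.lof ℂ _ _ L
          (indXi ζ L.1 (e L.1) σ x)) = actC σ (Φ' (DirectSum.lof ℂ _ _ L x)) := by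
        rw [map_smul, DirectSum.toModule_lof, DirectSum.toModule_lof, indToAlg_ind]
      have h2 : Representation.directSum (fun L : Labellings T a => indXi ζ L.1 (e L.1)) σ
          (DirectSum.lof ℂ _ _ L x) = DirectSum.lof ℂ _ _ L (indXi ζ L.1 (e L.1) σ x) :=
        DirectSum.lmap_lof _ _ _
      have h3 : Φ (((sgnRep n).tprod (Representation.directSum fun L : Labellings T a =>
          indXi ζ L.1 (e L.1)) σ) (1 ⊗ₜ DirectSum.lof ℂ _ _ L x))
          = actC σ (Φ (1 ⊗ₜ DirectSum.lof ℂ _ _ L x)) := by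
        rw [Representation.tprod_apply, TensorProduct.map_tmul, h2]
        simp only [Φ, LinearMap.comp_apply, LinearEquiv.coe_coe, TensorProduct.lid_tmul, one_smul]
        rw [← h1]
        congr 2
        exact mul_one _
      exact h3
    exact LinearMap.congr_fun h x
  · rw [range_baseChange_subtype, hrange]

end

/-! ### The action of the Lie algebra `sl_2` by derivations -/

section

variable {n : ℕ}

/-- The action of a `2 × 2` matrix on the generators. -/
def genDer (N : Matrix (Fin 2) (Fin 2) ℚ) : Gen n → E2Alg n
  | .cls c i => ∑ d : Fin 2, N d c • cl (.cls d i)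
  | .edge _ _ => 0

theorem genDer_mem_genSpan (N : Matrix (Fin 2) (Fin 2) ℚ) (g : Gen n) :
    genDer N g ∈ genSpan n := by
  cases g with
  | cls c i => exact Submodule.sum_mem _ fun d _ => Submodule.smul_mem _ _ (cl_mem_genSpan _)
  | edge i j => exact Submodule.zero_mem _

/-- The Leibniz rule is encoded by homomorphisms to the dual numbers over the algebra. -/
theorem isE2Family_genDer (N : Matrix (Fin 2) (Fin 2) ℚ) : IsE2Family fun g : Gen n =>
    (TrivSqZeroExt.inl (cl g) + TrivSqZeroExt.inr (genDer N g) : DualNumber (E2Alg n)) := by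
  refine ⟨fun a b => ?_, fun i => ?_, fun i j => ?_, fun d i j => ?_, fun i j k => ?_⟩
  · ext
    · simpa using cl_anticomm a b
    · have h1 := anticomm_span (cl_mem_genSpan a) (genDer_mem_genSpan N b)
      have h2 := anticomm_span (genDer_mem_genSpan N a) (cl_mem_genSpan b)
      simp [h1, h2]
  · ext <;> simp [genDer, cl_edge_self]
  · ext <;> simp [genDer, cl_edge_symm i j]
  · ext
    · simpa using cl_cls_edge d i j
    · simp [genDer, add_mul, cl_cls_edge _ i j]
  · ext
    · simpa using cl_arnold i j k
    · simp [genDer]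

/-- The derivation by which a `2 × 2` matrix acts on `E2Alg n`: it acts on each span of `x_i, y_i`
and kills the `ω_{i,j}`. -/
def der (n : ℕ) (N : Matrix (Fin 2) (Fin 2) ℚ) : Module.End ℚ (E2Alg n) :=
  ((TrivSqZeroExt.sndHom (E2Alg n) (E2Alg n)).restrictScalars ℚ).comp
    (isE2Family_genDer (n := n) N).lift.toLinearMap

theorem der_cl (N : Matrix (Fin 2) (Fin 2) ℚ) (g : Gen n) : der n N (cl g) = genDer N g := by
  simp [der]

theorem fst_lift_genDer (N : Matrix (Fin 2) (Fin 2) ℚ) (a : E2Alg n) :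
    TrivSqZeroExt.fst ((isE2Family_genDer N).lift a) = a := by
  induction a using E2Alg.induction with
  | algebraMap r => rw [AlgHom.commutes]; rfl
  | cl g => simp
  | mul a b ha hb => rw [map_mul, TrivSqZeroExt.fst_mul, ha, hb]
  | add a b ha hb => rw [map_add, TrivSqZeroExt.fst_add, ha, hb]

theorem der_mul (N : Matrix (Fin 2) (Fin 2) ℚ) (a b : E2Alg n) :
    der n N (a * b) = a * der n N b + der n N a * b := by
  simp only [der, LinearMap.comp_apply, LinearMap.restrictScalars_apply,
    TrivSqZeroExt.sndHom_apply, AlgHom.toLinearMap_apply, map_mul, TrivSqZeroExt.snd_mul,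
    fst_lift_genDer, smul_eq_mul, MulOpposite.smul_eq_mul_unop, MulOpposite.unop_op]

theorem der_one (N : Matrix (Fin 2) (Fin 2) ℚ) : der n N 1 = 0 := by
  have h := der_mul N (1 : E2Alg n) 1
  simpa using h

theorem der_algebraMap (N : Matrix (Fin 2) (Fin 2) ℚ) (r : ℚ) :
    der n N (algebraMap ℚ (E2Alg n) r) = 0 := by
  rw [Algebra.algebraMap_eq_smul_one, map_smul, der_one, smul_zero]

theorem der_edge (N : Matrix (Fin 2) (Fin 2) ℚ) (i j : Fin n) : der n N (cl (.edge i j)) = 0 :=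
  der_cl N _

theorem der_path (N : Matrix (Fin 2) (Fin 2) ℚ) (a : Fin n) (w : List (Fin n)) :
    der n N (path (omega n) a w) = 0 := by
  induction w generalizing a with
  | nil => exact der_one N
  | cons b w ih => rw [path_cons, der_mul, ih, omega, der_edge, mul_zero, zero_mul, add_zero]

theorem der_lie (N P : Matrix (Fin 2) (Fin 2) ℚ) (a : E2Alg n) :
    der n N (der n P a) - der n P (der n N a) = der n (N * P - P * N) a := by
  induction a using E2Alg.induction with
  | algebraMap r => simp [der_algebraMap]
  | cl g =>
    cases g with
    | cls c i =>
      simp only [der_cl, genDer, map_smul, Fin.sum_univ_two, Matrix.sub_apply,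
        Matrix.mul_apply, map_add]
      module
    | edge i j => simp [der_edge]
  | mul a b ha hb =>
    simp only [der_mul, map_add] at ha hb ⊢
    rw [← ha, ← hb]
    noncomm_ring
  | add a b ha hb => rw [map_add, map_add, map_add, map_add, map_add, ← ha, ← hb]; abel

theorem symRep_der (N : Matrix (Fin 2) (Fin 2) ℚ) (σ : Equiv.Perm (Fin n)) (a : E2Alg n) :
    symRep n σ (der n N a) = der n N (symRep n σ a) := by
  change actHom (σ, (1 : SL(2, ℚ))) _ = der n N (actHom (σ, (1 : SL(2, ℚ))) a)
  induction a using E2Alg.induction with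
  | algebraMap r => simp [der_algebraMap]
  | cl g =>
    cases g with
    | cls c i => simp [der_cl, genDer, genAct, actHom_cl, Matrix.one_apply]
    | edge i j => simp [der_cl, genDer, genAct, actHom_cl]
  | mul a b ha hb => simp only [der_mul, map_mul, map_add, ha, hb]
  | add a b ha hb => simp only [map_add, ha, hb]

/-- The weight of a label for the diagonal torus of `SL_2`. -/
def Label.wt : Label → ℤ
  | one => 0
  | x => 1
  | y => -1
  | xy => 0

/-- The weight of a system of labelled words for the diagonal torus of `SL_2`. -/
def labelWt (bs : List (LWord n)) : ℤ := (bs.map fun b => b.1.wt).sum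

theorem torusWeight_eq_sum (L : LabelledPartition n) :
    torusWeight L = (L.blocks.map fun b => b.2.wt).sum := by
  rw [torusWeight]
  induction L.blocks using Multiset.induction_on with
  | empty => simp
  | cons b s ih =>
    obtain ⟨k, l⟩ := b
    simp only [Multiset.map_cons, Multiset.sum_cons, ← ih, Multiset.count_cons]
    cases l <;> simp [Label.wt] <;> ring

theorem torusWeight_eq (L : LabelledPartition n) {bs : List (LWord n)}
    (h : (bs.map LWord.type : List _) = L.blocks) : torusWeight L = labelWt bs := by
  rw [torusWeight_eq_sum, ← h, Multiset.map_coe, Multiset.sum_coe, List.map_map]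
  rfl

theorem abs_torusWeight_le (L : LabelledPartition n) :
    |torusWeight L| ≤ totalWeight (toWeighted L) := by
  rw [torusWeight_eq_sum, totalWeight, toWeighted, Multiset.map_map]
  induction L.blocks using Multiset.induction_on with
  | empty => simp
  | cons b s ih =>
    have h1 : |b.2.wt| ≤ ((b.2.deg : ℕ) : ℤ) := by cases b.2 <;> decide
    simp only [Multiset.map_cons, Multiset.sum_cons, Function.comp_apply] at ih ⊢
    push_cast at ih ⊢
    exact (abs_add_le _ _).trans (add_le_add h1 ih)

theorem totalWeight_add_torusWeight_le (L : LabelledPartition n) :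
    totalWeight (toWeighted L) + |torusWeight L| ≤ 2 * numBlocks (toWeighted L) := by
  rw [torusWeight_eq_sum, totalWeight, numBlocks, toWeighted, Multiset.map_map, Multiset.card_map]
  induction L.blocks using Multiset.induction_on with
  | empty => simp
  | cons b s ih =>
    have h1 : ((b.2.deg : ℕ) : ℤ) + |b.2.wt| ≤ 2 := by cases b.2 <;> decide
    have h2 := abs_add_le b.2.wt (s.map fun b => b.2.wt).sum
    simp only [Multiset.map_cons, Multiset.sum_cons, Function.comp_apply, Multiset.card_cons]
      at ih ⊢
    push_cast at ih ⊢
    linarith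

/-- Two systems with the same words and labels of the same degrees. -/
def SameDeg (bs cs : List (LWord n)) : Prop :=
  bs.map (fun b => (b.2, b.1.deg)) = cs.map fun b => (b.2, b.1.deg)

theorem SameDeg.isLWordSystem {bs cs : List (LWord n)} (h : SameDeg bs cs)
    (hcs : IsLWordSystem cs) : IsLWordSystem bs := by
  have h1 := congrArg (List.map Prod.fst) h
  rw [List.map_map, List.map_map] at h1
  have h2 : bs.map Prod.snd = cs.map Prod.snd := h1
  rwa [IsLWordSystem, h2]

theorem SameDeg.map_type {bs cs : List (LWord n)} (h : SameDeg bs cs) :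
    bs.map (fun b => (b.type.1, b.1.deg)) = cs.map fun b => (b.type.1, b.1.deg) := by
  have h1 := congrArg (List.map fun p : Word n × Fin 3 => (p.1.2.length + 1, p.2)) h
  rwa [List.map_map, List.map_map] at h1

theorem SameDeg.toWeighted_eq {bs cs : List (LWord n)} (h : SameDeg bs cs)
    {K L : LabelledPartition n} (hK : (bs.map LWord.type : List _) = K.blocks)
    (hL : (cs.map LWord.type : List _) = L.blocks) : toWeighted K = toWeighted L := by
  ext1
  change K.blocks.map _ = L.blocks.map _
  rw [← hK, ← hL, Multiset.map_coe, Multiset.map_coe, List.map_map, List.map_map]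
  exact congrArg _ h.map_type

theorem EWeighted_eq_span (T : WeightedPartition n) (a : ℤ) :
    (EWeighted T a).toSubmodule = Submodule.span ℚ {z | ∃ (bs : List (LWord n))
      (h : IsLWordSystem bs), toWeighted (sysShape bs h) = T ∧ labelWt bs = a ∧
        z = sysVal bs} := by
  apply le_antisymm
  · refine iSup₂_le fun L hL => ?_
    rw [ELabelled_eq_span]
    refine Submodule.span_mono ?_
    rintro _ ⟨bs, hbs, hL', rfl⟩
    have h1 : sysShape bs hbs = L := DecoratedPartition.ext hL'
    exact ⟨bs, hbs, h1 ▸ hL.1, (torusWeight_eq L hL').symm.trans hL.2, rfl⟩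
  · rw [Submodule.span_le]
    rintro _ ⟨bs, hbs, hT, ha, rfl⟩
    refine Submodule.mem_iSup_of_mem (sysShape bs hbs) (Submodule.mem_iSup_of_mem
      ⟨hT, (torusWeight_eq _ rfl).trans ha⟩ ?_)
    rw [ELabelled_eq_span]
    exact Submodule.subset_span ⟨bs, hbs, rfl, rfl⟩

/-- A derivation that changes the weights of the labels by `k` does so for all monomials. -/
theorem der_sysVal_mem {N : Matrix (Fin 2) (Fin 2) ℚ} {k : ℤ}
    (hN : ∀ (l : Label) (i : Fin n), der n N (labelClass l i) = 0 ∨ ∃ l' : Label,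
      l'.deg = l.deg ∧ l'.wt = l.wt + k ∧ der n N (labelClass l i) = labelClass l' i)
    (bs : List (LWord n)) : der n N (sysVal bs) ∈ Submodule.span ℚ
      {z | ∃ cs, SameDeg cs bs ∧ labelWt cs = labelWt bs + k ∧ z = sysVal cs} := by
  induction bs with
  | nil =>
    rw [show sysVal ([] : List (LWord n)) = 1 from rfl, der_one]
    exact Submodule.zero_mem _
  | cons b bs ih =>
    rw [show sysVal (b :: bs) = b.val * sysVal bs from rfl, der_mul]
    refine Submodule.add_mem _ ?_ ?_
    · have h1 := Submodule.mem_map_of_mem (f := LinearMap.mulLeft ℚ b.val) ih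
      rw [Submodule.map_span] at h1
      refine Submodule.span_mono ?_ h1
      rintro _ ⟨_, ⟨cs, hcs, hw, rfl⟩, rfl⟩
      refine ⟨b :: cs, ?_, ?_, rfl⟩
      · simpa [SameDeg] using hcs
      · simp only [labelWt, List.map_cons, List.sum_cons] at hw ⊢
        omega
    · rw [LWord.val, der_mul, Word.val, der_path, mul_zero, zero_add]
      rcases hN b.1 b.2.1 with h | ⟨l, hl, hw, h⟩
      · rw [h, zero_mul, zero_mul]
        exact Submodule.zero_mem _
      · rw [h]
        refine Submodule.subset_span ⟨(l, b.2) :: bs, ?_, ?_, rfl⟩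
        · simp [SameDeg, hl]
        · simp only [labelWt, List.map_cons, List.sum_cons, hw]
          omega

theorem der_mem_EWeighted {N : Matrix (Fin 2) (Fin 2) ℚ} {k : ℤ}
    (hN : ∀ (l : Label) (i : Fin n), der n N (labelClass l i) = 0 ∨ ∃ l' : Label,
      l'.deg = l.deg ∧ l'.wt = l.wt + k ∧ der n N (labelClass l i) = labelClass l' i)
    {T : WeightedPartition n} {a : ℤ} {v : E2Alg n} (hv : v ∈ (EWeighted T a).toSubmodule) :
    der n N v ∈ (EWeighted T (a + k)).toSubmodule := by
  rw [EWeighted_eq_span] at hv ⊢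
  have h1 := Submodule.mem_map_of_mem (f := der n N) hv
  refine (Submodule.map_span_le _ _ _).2 ?_ h1
  rintro _ ⟨bs, hbs, hT, ha, rfl⟩
  refine Submodule.span_mono ?_ (der_sysVal_mem hN bs)
  rintro _ ⟨cs, hcs, hw, rfl⟩
  exact ⟨cs, hcs.isLWordSystem hbs, (hcs.toWeighted_eq rfl rfl).trans hT, by rw [hw, ha], rfl⟩

/-- The raising operator, with `e y = x`. -/
def raise (n : ℕ) : Module.End ℚ (E2Alg n) := der n !![0, 1; 0, 0]

/-- The lowering operator, with `f x = y`. -/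
def lower (n : ℕ) : Module.End ℚ (E2Alg n) := der n !![0, 0; 1, 0]

theorem raise_mem {T : WeightedPartition n} {a : ℤ} {v : E2Alg n}
    (hv : v ∈ (EWeighted T a).toSubmodule) : raise n v ∈ (EWeighted T (a + 2)).toSubmodule := by
  refine der_mem_EWeighted (fun l i => ?_) hv
  cases l
  · exact Or.inl (der_one _)
  · left; simp [labelClass, der_cl, genDer]
  · exact Or.inr ⟨.x, rfl, rfl, by simp [labelClass, der_cl, genDer]⟩
  · left; simp [labelClass, der_cl, genDer, der_mul, cl_mul_self]

theorem lower_mem {T : WeightedPartition n} {a : ℤ} {v : E2Alg n}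
    (hv : v ∈ (EWeighted T a).toSubmodule) : lower n v ∈ (EWeighted T (a - 2)).toSubmodule := by
  refine der_mem_EWeighted (k := -2) (fun l i => ?_) hv
  cases l
  · exact Or.inl (der_one _)
  · exact Or.inr ⟨.y, rfl, rfl, by simp [labelClass, der_cl, genDer]⟩
  · left; simp [labelClass, der_cl, genDer]
  · left; simp [labelClass, der_cl, genDer, der_mul, cl_mul_self]

/-- The Cartan element acts on the monomials by their weights. -/
theorem der_diag_sysVal (bs : List (LWord n)) :
    der n !![1, 0; 0, -1] (sysVal bs) = (labelWt bs : ℚ) • sysVal bs := by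
  induction bs with
  | nil =>
    rw [show sysVal ([] : List (LWord n)) = 1 from rfl, der_one]
    simp [labelWt]
  | cons b bs ih =>
    have h1 : der n !![1, 0; 0, -1] (labelClass b.1 b.2.1)
        = (b.1.wt : ℚ) • labelClass b.1 b.2.1 := by
      cases b.1 <;> simp [labelClass, der_cl, genDer, der_mul, der_one, Label.wt]
    rw [show sysVal (b :: bs) = b.val * sysVal bs from rfl, der_mul, ih, LWord.val, der_mul,
      Word.val, der_path, h1, mul_zero, zero_add, mul_smul_comm, smul_mul_assoc, smul_mul_assoc,
      ← add_smul]
    congr 1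
    simp [labelWt]
    ring

theorem lie_raise_lower {T : WeightedPartition n} {a : ℤ} {v : E2Alg n}
    (hv : v ∈ (EWeighted T a).toSubmodule) :
    raise n (lower n v) = lower n (raise n v) + (a : ℚ) • v := by
  rw [← sub_eq_iff_eq_add', raise, lower, der_lie]
  rw [EWeighted_eq_span] at hv
  have h2 : (!![0, 1; 0, 0] * !![0, 0; 1, 0] - !![0, 0; 1, 0] * !![0, 1; 0, 0] :
      Matrix (Fin 2) (Fin 2) ℚ) = !![1, 0; 0, -1] := by
    ext i j
    fin_cases i <;> fin_cases j <;> simp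
  rw [h2]
  induction hv using Submodule.span_induction with
  | mem z hz =>
    obtain ⟨bs, _, _, rfl, rfl⟩ := hz
    exact der_diag_sysVal bs
  | zero => simp
  | add x y _ _ hx hy => rw [map_add, hx, hy, smul_add]
  | smul c x _ hx => rw [map_smul, hx, smul_comm]

theorem EWeighted_eq_bot {T : WeightedPartition n} {a : ℤ} (h : (totalWeight T : ℤ) < |a|) :
    (EWeighted T a).toSubmodule = ⊥ := by
  refine (iSup₂_eq_bot (f := fun L (_ : L ∈ Labellings T a) => (ELabelled L).toSubmodule)).2
    fun L hL => ?_
  have h1 := abs_torusWeight_le L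
  rw [hL.1, hL.2] at h1
  exact absurd h1 (not_le.2 h)

/-- Exchanging `x` and `y`. -/
def Label.swap : Label → Label
  | one => one
  | x => y
  | y => x
  | xy => xy

/-- The Weyl element of `SL_2`, which maps `x` to `y` and `y` to `-x`. -/
def weyl : SL(2, ℚ) := ⟨!![0, -1; 1, 0], by simp [Matrix.det_fin_two]⟩

theorem slRep_path (A : SL(2, ℚ)) (a : Fin n) (w : List (Fin n)) :
    slRep n A (path (omega n) a w) = path (omega n) a w := by
  change actHom (1, A) _ = _
  induction w generalizing a with
  | nil => exact map_one _
  | cons b w ih => rw [path_cons, map_mul, ih, omega, actHom_cl]; rfl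

theorem slRep_mul (A : SL(2, ℚ)) (a b : E2Alg n) :
    slRep n A (a * b) = slRep n A a * slRep n A b := map_mul (actHom (1, A)) a b

theorem slRep_cl (A : SL(2, ℚ)) (g : Gen n) : slRep n A (cl g) = genAct (1, A) g := actHom_cl _ _

theorem slRep_one (A : SL(2, ℚ)) : slRep n A 1 = 1 := map_one (actHom (1, A))

theorem slRep_weyl_sysVal (bs : List (LWord n)) :
    slRep n weyl (sysVal bs) = sysVal (bs.map fun b => (b.1.swap, b.2)) ∨
      slRep n weyl (sysVal bs) = -sysVal (bs.map fun b => (b.1.swap, b.2)) := by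
  induction bs with
  | nil => exact Or.inl (slRep_one _)
  | cons b bs ih =>
    have h1 : slRep n weyl (labelClass b.1 b.2.1) = labelClass b.1.swap b.2.1 ∨
        slRep n weyl (labelClass b.1 b.2.1) = -labelClass b.1.swap b.2.1 := by
      cases b.1
      · exact Or.inl (slRep_one _)
      · left; rw [labelClass, slRep_cl]; simp [labelClass, genAct, weyl, Label.swap]
      · right; rw [labelClass, slRep_cl]; simp [labelClass, genAct, weyl, Label.swap]
      · left
        rw [labelClass, slRep_mul, slRep_cl, slRep_cl]
        simp [labelClass, genAct, weyl, Label.swap, cl_anticomm (.cls 1 b.2.1)]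
    have h2 : slRep n weyl (sysVal (b :: bs)) = slRep n weyl (labelClass b.1 b.2.1) * b.2.val
        * slRep n weyl (sysVal bs) := by
      rw [show sysVal (b :: bs) = labelClass b.1 b.2.1 * b.2.val * sysVal bs from rfl, slRep_mul,
        slRep_mul, Word.val, slRep_path]
    have h3 : sysVal ((b :: bs).map fun b => (b.1.swap, b.2)) = labelClass b.1.swap b.2.1 * b.2.val
        * sysVal (bs.map fun b => (b.1.swap, b.2)) := rfl
    rw [h2, h3]
    rcases h1 with h1 | h1 <;> rcases ih with h | h <;> rw [h1, h] <;> simp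

theorem slRep_weyl_mem {T : WeightedPartition n} {a : ℤ} {v : E2Alg n}
    (hv : v ∈ (EWeighted T a).toSubmodule) :
    slRep n weyl v ∈ (EWeighted T (-a)).toSubmodule := by
  rw [EWeighted_eq_span] at hv ⊢
  refine (Submodule.map_span_le _ _ _).2 ?_ (Submodule.mem_map_of_mem hv)
  rintro _ ⟨bs, hbs, hT, ha, rfl⟩
  have hdeg : SameDeg (bs.map fun b => (b.1.swap, b.2)) bs := by
    rw [SameDeg, List.map_map]
    refine List.map_congr_left fun b _ => ?_
    simp only [Function.comp_apply, Prod.mk.injEq, true_and]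
    cases b.1 <;> rfl
  have hwt : labelWt (bs.map fun b => (b.1.swap, b.2)) = -a := by
    rw [← ha]
    clear ha hT hdeg hbs
    induction bs with
    | nil => rfl
    | cons b bs ih =>
      have h1 : b.1.swap.wt = -b.1.wt := by cases b.1 <;> rfl
      simp only [labelWt, List.map_cons, List.sum_cons] at ih ⊢
      rw [ih, h1, neg_add]
  have hmem : sysVal (bs.map fun b => (b.1.swap, b.2)) ∈ Submodule.span ℚ
      {z | ∃ (bs : List (LWord n)) (h : IsLWordSystem bs), toWeighted (sysShape bs h) = T ∧
        labelWt bs = -a ∧ z = sysVal bs} :=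
    Submodule.subset_span
      ⟨_, hdeg.isLWordSystem hbs, (hdeg.toWeighted_eq rfl rfl).trans hT, hwt, rfl⟩
  rcases slRep_weyl_sysVal bs with h | h <;> rw [h]
  · exact hmem
  · exact Submodule.neg_mem _ hmem

/-- The element `diag(2, 1/2)` of the torus. Since `2` is not a root of unity, its eigenvalues `2^a`
distinguish the weights. -/
def torus : SL(2, ℚ) := ⟨!![2, 0; 0, 2⁻¹], by simp [Matrix.det_fin_two]⟩

theorem slRep_torus_sysVal (bs : List (LWord n)) :
    slRep n torus (sysVal bs) = (2 : ℚ) ^ labelWt bs • sysVal bs := by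
  induction bs with
  | nil =>
    rw [show sysVal ([] : List (LWord n)) = 1 from rfl, slRep_one]
    simp [labelWt]
  | cons b bs ih =>
    have h1 : slRep n torus (labelClass b.1 b.2.1)
        = (2 : ℚ) ^ b.1.wt • labelClass b.1 b.2.1 := by
      cases b.1
      · exact (slRep_one _).trans (by simp [labelClass, Label.wt])
      · rw [labelClass, slRep_cl]; simp [genAct, torus, Label.wt]
      · rw [labelClass, slRep_cl]; simp [genAct, torus, Label.wt]
      · rw [labelClass, slRep_mul, slRep_cl, slRep_cl]
        simp [genAct, torus, Label.wt, smul_smul]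
    rw [show sysVal (b :: bs) = labelClass b.1 b.2.1 * b.2.val * sysVal bs from rfl, slRep_mul,
      slRep_mul, Word.val, slRep_path, h1, ih, smul_mul_assoc, smul_mul_assoc, mul_smul_comm,
      smul_smul, ← zpow_add₀ two_ne_zero]
    congr 2

theorem slRep_torus_of_mem {L : LabelledPartition n} {v : E2Alg n}
    (hv : v ∈ (ELabelled L).toSubmodule) :
    slRep n torus v = (2 : ℚ) ^ torusWeight L • v := by
  rw [ELabelled_eq_span] at hv
  induction hv using Submodule.span_induction with
  | mem z hz =>
    obtain ⟨bs, _, h, rfl⟩ := hz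
    rw [slRep_torus_sysVal, torusWeight_eq L h]
  | zero => simp
  | add x y _ _ hx hy => rw [map_add, hx, hy, smul_add]
  | smul c x _ hx => rw [map_smul, hx, smul_comm]

end

/-! ### Weight modules of `sl_2` -/

/-- Two operators `e` and `f` form an `sl_2`-triple on a family of weight spaces, of which only
finitely many are nonzero. -/
structure IsWeightFamily {U : Type*} [AddCommGroup U] [Module ℚ U] (e f : Module.End ℚ U)
    (W : ℤ → Submodule ℚ U) : Prop where
  raise_mem : ∀ {a v}, v ∈ W a → e v ∈ W (a + 2)
  lower_mem : ∀ {a v}, v ∈ W a → f v ∈ W (a - 2)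
  lie : ∀ {a v}, v ∈ W a → e (f v) = f (e v) + (a : ℚ) • v
  eq_bot : ∃ N : ℕ, ∀ a : ℤ, N < |a| → W a = ⊥

namespace IsWeightFamily

variable {U : Type*} [AddCommGroup U] [Module ℚ U] {e f : Module.End ℚ U} {W : ℤ → Submodule ℚ U}

theorem raise_pow_mem (h : IsWeightFamily e f W) {a : ℤ} {v : U} (hv : v ∈ W a) (k : ℕ) :
    (e ^ k) v ∈ W (a + 2 * k) := by
  induction k with
  | zero => simpa using hv
  | succ k ih =>
    rw [pow_succ', Module.End.mul_apply]
    have h1 := h.raise_mem ih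
    rwa [show a + 2 * k + 2 = a + 2 * ((k + 1 : ℕ) : ℤ) by push_cast; ring] at h1

theorem lower_pow_mem (h : IsWeightFamily e f W) {a : ℤ} {v : U} (hv : v ∈ W a) (k : ℕ) :
    (f ^ k) v ∈ W (a - 2 * k) := by
  induction k with
  | zero => simpa using hv
  | succ k ih =>
    rw [pow_succ', Module.End.mul_apply]
    have h1 := h.lower_mem ih
    rwa [show a - 2 * k - 2 = a - 2 * ((k + 1 : ℕ) : ℤ) by push_cast; ring] at h1

theorem exists_raise_pow_eq_zero (h : IsWeightFamily e f W) {a : ℤ} {v : U} (hv : v ∈ W a) :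
    ∃ k : ℕ, (e ^ k) v = 0 := by
  obtain ⟨N, hN⟩ := h.eq_bot
  refine ⟨N + a.natAbs + 1, ?_⟩
  have h1 := h.raise_pow_mem hv (N + a.natAbs + 1)
  rw [hN _ (lt_of_lt_of_le (by omega) (le_abs_self _))] at h1
  simpa using h1

theorem exists_lower_pow_eq_zero (h : IsWeightFamily e f W) {a : ℤ} {v : U} (hv : v ∈ W a) :
    ∃ k : ℕ, (f ^ k) v = 0 := by
  obtain ⟨N, hN⟩ := h.eq_bot
  refine ⟨N + a.natAbs + 1, ?_⟩
  have h1 := h.lower_pow_mem hv (N + a.natAbs + 1)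
  rw [hN _ (lt_of_lt_of_le (by omega) (neg_le_abs _))] at h1
  simpa using h1

/-- The relation `e f^(k+1) m = (k+1) (a-k) f^k m` for a highest weight vector `m` of weight `a`. -/
theorem raise_lower_pow (h : IsWeightFamily e f W) {a : ℤ} {v : U} (hv : v ∈ W a) (h0 : e v = 0)
    (k : ℕ) : e ((f ^ (k + 1)) v) = ((k + 1) * (a - k) : ℚ) • (f ^ k) v := by
  induction k with
  | zero => simp [h.lie hv, h0]
  | succ k ih =>
    rw [pow_succ', Module.End.mul_apply, h.lie (h.lower_pow_mem hv (k + 1)), ih, map_smul,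
      ← Module.End.mul_apply, ← pow_succ', ← add_smul]
    congr 1
    push_cast
    ring

theorem lower_raise_pow (h : IsWeightFamily e f W) {a : ℤ} {v : U} (hv : v ∈ W a)
    (h0 : e (f v) = 0) (k : ℕ) :
    f ((e ^ (k + 1)) v) = (-((k + 1) * (a + k)) : ℚ) • (e ^ k) v := by
  induction k with
  | zero =>
    have h1 := h.lie hv
    rw [h0] at h1
    simpa using eq_neg_of_add_eq_zero_left h1.symm
  | succ k ih =>
    have h1 := h.lie (h.raise_pow_mem hv (k + 1))
    rw [ih, map_smul, ← Module.End.mul_apply, ← pow_succ', ← Module.End.mul_apply e,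
      ← pow_succ', ← sub_eq_iff_eq_add, ← sub_smul] at h1
    rw [← h1]
    congr 1
    push_cast
    ring

/-- A highest weight is not negative. -/
theorem eq_zero_of_raise_eq_zero (h : IsWeightFamily e f W) {a : ℤ} (ha : a < 0) {v : U}
    (hv : v ∈ W a) (h0 : e v = 0) : v = 0 := by
  obtain ⟨k, hk⟩ := h.exists_lower_pow_eq_zero hv
  induction k with
  | zero => simpa using hk
  | succ k ih =>
    have h1 := h.raise_lower_pow hv h0 k
    rw [hk, map_zero, eq_comm, smul_eq_zero] at h1
    refine ih (h1.resolve_left (mul_ne_zero (by positivity) ?_))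
    have h2 : (a : ℚ) < 0 := by exact_mod_cast ha
    have h3 : (0 : ℚ) ≤ k := k.cast_nonneg
    linarith

/-- The operator `e f` is injective on the spaces of positive weight. -/
theorem eq_zero_of_raise_lower_eq_zero (h : IsWeightFamily e f W) {a : ℤ} (ha : 0 < a) {v : U}
    (hv : v ∈ W a) (h0 : e (f v) = 0) : v = 0 := by
  obtain ⟨k, hk⟩ := h.exists_raise_pow_eq_zero hv
  induction k with
  | zero => simpa using hk
  | succ k ih =>
    have h1 := h.lower_raise_pow hv h0 k
    rw [hk, map_zero, eq_comm, smul_eq_zero] at h1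
    have h2 : (0 : ℚ) < a := by exact_mod_cast ha
    exact ih (h1.resolve_left (neg_ne_zero.2 (by positivity)))

theorem lower_pow_eq_zero (h : IsWeightFamily e f W) {a : ℕ} {v : U} (hv : v ∈ W a)
    (h0 : e v = 0) : (f ^ (a + 1)) v = 0 := by
  refine h.eq_zero_of_raise_eq_zero (a := a - 2 * ((a + 1 : ℕ) : ℤ)) (by push_cast; omega)
    (h.lower_pow_mem hv _) ?_
  rw [h.raise_lower_pow hv h0]
  simp

/-- The space of weight `a ≥ 0` is the sum of its highest weight vectors and of the image of the
space of weight `a + 2`. -/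
theorem exists_eq_add (h : IsWeightFamily e f W) [Module.Finite ℚ U] {a : ℤ} (ha : 0 ≤ a) {v : U}
    (hv : v ∈ W a) : ∃ m ∈ W a, e m = 0 ∧ ∃ w ∈ W (a + 2), v = m + f w := by
  have hef : ∀ w ∈ W (a + 2), (e ∘ₗ f) w ∈ W (a + 2) := fun w hw => by
    have h1 := h.raise_mem (h.lower_mem hw)
    rwa [sub_add_cancel] at h1
  have hinj : Function.Injective ((e ∘ₗ f).restrict hef) := by
    rw [injective_iff_map_eq_zero]
    intro w hw
    exact Subtype.ext (h.eq_zero_of_raise_lower_eq_zero (by omega) w.2 (congrArg Subtype.val hw))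
  obtain ⟨w, hw⟩ := LinearMap.surjective_of_injective hinj ⟨e v, h.raise_mem hv⟩
  have hw' : e (f w) = e v := congrArg Subtype.val hw
  have hfw : f w ∈ W a := by
    have h1 := h.lower_mem w.2
    rwa [add_sub_cancel_right] at h1
  refine ⟨v - f w, Submodule.sub_mem _ hv hfw, by rw [map_sub, hw', sub_self], w, w.2, ?_⟩
  rw [sub_add_cancel]

/-- The spaces of nonnegative weight are generated by the highest weight vectors. -/
theorem le_of_lower_pow_mem (h : IsWeightFamily e f W) [Module.Finite ℚ U] {S : Submodule ℚ U}
    (hS : ∀ (a : ℕ) (m : U), m ∈ W a → e m = 0 → ∀ j, (f ^ j) m ∈ S) {a : ℤ} (ha : 0 ≤ a) :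
    W a ≤ S := by
  obtain ⟨N, hN⟩ := h.eq_bot
  have key : ∀ (k : ℕ) (a : ℤ), 0 ≤ a → (N : ℤ) < a + k → ∀ v ∈ W a, ∀ j, (f ^ j) v ∈ S := by
    intro k
    induction k using Nat.strong_induction_on with
    | _ k ih =>
      intro a ha hk v hv j
      by_cases hNa : (N : ℤ) < a
      · rw [hN a (hNa.trans_le (le_abs_self a)), Submodule.mem_bot] at hv
        rw [hv, map_zero]
        exact S.zero_mem
      · obtain ⟨m, hm, hm0, w, hw, rfl⟩ := h.exists_eq_add ha hv
        rw [map_add]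
        lift a to ℕ using ha
        refine S.add_mem (hS a m hm hm0 j) ?_
        rw [← Module.End.mul_apply, ← pow_succ]
        exact ih (k - 1) (by omega) (a + 2) (by omega) (by omega) w hw (j + 1)
  intro v hv
  simpa using key (N + 1) a ha (by push_cast; omega) v hv 0

/-- The splitting of the space of weight `a ≥ 0` as a linear equivalence. -/
theorem bijective_add_lower (h : IsWeightFamily e f W) [Module.Finite ℚ U] {a : ℤ} (ha : 0 ≤ a) :
    Function.Injective ((LinearMap.ker e ⊓ W a).subtype.coprod (f ∘ₗ (W (a + 2)).subtype)) ∧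
      LinearMap.range ((LinearMap.ker e ⊓ W a).subtype.coprod (f ∘ₗ (W (a + 2)).subtype))
        = W a := by
  constructor
  · rw [injective_iff_map_eq_zero]
    rintro ⟨⟨m, hm⟩, ⟨w, hw⟩⟩ hmw
    have h1 : m + f w = 0 := by simpa using hmw
    have h2 : e (f w) = 0 := by
      have h3 := congrArg e h1
      rwa [map_add, LinearMap.mem_ker.1 hm.1, zero_add, map_zero] at h3
    have h3 := h.eq_zero_of_raise_lower_eq_zero (by omega) hw h2
    subst h3
    rw [map_zero, add_zero] at h1
    subst h1
    rfl
  · apply le_antisymm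
    · rintro _ ⟨⟨m, w⟩, rfl⟩
      have h1 := h.lower_mem w.2
      rw [add_sub_cancel_right] at h1
      simpa using Submodule.add_mem _ m.2.2 h1
    · intro v hv
      obtain ⟨m, hm, hm0, w, hw, rfl⟩ := h.exists_eq_add ha hv
      exact ⟨(⟨m, hm0, hm⟩, ⟨w, hw⟩), rfl⟩

theorem finrank_ker_add (h : IsWeightFamily e f W) [Module.Finite ℚ U] {a : ℤ} (ha : 0 ≤ a) :
    Module.finrank ℚ (LinearMap.ker e ⊓ W a : Submodule ℚ U) + Module.finrank ℚ (W (a + 2))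
      = Module.finrank ℚ (W a) := by
  obtain ⟨h1, h2⟩ := h.bijective_add_lower ha
  rw [← Module.finrank_prod, ← LinearMap.finrank_range_of_inj h1, h2]

end IsWeightFamily

section

variable {U : Type*} [AddCommGroup U] [Module ℚ U] (f : Module.End ℚ U) (a : ℕ)

/-- The basis `((a - i)! / a!) f^i m` of the representation generated by a highest weight vector `m`
of weight `a`; it corresponds to the monomials `X_0^(a-i) X_1^i`. -/
def stringVec (i : ℕ) : Module.End ℚ U := (((a - i).factorial : ℚ) / a.factorial) • f ^ i

variable {f a} {e : Module.End ℚ U} {W : ℤ → Submodule ℚ U} {m : U}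

theorem stringVec_zero : stringVec f a 0 m = m := by
  have h1 : (a.factorial : ℚ) ≠ 0 := by exact_mod_cast a.factorial_ne_zero
  simp [stringVec, div_self h1]

theorem lower_stringVec {i : ℕ} (hi : i < a) :
    f (stringVec f a i m) = ((a - i : ℕ) : ℚ) • stringVec f a (i + 1) m := by
  obtain ⟨k, rfl⟩ := Nat.exists_eq_add_of_lt hi
  rw [stringVec, stringVec, LinearMap.smul_apply, LinearMap.smul_apply, map_smul,
    ← Module.End.mul_apply, ← pow_succ', smul_smul, show i + k + 1 - i = k + 1 by omega,
    show i + k + 1 - (i + 1) = k by omega, Nat.factorial_succ k]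
  congr 1
  push_cast
  ring

theorem lower_pow_stringVec {i j : ℕ} (hij : i + j ≤ a) :
    (f ^ j) (stringVec f a i m) = ((a - i).descFactorial j : ℚ) • stringVec f a (i + j) m := by
  induction j with
  | zero => simp
  | succ j ih =>
    rw [pow_succ', Module.End.mul_apply, ih (by omega), map_smul, lower_stringVec (by omega),
      smul_smul, Nat.descFactorial_succ, Nat.cast_mul, mul_comm ((a - i - j : ℕ) : ℚ),
      Nat.sub_sub, add_assoc]

theorem IsWeightFamily.lower_pow_stringVec_eq_zero (h : IsWeightFamily e f W) (hm : m ∈ W a)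
    (h0 : e m = 0) {i : ℕ} (hi : i ≤ a) : (f ^ (a - i + 1)) (stringVec f a i m) = 0 := by
  rw [stringVec, LinearMap.smul_apply, map_smul, ← Module.End.mul_apply, ← pow_add,
    show a - i + 1 + i = a + 1 by omega, h.lower_pow_eq_zero hm h0, smul_zero]

theorem IsWeightFamily.raise_stringVec (h : IsWeightFamily e f W) (hm : m ∈ W a) (h0 : e m = 0)
    {i : ℕ} (hi : i + 1 ≤ a) :
    e (stringVec f a (i + 1) m) = ((i + 1 : ℕ) : ℚ) • stringVec f a i m := by
  obtain ⟨k, rfl⟩ := Nat.exists_eq_add_of_le hi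
  rw [stringVec, stringVec, LinearMap.smul_apply, LinearMap.smul_apply, map_smul,
    h.raise_lower_pow hm h0, smul_smul, smul_smul, show i + 1 + k - (i + 1) = k by omega,
    show i + 1 + k - i = k + 1 by omega, Nat.factorial_succ k]
  congr 1
  push_cast
  ring

theorem IsWeightFamily.raise_pow_stringVec (h : IsWeightFamily e f W) (hm : m ∈ W a) (h0 : e m = 0)
    {i j : ℕ} (hij : j ≤ i) (hi : i ≤ a) :
    (e ^ j) (stringVec f a i m) = (i.descFactorial j : ℚ) • stringVec f a (i - j) m := by
  induction j with
  | zero => simp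
  | succ j ih =>
    rw [pow_succ', Module.End.mul_apply, ih (by omega), map_smul,
      show i - j = (i - (j + 1)) + 1 by omega, h.raise_stringVec hm h0 (by omega), smul_smul,
      Nat.descFactorial_succ, Nat.cast_mul, mul_comm ((i - j : ℕ) : ℚ),
      show i - (j + 1) + 1 = i - j by omega]

theorem IsWeightFamily.raise_pow_stringVec_eq_zero (h : IsWeightFamily e f W) (hm : m ∈ W a)
    (h0 : e m = 0) {i : ℕ} (hi : i ≤ a) : (e ^ (i + 1)) (stringVec f a i m) = 0 := by
  rw [pow_succ', Module.End.mul_apply, h.raise_pow_stringVec hm h0 le_rfl hi, map_smul,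
    Nat.sub_self, stringVec_zero, h0, smul_zero]

theorem IsWeightFamily.exp_raise_stringVec (h : IsWeightFamily e f W) (hm : m ∈ W a) (h0 : e m = 0)
    (he : IsNilpotent e) (t : ℚ) {i : ℕ} (hi : i ≤ a) :
    IsNilpotent.exp (t • e) (stringVec f a i m)
      = ∑ j ∈ Finset.range (i + 1), (t ^ j * i.choose j) • stringVec f a (i - j) m := by
  have h1 : (t • e) ^ (i + 1) • stringVec f a i m = 0 := by
    rw [smul_pow, Module.End.smul_def, LinearMap.smul_apply,
      h.raise_pow_stringVec_eq_zero hm h0 hi, smul_zero]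
  have h2 := IsNilpotent.exp_smul_eq_sum h1 (he.smul t)
  rw [Module.End.smul_def] at h2
  rw [h2]
  refine Finset.sum_congr rfl fun j hj => ?_
  have hj' : j ≤ i := by have := Finset.mem_range.1 hj; omega
  have h3 : (j.factorial : ℚ) ≠ 0 := by exact_mod_cast j.factorial_ne_zero
  rw [smul_pow, Module.End.smul_def, LinearMap.smul_apply, h.raise_pow_stringVec hm h0 hj' hi,
    smul_smul, smul_smul, Nat.descFactorial_eq_factorial_mul_choose]
  congr 1
  push_cast
  field_simp

theorem IsWeightFamily.exp_lower_stringVec (h : IsWeightFamily e f W) (hm : m ∈ W a) (h0 : e m = 0)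
    (hf : IsNilpotent f) (t : ℚ) {i : ℕ} (hi : i ≤ a) :
    IsNilpotent.exp (t • f) (stringVec f a i m)
      = ∑ j ∈ Finset.range (a - i + 1), (t ^ j * (a - i).choose j) • stringVec f a (i + j) m := by
  have h1 : (t • f) ^ (a - i + 1) • stringVec f a i m = 0 := by
    rw [smul_pow, Module.End.smul_def, LinearMap.smul_apply,
      h.lower_pow_stringVec_eq_zero hm h0 hi, smul_zero]
  have h2 := IsNilpotent.exp_smul_eq_sum h1 (hf.smul t)
  rw [Module.End.smul_def] at h2
  rw [h2]
  refine Finset.sum_congr rfl fun j hj => ?_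
  have hj' : i + j ≤ a := by have := Finset.mem_range.1 hj; omega
  have h3 : (j.factorial : ℚ) ≠ 0 := by exact_mod_cast j.factorial_ne_zero
  rw [smul_pow, Module.End.smul_def, LinearMap.smul_apply, lower_pow_stringVec hj',
    smul_smul, smul_smul, Nat.descFactorial_eq_factorial_mul_choose]
  congr 1
  push_cast
  field_simp

end

/-! ### Integration of the `sl_2`-action -/

/-- The upper triangular unipotent matrices. -/
def upperUnip (t : ℚ) : SL(2, ℚ) := ⟨!![1, t; 0, 1], by simp [Matrix.det_fin_two]⟩

/-- The lower triangular unipotent matrices. -/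
def lowerUnip (t : ℚ) : SL(2, ℚ) := ⟨!![1, 0; t, 1], by simp [Matrix.det_fin_two]⟩

theorem coe_upperUnip (t : ℚ) : (upperUnip t : Matrix (Fin 2) (Fin 2) ℚ) = !![1, t; 0, 1] := rfl

theorem coe_lowerUnip (t : ℚ) : (lowerUnip t : Matrix (Fin 2) (Fin 2) ℚ) = !![1, 0; t, 1] := rfl

/-- The unipotent matrices generate `SL_2(ℚ)`. -/
theorem sl2_induction {P : SL(2, ℚ) → Prop} (mul : ∀ A B, P A → P B → P (A * B))
    (upper : ∀ t, P (upperUnip t)) (lower : ∀ t, P (lowerUnip t)) (A : SL(2, ℚ)) : P A := by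
  have key : ∀ A : SL(2, ℚ), (A : Matrix (Fin 2) (Fin 2) ℚ) 1 0 ≠ 0 → P A := by
    intro A hc
    have hdet := A.det_coe
    rw [Matrix.det_fin_two] at hdet
    -- Row and column operations with the pivot `A 1 0` reduce the matrix to a lower unipotent one.
    have h1 : A = upperUnip ((A.1 0 0 - 1) / A.1 1 0) * lowerUnip (A.1 1 0)
        * upperUnip ((A.1 1 1 - 1) / A.1 1 0) := by
      ext i j
      fin_cases i <;> fin_cases j <;>
        simp [coe_upperUnip, coe_lowerUnip, Matrix.mul_apply, Fin.sum_univ_two] <;> field_simp <;>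
        grind
    rw [h1]
    exact mul _ _ (mul _ _ (upper _) (lower _)) (upper _)
  by_cases hc : (A : Matrix (Fin 2) (Fin 2) ℚ) 1 0 = 0
  · have hdet := A.det_coe
    rw [Matrix.det_fin_two, hc, mul_zero, sub_zero] at hdet
    -- An upper triangular matrix is moved to the previous case by adding a column.
    have h1 : A = (A * lowerUnip 1) * lowerUnip (-1) := by
      rw [mul_assoc, show lowerUnip 1 * lowerUnip (-1) = 1 from ?_, mul_one]
      ext i j
      fin_cases i <;> fin_cases j <;>
        simp [coe_lowerUnip, Matrix.mul_apply, Fin.sum_univ_two]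
    rw [h1]
    refine mul _ _ (key _ ?_) (lower _)
    have h2 : (A : Matrix (Fin 2) (Fin 2) ℚ) 1 1 ≠ 0 := fun h => by simp [h] at hdet
    simpa [coe_lowerUnip, Matrix.mul_apply, Fin.sum_univ_two, hc] using h2
  · exact key A hc

/-- The linear map on `ℚ[X_0, X_1]` that sends `X_0^i X_1^j` to `u j`. -/
def formMap {U : Type*} [AddCommGroup U] [Module ℚ U] :
    (ℕ → U) →ₗ[ℚ] MvPolynomial (Fin 2) ℚ →ₗ[ℚ] U :=
  ((MvPolynomial.basisMonomials (Fin 2) ℚ).constr ℚ).toLinearMap ∘ₗ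
    LinearMap.funLeft ℚ U fun d : Fin 2 →₀ ℕ => d 1

/-- The monomials `X_0^i X_1^j`. -/
def binaryMonomial (i j : ℕ) : MvPolynomial (Fin 2) ℚ := MvPolynomial.X 0 ^ i * MvPolynomial.X 1 ^ j

theorem monomial_eq_binaryMonomial (d : Fin 2 →₀ ℕ) :
    MvPolynomial.monomial d (1 : ℚ) = binaryMonomial (d 0) (d 1) := by
  rw [MvPolynomial.monomial_eq, binaryMonomial, Finsupp.prod_fintype _ _ (by simp)]
  simp

theorem formMap_binaryMonomial {U : Type*} [AddCommGroup U] [Module ℚ U] (u : ℕ → U) (i j : ℕ) :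
    formMap u (binaryMonomial i j) = u j := by
  have h1 := monomial_eq_binaryMonomial (Finsupp.single 0 i + Finsupp.single 1 j)
  simp only [Finsupp.add_apply, Finsupp.single_apply, Fin.isValue, if_true, zero_add,
    add_zero, one_ne_zero, zero_ne_one, if_false] at h1
  have h2 := Module.Basis.constr_basis (MvPolynomial.basisMonomials (Fin 2) ℚ) ℚ
    (fun d => u (d 1)) (Finsupp.single 0 i + Finsupp.single 1 j)
  rw [MvPolynomial.coe_basisMonomials] at h2
  dsimp only at h2
  rw [h1] at h2
  refine h2.trans ?_
  simp

theorem V_eq_span (a : ℕ) : (V a).toSubmodule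
    = Submodule.span ℚ (Set.range fun i : Fin (a + 1) => binaryMonomial (a - i) i) := by
  apply le_antisymm
  · intro P hP
    have hP' : P.IsHomogeneous a := hP
    rw [← P.support_sum_monomial_coeff]
    refine Submodule.sum_mem _ fun d hd => ?_
    have h1 := hP' (MvPolynomial.mem_support_iff.1 hd)
    rw [Finsupp.weight_apply, Finsupp.sum_fintype _ _ (by simp)] at h1
    simp only [Fin.sum_univ_two, Pi.one_apply, smul_eq_mul, mul_one] at h1
    rw [← mul_one (MvPolynomial.coeff d P), ← smul_eq_mul, ← MvPolynomial.smul_monomial,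
      monomial_eq_binaryMonomial]
    refine Submodule.smul_mem _ _ (Submodule.subset_span ⟨⟨d 1, by omega⟩, ?_⟩)
    simp only
    congr 1
    omega
  · rw [Submodule.span_le]
    rintro _ ⟨i, rfl⟩
    have h1 := (MvPolynomial.isHomogeneous_X_pow (R := ℚ) (0 : Fin 2) (a - i)).mul
      (MvPolynomial.isHomogeneous_X_pow (R := ℚ) (1 : Fin 2) i)
    rwa [show a - (i : ℕ) + i = a by omega] at h1

theorem binaryMonomial_mem_V {a i : ℕ} (hi : i ≤ a) :
    binaryMonomial (a - i) i ∈ (V a).toSubmodule := by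
  rw [V_eq_span]
  exact Submodule.subset_span ⟨⟨i, by omega⟩, rfl⟩

instance finite_V (a : ℕ) : Module.Finite ℚ (V a).toSubmodule := by
  rw [V_eq_span]
  exact Module.Finite.span_of_finite ℚ (Set.finite_range _)

theorem finrank_V_le (a : ℕ) : Module.finrank ℚ (V a).toSubmodule ≤ a + 1 := by
  rw [V_eq_span]
  exact (finrank_range_le_card _).trans (by simp)

theorem polyRep_upperUnip (t : ℚ) (k i : ℕ) : polyRep (upperUnip t) (binaryMonomial k i)
    = ∑ j ∈ Finset.range (i + 1), (t ^ j * i.choose j) • binaryMonomial (k + j) (i - j) := by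
  have h1 : polyRep (upperUnip t) (binaryMonomial k i) = MvPolynomial.X 0 ^ k *
      (t • MvPolynomial.X 0 + MvPolynomial.X 1) ^ i := by
    rw [binaryMonomial, polyRep]
    simp [upperUnip]
  rw [h1, add_pow, Finset.mul_sum]
  refine Finset.sum_congr rfl fun j _ => ?_
  simp only [binaryMonomial, MvPolynomial.smul_eq_C_mul, map_mul, map_pow, map_natCast]
  ring

theorem polyRep_lowerUnip (t : ℚ) (k i : ℕ) : polyRep (lowerUnip t) (binaryMonomial k i)
    = ∑ j ∈ Finset.range (k + 1), (t ^ j * k.choose j) • binaryMonomial (k - j) (i + j) := by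
  have h1 : polyRep (lowerUnip t) (binaryMonomial k i) =
      (t • MvPolynomial.X 1 + MvPolynomial.X 0) ^ k * MvPolynomial.X 1 ^ i := by
    rw [binaryMonomial, polyRep]
    simp [lowerUnip, add_comm]
  rw [h1, add_pow, Finset.sum_mul]
  refine Finset.sum_congr rfl fun j _ => ?_
  simp only [binaryMonomial, MvPolynomial.smul_eq_C_mul, map_mul, map_pow, map_natCast]
  ring

section

variable {n : ℕ}

theorem totalWeight_le (T : WeightedPartition n) : totalWeight T ≤ 2 * n := by
  have h1 : ∀ s : Multiset (ℕ × Fin 3), (∀ b ∈ s, 0 < b.1) →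
      (s.map fun b => (b.2 : ℕ)).sum ≤ 2 * (s.map Prod.fst).sum := by
    intro s
    induction s using Multiset.induction_on with
    | empty => simp
    | cons b s ih =>
      intro hs
      have h2 := ih fun c hc => hs c (Multiset.mem_cons_of_mem hc)
      have h3 := hs b (Multiset.mem_cons_self b s)
      have h4 := b.2.2
      simp only [Multiset.map_cons, Multiset.sum_cons]
      omega
  have h2 := h1 T.blocks T.pos
  rwa [T.sum_eq] at h2

theorem isWeightFamily_EWeighted (T : WeightedPartition n) :
    IsWeightFamily (raise n) (lower n) fun a => (EWeighted T a).toSubmodule :=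
  ⟨raise_mem, lower_mem, lie_raise_lower, _, fun _ h => EWeighted_eq_bot h⟩

theorem ELabelled_le_EWeighted (L : LabelledPartition n) :
    (ELabelled L).toSubmodule ≤ (EWeighted (toWeighted L) (torusWeight L)).toSubmodule :=
  le_iSup₂_of_le (f := fun K (_ : K ∈ Labellings (toWeighted L) (torusWeight L)) =>
    (ELabelled K).toSubmodule) L ⟨rfl, rfl⟩ le_rfl

/-- An endomorphism that vanishes on all weight spaces is zero, as these span the algebra. -/
theorem end_eq_zero {φ : Module.End ℚ (E2Alg n)}
    (h : ∀ (T : WeightedPartition n) (a : ℤ), ∀ v ∈ (EWeighted T a).toSubmodule, φ v = 0) :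
    φ = 0 := by
  rw [← LinearMap.ker_eq_top, eq_top_iff, ← iSup_ELabelled]
  exact iSup_le fun L v hv => h _ _ v (ELabelled_le_EWeighted L hv)

theorem isNilpotent_raise (n : ℕ) : IsNilpotent (raise n) := by
  refine ⟨2 * n + 1, end_eq_zero fun T a v hv => ?_⟩
  by_cases ha : (totalWeight T : ℤ) < |a|
  · rw [EWeighted_eq_bot ha, Submodule.mem_bot] at hv
    rw [hv, map_zero]
  · have h1 := (isWeightFamily_EWeighted T).raise_pow_mem hv (2 * n + 1)
    have h2 := totalWeight_le T
    have h3 := neg_abs_le a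
    rwa [EWeighted_eq_bot (lt_of_lt_of_le (by push_cast; omega) (le_abs_self _)),
      Submodule.mem_bot] at h1

theorem isNilpotent_lower (n : ℕ) : IsNilpotent (lower n) := by
  refine ⟨2 * n + 1, end_eq_zero fun T a v hv => ?_⟩
  by_cases ha : (totalWeight T : ℤ) < |a|
  · rw [EWeighted_eq_bot ha, Submodule.mem_bot] at hv
    rw [hv, map_zero]
  · have h1 := (isWeightFamily_EWeighted T).lower_pow_mem hv (2 * n + 1)
    have h2 := totalWeight_le T
    have h3 := le_abs_self a
    rwa [EWeighted_eq_bot (lt_of_lt_of_le (by push_cast; omega) (neg_le_abs _)),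
      Submodule.mem_bot] at h1

/-- A matrix in `SL_2` of the form `1 + N` with `N² = 0` acts as the exponential of the derivation
given by `N`. -/
theorem slRep_eq_exp {A : SL(2, ℚ)} {N : Matrix (Fin 2) (Fin 2) ℚ}
    (hA : (A : Matrix (Fin 2) (Fin 2) ℚ) = 1 + N) (hN : N * N = 0)
    (hnil : IsNilpotent (der n N)) : slRep n A = IsNilpotent.exp (der n N) := by
  have hcl : ∀ g : Gen n, IsNilpotent.exp (der n N) (cl g) = cl g + der n N (cl g) := by
    intro g
    have h1 : der n N ^ 2 • cl g = 0 := by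
      rw [pow_two, Module.End.smul_def, Module.End.mul_apply]
      cases g with
      | cls c i =>
        have h2 : ∀ d, N d 0 * N 0 c + N d 1 * N 1 c = 0 := by
          intro d
          have h3 := congrFun (congrFun hN d) c
          rwa [Matrix.mul_apply, Fin.sum_univ_two] at h3
        have h3 := h2 0
        have h4 := h2 1
        simp only [der_cl, genDer, map_add, map_smul, Fin.sum_univ_two]
        calc _ = (N 0 0 * N 0 c + N 0 1 * N 1 c) • cl (Gen.cls 0 i)
              + (N 1 0 * N 0 c + N 1 1 * N 1 c) • cl (Gen.cls 1 i) := by module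
          _ = 0 := by rw [h3, h4, zero_smul, zero_smul, add_zero]
      | edge i j => rw [der_edge, map_zero]
    have h2 := IsNilpotent.exp_smul_eq_sum h1 hnil
    rw [Module.End.smul_def] at h2
    rw [h2]
    simp [Finset.sum_range_succ]
  have hone : IsNilpotent.exp (der n N) (1 : E2Alg n) = 1 := by
    have h1 : der n N ^ 1 • (1 : E2Alg n) = 0 := by
      rw [pow_one, Module.End.smul_def, der_one]
    have h2 := IsNilpotent.exp_smul_eq_sum h1 hnil
    rw [Module.End.smul_def] at h2
    rw [h2]
    simp
  refine LinearMap.ext fun a => ?_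
  induction a using E2Alg.induction with
  | algebraMap r => rw [Algebra.algebraMap_eq_smul_one, map_smul, map_smul, hone, slRep_one]
  | cl g =>
    rw [hcl, slRep_cl]
    cases g with
    | cls c i =>
      rw [der_cl]
      simp only [genAct, genDer, hA, Matrix.add_apply, add_smul, Finset.sum_add_distrib]
      simp [Matrix.one_apply]
    | edge i j => rw [der_edge, add_zero]; rfl
  | mul a b ha hb =>
    rw [slRep_mul, ha, hb, Module.End.exp_mul_of_derivation ℚ (E2Alg n) _ (der_mul N) hnil]
  | add a b ha hb => rw [map_add, map_add, ha, hb]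

theorem der_smul (N : Matrix (Fin 2) (Fin 2) ℚ) (t : ℚ) : der n (t • N) = t • der n N := by
  refine LinearMap.ext fun a => ?_
  rw [LinearMap.smul_apply]
  induction a using E2Alg.induction with
  | algebraMap r => simp [der_algebraMap]
  | cl g => cases g <;> simp [der_cl, genDer, mul_smul]
  | mul a b ha hb => rw [der_mul, der_mul, ha, hb, smul_add, mul_smul_comm, smul_mul_assoc]
  | add a b ha hb => rw [map_add, map_add, ha, hb, smul_add]

theorem slRep_upperUnip (t : ℚ) : slRep n (upperUnip t) = IsNilpotent.exp (t • raise n) := by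
  have h1 : t • raise n = der n (t • !![0, 1; 0, 0]) := (der_smul _ t).symm
  rw [h1]
  refine slRep_eq_exp ?_ ?_ (h1 ▸ (isNilpotent_raise n).smul t)
  · ext i j
    fin_cases i <;> fin_cases j <;> simp [upperUnip]
  · ext i j
    fin_cases i <;> fin_cases j <;> simp [Matrix.mul_apply]

theorem slRep_lowerUnip (t : ℚ) : slRep n (lowerUnip t) = IsNilpotent.exp (t • lower n) := by
  have h1 : t • lower n = der n (t • !![0, 0; 1, 0]) := (der_smul _ t).symm
  rw [h1]
  refine slRep_eq_exp ?_ ?_ (h1 ▸ (isNilpotent_lower n).smul t)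
  · ext i j
    fin_cases i <;> fin_cases j <;> simp [lowerUnip]
  · ext i j
    fin_cases i <;> fin_cases j <;> simp [Matrix.mul_apply]

/-- A highest weight vector of weight `a` generates a copy of the space of binary forms. -/
theorem slRep_formMap {T : WeightedPartition n} {a : ℕ} {m : E2Alg n}
    (hm : m ∈ (EWeighted T a).toSubmodule) (h0 : raise n m = 0) (A : SL(2, ℚ)) :
    ∀ P ∈ (V a).toSubmodule, slRep n A (formMap (fun i => stringVec (lower n) a i m) P)
      = formMap (fun i => stringVec (lower n) a i m) (polyRep A P) := by
  have hW := isWeightFamily_EWeighted T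
  induction A using sl2_induction with
  | mul A B hA hB =>
    intro P hP
    rw [map_mul, map_mul, Module.End.mul_apply, Module.End.mul_apply, hB P hP,
      hA _ ((V a).apply_mem_toSubmodule B hP)]
  | upper t =>
    intro P hP
    rw [V_eq_span] at hP
    induction hP using Submodule.span_induction with
    | mem P hP =>
      obtain ⟨i, rfl⟩ := hP
      rw [formMap_binaryMonomial, slRep_upperUnip,
        hW.exp_raise_stringVec hm h0 (isNilpotent_raise n) t (by omega), polyRep_upperUnip,
        map_sum]
      simp only [map_smul, formMap_binaryMonomial]
    | zero => simp
    | add x y _ _ hx hy => simp only [map_add, hx, hy]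
    | smul c x _ hx => simp only [map_smul, hx]
  | lower t =>
    intro P hP
    rw [V_eq_span] at hP
    induction hP using Submodule.span_induction with
    | mem P hP =>
      obtain ⟨i, rfl⟩ := hP
      rw [formMap_binaryMonomial, slRep_lowerUnip,
        hW.exp_lower_stringVec hm h0 (isNilpotent_lower n) t (by omega), polyRep_lowerUnip,
        map_sum]
      simp only [map_smul, formMap_binaryMonomial]
    | zero => simp
    | add x y _ _ hx hy => simp only [map_add, hx, hy]
    | smul c x _ hx => simp only [map_smul, hx]

end

/-! ### The isotypic decomposition -/

section

variable {n : ℕ}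

/-- The highest weight vectors in `E(λ,t,a)`. -/
def highest (T : WeightedPartition n) (a : ℤ) : Subrepresentation (symRep n) where
  toSubmodule := LinearMap.ker (raise n) ⊓ (EWeighted T a).toSubmodule
  apply_mem_toSubmodule σ v hv := by
    refine ⟨?_, (EWeighted T a).apply_mem_toSubmodule σ hv.2⟩
    rw [SetLike.mem_coe, LinearMap.mem_ker, raise, ← symRep_der]
    have h := LinearMap.mem_ker.1 hv.1
    rw [raise] at h
    rw [h, map_zero]

/-- The space of weight `a ≥ 0` is the sum of the highest weight vectors and of a copy of the space
of weight `a + 2`. -/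
theorem nonempty_highest_prod_equiv (T : WeightedPartition n) {a : ℤ} (ha : 0 ≤ a) :
    Nonempty (((highest T a).toRepresentation.prod (EWeighted T (a + 2)).toRepresentation).Equiv
      (EWeighted T a).toRepresentation) := by
  obtain ⟨h1, h2⟩ := (isWeightFamily_EWeighted T).bijective_add_lower ha
  refine nonempty_equiv_of_range_eq (fun σ => symRep n σ) h1
    (EWeighted T a).toSubmodule.injective_subtype ?_ (fun σ x => rfl) ?_
  · rintro σ ⟨m, w⟩
    change symRep n σ m + lower n (symRep n σ w) = symRep n σ (m + lower n w)
    rw [map_add, lower, symRep_der]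
  · exact h2.trans (Submodule.range_subtype _).symm

/-- The map from `m ⊗ P` to the vector corresponding to the form `P` in the copy of `𝕍_a` generated
by the highest weight vector `m`. -/
def stringMap (T : WeightedPartition n) (a : ℕ) :
    (highest T a).toSubmodule ⊗[ℚ] (V a).toSubmodule →ₗ[ℚ] E2Alg n :=
  TensorProduct.lift ((formMap ∘ₗ LinearMap.pi (stringVec (lower n) a)).domRestrict₁₂ _ _)

theorem stringMap_tmul (T : WeightedPartition n) (a : ℕ) (m : (highest T a).toSubmodule)
    (P : (V a).toSubmodule) : stringMap T a (m ⊗ₜ P)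
      = formMap (fun i => stringVec (lower n) a i m.1) P.1 := rfl

theorem symRep_stringVec (σ : Equiv.Perm (Fin n)) (a i : ℕ) (m : E2Alg n) :
    symRep n σ (stringVec (lower n) a i m) = stringVec (lower n) a i (symRep n σ m) := by
  rw [stringVec, LinearMap.smul_apply, LinearMap.smul_apply, map_smul]
  congr 1
  induction i with
  | zero => rfl
  | succ i ih =>
    rw [pow_succ', Module.End.mul_apply, Module.End.mul_apply, ← ih]
    exact symRep_der _ _ _

/-- The map from the isotypic summand commutes with `S_n`, because the lowering operator does, and
with `SL_2`, because the vector `m` is of highest weight. -/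
theorem stringMap_boxTensor (T : WeightedPartition n) (a : ℕ)
    (g : Equiv.Perm (Fin n) × SL(2, ℚ)) (x : (highest T a).toSubmodule ⊗[ℚ] (V a).toSubmodule) :
    stringMap T a (boxTensor (highest T a).toRepresentation (V a).toRepresentation g x)
      = E2Rep n g (stringMap T a x) := by
  obtain ⟨σ, A⟩ := g
  have hg : E2Rep n (σ, A) = symRep n σ * slRep n A := by
    change _ = E2Rep n (σ, 1) * E2Rep n (1, A)
    rw [← map_mul, Prod.mk_mul_mk, mul_one, one_mul]
  induction x using TensorProduct.induction_on with
  | zero => simp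
  | add x y hx hy => simp only [map_add, hx, hy]
  | tmul m P =>
    have h1 : boxTensor (highest T a).toRepresentation (V a).toRepresentation (σ, A) (m ⊗ₜ P)
        = (highest T a).toRepresentation σ m ⊗ₜ (V a).toRepresentation A P := rfl
    rw [h1, stringMap_tmul, stringMap_tmul, hg, Module.End.mul_apply,
      slRep_formMap m.2.2 (LinearMap.mem_ker.1 m.2.1) A _ P.2]
    change formMap (fun i => stringVec (lower n) a i (symRep n σ m.1)) (polyRep A P.1) = _
    have hP := (V a).apply_mem_toSubmodule A P.2
    generalize polyRep A P.1 = Q at hP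
    rw [V_eq_span] at hP
    induction hP using Submodule.span_induction with
    | mem Q hQ =>
      obtain ⟨i, rfl⟩ := hQ
      rw [formMap_binaryMonomial, formMap_binaryMonomial, symRep_stringVec]
    | zero => simp
    | add x y _ _ hx hy => simp only [map_add, hx, hy]
    | smul c x _ hx => simp only [map_smul, hx]

theorem EWeighted_le_E2 {T : WeightedPartition n} {p q : ℕ}
    (hT : numBlocks T + q = n ∧ totalWeight T = p) (a : ℤ) :
    (EWeighted T a).toSubmodule ≤ (E2 n p q).toSubmodule := by
  rw [E2_eq_iSup]
  refine iSup₂_le fun L hL => ?_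
  exact le_iSup₂_of_le (f := fun (L : LabelledPartition n) (_ : numBlocks (toWeighted L) + q = n ∧
    totalWeight (toWeighted L) = p) => (ELabelled L).toSubmodule) L (by rw [hL.1]; exact hT) le_rfl

theorem range_stringMap_le {T : WeightedPartition n} {p q : ℕ}
    (hT : numBlocks T + q = n ∧ totalWeight T = p) (a : ℕ) :
    LinearMap.range (stringMap T a) ≤ (E2 n p q).toSubmodule := by
  rintro _ ⟨x, rfl⟩
  induction x using TensorProduct.induction_on with
  | zero => simp
  | add x y hx hy => rw [map_add]; exact Submodule.add_mem _ hx hy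
  | tmul m P =>
    rw [stringMap_tmul]
    obtain ⟨P, hP⟩ := P
    dsimp only
    rw [V_eq_span] at hP
    induction hP using Submodule.span_induction with
    | mem Q hQ =>
      obtain ⟨i, rfl⟩ := hQ
      rw [formMap_binaryMonomial, stringVec, LinearMap.smul_apply]
      exact EWeighted_le_E2 hT _ (Submodule.smul_mem _ _
        ((isWeightFamily_EWeighted T).lower_pow_mem m.2.2 i))
    | zero => simp
    | add x y _ _ hx hy => rw [map_add]; exact Submodule.add_mem _ hx hy
    | smul c x _ hx => rw [map_smul]; exact Submodule.smul_mem _ _ hx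

theorem lower_pow_mem_range_stringMap {T : WeightedPartition n} {a : ℕ} {m : E2Alg n}
    (hm : m ∈ (EWeighted T a).toSubmodule) (h0 : raise n m = 0) (j : ℕ) :
    (lower n ^ j) m ∈ LinearMap.range (stringMap T a) := by
  by_cases hj : j ≤ a
  · have h1 := lower_pow_stringVec (f := lower n) (a := a) (m := m) (i := 0) (j := j) (by omega)
    rw [stringVec_zero, zero_add] at h1
    rw [h1]
    refine Submodule.smul_mem _ _ ⟨(⟨m, h0, hm⟩ : (highest T a).toSubmodule) ⊗ₜ
      (⟨_, binaryMonomial_mem_V hj⟩ : (V a).toSubmodule), ?_⟩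
    rw [stringMap_tmul, formMap_binaryMonomial]
  · obtain ⟨k, rfl⟩ := Nat.exists_eq_add_of_lt (not_le.1 hj)
    rw [show a + k + 1 = k + (a + 1) by omega, pow_add, Module.End.mul_apply,
      (isWeightFamily_EWeighted T).lower_pow_eq_zero hm h0, map_zero]
    exact Submodule.zero_mem _

/-- The copies of the representations `𝕍_a` generated by the highest weight vectors exhaust the
homogeneous component. -/
theorem iSup_range_stringMap (n p q : ℕ) : ⨆ i : {T : WeightedPartition n //
    numBlocks T + q = n ∧ totalWeight T = p} × Fin (p + 1),
      LinearMap.range (stringMap i.1.1 i.2) = (E2 n p q).toSubmodule := by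
  refine le_antisymm (iSup_le fun i => range_stringMap_le i.1.2 _) ?_
  rw [E2_eq_iSup]
  refine iSup₂_le fun L hL => (ELabelled_le_EWeighted L).trans ?_
  set T := toWeighted L
  set R := ⨆ i : {T : WeightedPartition n // numBlocks T + q = n ∧ totalWeight T = p} ×
    Fin (p + 1), LinearMap.range (stringMap i.1.1 i.2) with hR
  have hpos : ∀ b : ℤ, 0 ≤ b → (EWeighted T b).toSubmodule ≤ R := by
    intro b hb
    refine (isWeightFamily_EWeighted T).le_of_lower_pow_mem (fun a m hm h0 j => ?_) hb
    by_cases ha : a ≤ p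
    · exact Submodule.mem_iSup_of_mem (p := fun i : {T : WeightedPartition n //
        numBlocks T + q = n ∧ totalWeight T = p} × Fin (p + 1) =>
          LinearMap.range (stringMap i.1.1 i.2)) (⟨T, hL⟩, ⟨a, by omega⟩)
        (lower_pow_mem_range_stringMap hm h0 j)
    · rw [EWeighted_eq_bot (by rw [hL.2, Nat.abs_cast]; omega), Submodule.mem_bot] at hm
      rw [hm, map_zero]
      exact Submodule.zero_mem _
  have hstable : ∀ (A : SL(2, ℚ)), ∀ v ∈ R, slRep n A v ∈ R := by
    intro A v hv
    induction hv using Submodule.iSup_induction' with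
    | mem i v hv =>
      obtain ⟨x, rfl⟩ := hv
      refine Submodule.mem_iSup_of_mem i ⟨_, stringMap_boxTensor _ _ (1, A) x⟩
    | zero => simp
    | add x y _ _ hx hy => rw [map_add]; exact Submodule.add_mem _ hx hy
  rcases le_total 0 (torusWeight L) with h | h
  · exact hpos _ h
  · intro v hv
    have h1 := hstable weyl⁻¹ _ (hpos _ (neg_nonneg.2 h) (slRep_weyl_mem hv))
    rwa [← Module.End.mul_apply, ← map_mul, inv_mul_cancel, map_one, Module.End.one_apply] at h1

/-- The Weyl element of `SL_2` exchanges the weights `a` and `-a`. -/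
theorem finrank_EWeighted_neg (T : WeightedPartition n) (a : ℤ) :
    Module.finrank ℚ (EWeighted T (-a)).toSubmodule
      = Module.finrank ℚ (EWeighted T a).toSubmodule := by
  have hinj : Function.Injective (slRep n weyl) := by
    refine Function.LeftInverse.injective (g := slRep n weyl⁻¹) fun v => ?_
    rw [← Module.End.mul_apply, ← map_mul, inv_mul_cancel, map_one, Module.End.one_apply]
  have hle : ∀ b : ℤ, Module.finrank ℚ (EWeighted T b).toSubmodule
      ≤ Module.finrank ℚ (EWeighted T (-b)).toSubmodule := by
    intro b
    refine LinearMap.finrank_le_finrank_of_injective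
      (f := (slRep n weyl).restrict fun v hv => slRep_weyl_mem hv) ?_
    intro v w hvw
    exact Subtype.ext (hinj (congrArg Subtype.val hvw))
  refine le_antisymm ?_ (hle a)
  have h := hle (-a)
  rwa [neg_neg] at h

/-- If `w a` is the dimension of the space of weight `a` and `m a` that of its highest weight vectors,
then `∑ m a (a + 1)` counts the weight spaces of weights `a` and `-a`. -/
theorem sum_highest_mul {m w : ℕ → ℕ} (h : ∀ a, m a + w (a + 2) = w a) {p : ℕ}
    (hw : ∀ a, p < a → w a = 0) :
    ∑ a ∈ Finset.range (p + 1), m a * (a + 1) = w 0 + 2 * ∑ a ∈ Finset.range p, w (a + 1) := by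
  -- The sum telescopes; the two correction terms vanish for `k = p`.
  have key : ∀ k, ∑ a ∈ Finset.range (k + 1), m a * (a + 1) + k * w (k + 1) + (k + 1) * w (k + 2)
      = w 0 + 2 * ∑ a ∈ Finset.range k, w (a + 1) := by
    intro k
    induction k with
    | zero => simpa using h 0
    | succ k ih =>
      rw [Finset.sum_range_succ _ (k + 1), Finset.sum_range_succ (fun a => w (a + 1)) k]
      rw [← h (k + 1)] at ih ⊢
      linarith
  have h1 := key p
  rw [hw (p + 1) (by omega), hw (p + 2) (by omega)] at h1
  simpa using h1

theorem sum_Icc_neg (g : ℤ → ℕ) (k : ℕ) : ∑ b ∈ Finset.Icc (-(k : ℤ)) k, g b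
    = g 0 + ∑ a ∈ Finset.range k, (g (a + 1) + g (-(a + 1))) := by
  induction k with
  | zero => simp
  | succ k ih =>
    have h1 : Finset.Icc (-((k + 1 : ℕ) : ℤ)) (k + 1 : ℕ)
        = insert ((k : ℤ) + 1) (insert (-((k : ℤ) + 1)) (Finset.Icc (-(k : ℤ)) k)) := by
      ext x
      simp only [Finset.mem_Icc, Finset.mem_insert]
      omega
    rw [h1, Finset.sum_insert, Finset.sum_insert, ih, Finset.sum_range_succ]
    · ring
    · simp
    · simp only [Finset.mem_Icc, Finset.mem_insert]
      omega

/-- The dimensions of the `𝕍_a` generated by highest weight vectors add up to the dimension of the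
sum of all weight spaces. -/
theorem sum_finrank_highest (T : WeightedPartition n) {p : ℕ} (hT : totalWeight T = p) :
    ∑ a : Fin (p + 1), Module.finrank ℚ (highest T (a : ℕ)).toSubmodule * ((a : ℕ) + 1)
      = ∑ b ∈ Finset.Icc (-(p : ℤ)) p, Module.finrank ℚ (EWeighted T b).toSubmodule := by
  rw [sum_Icc_neg, Fin.sum_univ_eq_sum_range (fun a : ℕ =>
    Module.finrank ℚ (highest T (a : ℕ)).toSubmodule * (a + 1)),
    sum_highest_mul (w := fun a : ℕ => Module.finrank ℚ (EWeighted T a).toSubmodule)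
      (fun a => ?_) (fun a ha => ?_), Finset.mul_sum]
  · congr 1
    refine Finset.sum_congr rfl fun a _ => ?_
    rw [finrank_EWeighted_neg, two_mul]
    rfl
  · exact (isWeightFamily_EWeighted T).finrank_ker_add (Int.natCast_nonneg a)
  · rw [EWeighted_eq_bot (by rw [hT, Nat.abs_cast]; omega), finrank_bot]

theorem surjective_toWeighted (n : ℕ) :
    Function.Surjective (toWeighted : LabelledPartition n → WeightedPartition n) := by
  intro T
  let r : Fin 3 → Label := ![.one, .x, .xy]
  have hr : ∀ d, (r d).deg = d := by decide
  refine ⟨⟨T.blocks.map fun b => (b.1, r b.2), ?_, ?_⟩, ?_⟩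
  · intro b hb
    obtain ⟨c, hc, rfl⟩ := Multiset.mem_map.1 hb
    exact T.pos c hc
  · rw [Multiset.map_map]
    exact T.sum_eq
  · ext1
    simp [toWeighted, Multiset.map_map, hr]

instance (n : ℕ) : Fintype (WeightedPartition n) :=
  @Fintype.ofFinite _ (Finite.of_surjective _ (surjective_toWeighted n))

variable {ζ : ∀ k : ℕ, AddChar (ZMod k) ℂ}

/-- The homogeneous component is the direct sum of the weight spaces `E(λ,t,b)`, `|b| ≤ p`, in it.
-/
theorem finrank_E2 (hζ : ∀ k : ℕ, 0 < k → Function.Injective (ζ k)) (p q : ℕ) :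
    Module.finrank ℚ (E2 n p q).toSubmodule
      = ∑ T : {T : WeightedPartition n // numBlocks T + q = n ∧ totalWeight T = p},
        ∑ b ∈ Finset.Icc (-(p : ℤ)) p, Module.finrank ℚ (EWeighted T.1 b).toSubmodule := by
  classical
  have hind : iSupIndep fun L : {L : LabelledPartition n // numBlocks (toWeighted L) + q = n ∧
      totalWeight (toWeighted L) = p} => (ELabelled L.1).toSubmodule :=
    (iSupIndep_ELabelled hζ).comp Subtype.val_injective
  have h1 : (E2 n p q).toSubmodule = ⨆ L : {L : LabelledPartition n //
      numBlocks (toWeighted L) + q = n ∧ totalWeight (toWeighted L) = p},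
        (ELabelled L.1).toSubmodule := by rw [E2_eq_iSup, iSup_subtype']
  rw [h1, finrank_iSup_of_iSupIndep hind]
  simp only [finrank_EWeighted_eq_sum hζ]
  have h2 : ∀ (T : WeightedPartition n) (b : ℤ),
      ∑ L : Labellings T b, Module.finrank ℚ (ELabelled L.1).toSubmodule
        = ∑ L : LabelledPartition n with toWeighted L = T ∧ torusWeight L = b,
          Module.finrank ℚ (ELabelled L).toSubmodule := by
    intro T b
    rw [Finset.sum_subtype (p := fun L => L ∈ Labellings T b) _ (by simp [Labellings])]
  simp only [h2]
  rw [← Finset.sum_subtype (f := fun L => Module.finrank ℚ (ELabelled L).toSubmodule)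
      (Finset.univ.filter fun L : LabelledPartition n => numBlocks (toWeighted L) + q = n ∧
        totalWeight (toWeighted L) = p) (by simp),
    ← Finset.sum_subtype (f := fun T : WeightedPartition n => ∑ b ∈ Finset.Icc (-(p : ℤ)) p,
        ∑ L : LabelledPartition n with toWeighted L = T ∧ torusWeight L = b,
          Module.finrank ℚ (ELabelled L).toSubmodule)
      (Finset.univ.filter fun T : WeightedPartition n => numBlocks T + q = n ∧
        totalWeight T = p) (by simp), ← Finset.sum_product',
    ← Finset.sum_fiberwise_of_maps_to (g := fun L => (toWeighted L, torusWeight L))]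
  · refine Finset.sum_congr rfl fun Tb hTb => ?_
    rw [Finset.mem_product, Finset.mem_filter] at hTb
    refine Finset.sum_congr ?_ fun _ _ => rfl
    ext L
    simp only [Finset.mem_filter, Finset.mem_univ, true_and, Prod.ext_iff]
    constructor
    · exact fun h => h.2
    · exact fun h => ⟨by rw [h.1]; exact hTb.1.2, h⟩
  · intro L hL
    rw [Finset.mem_filter] at hL
    rw [Finset.mem_product, Finset.mem_filter]
    refine ⟨⟨Finset.mem_univ _, hL.2⟩, ?_⟩
    have h := abs_torusWeight_le L
    rw [hL.2.2] at h
    exact Finset.mem_Icc.2 (abs_le.1 h)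

end

/-! ### The homogeneous components as representations of `S_n × SL_2(ℚ)` -/

/-- Maps from the summands of a direct sum that exhaust a subrepresentation of at least the
dimension of the direct sum define an isomorphism. -/
theorem nonempty_equiv_directSum {K G I U : Type*} [Field K] [Group G] [Fintype I]
    {X : I → Type*} [∀ i, AddCommGroup (X i)] [∀ i, Module K (X i)] [∀ i, Module.Finite K (X i)]
    [AddCommGroup U] [Module K U] {ρ : ∀ i, Representation K G (X i)} {τ : Representation K G U}
    {S : Subrepresentation τ} (f : ∀ i, X i →ₗ[K] U) (hf : ∀ i g x, f i (ρ i g x) = τ g (f i x))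
    (hrange : ⨆ i, LinearMap.range (f i) = S.toSubmodule)
    (hrank : ∑ i, Module.finrank K (X i) ≤ Module.finrank K S.toSubmodule) :
    Nonempty (S.toRepresentation.Equiv (Representation.directSum ρ)) := by
  classical
  let Φ : (⨁ i, X i) →ₗ[K] U := DirectSum.toModule K _ _ f
  have hΦ : LinearMap.range Φ = S.toSubmodule := by rw [range_toModule, hrange]
  have hinj : Function.Injective Φ := by
    have h := LinearMap.finrank_range_add_finrank_ker Φ
    rw [hΦ, Module.finrank_directSum] at h
    exact LinearMap.ker_eq_bot.1 (Submodule.finrank_eq_zero.1 (by omega))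
  refine nonempty_equiv_of_range_eq (fun g => τ g) S.toSubmodule.injective_subtype
    hinj (fun g x => rfl) (fun g x => ?_) (by rw [hΦ, Submodule.range_subtype])
  have h : Φ ∘ₗ Representation.directSum ρ g = τ g ∘ₗ Φ := by
    refine DirectSum.linearMap_ext K fun i => LinearMap.ext fun x => ?_
    have h1 : Representation.directSum ρ g (DirectSum.lof K _ X i x)
        = DirectSum.lof K _ X i (ρ i g x) := DirectSum.lmap_lof _ _ _
    have h2 : ∀ y, Φ (DirectSum.lof K _ X i y) = f i y := fun y => DirectSum.toModule_lof _ _ _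
    simp only [LinearMap.comp_apply]
    rw [h1, h2, h2, hf]
  exact LinearMap.congr_fun h x

theorem nonempty_E2_equiv {n : ℕ} {ζ : ∀ k : ℕ, AddChar (ZMod k) ℂ}
    (hζ : ∀ k : ℕ, 0 < k → Function.Injective (ζ k)) (p q : ℕ) :
    Nonempty ((E2 n p q).toRepresentation.Equiv (Representation.directSum
      fun i : {T : WeightedPartition n // numBlocks T + q = n ∧ totalWeight T = p} × Fin (p + 1) =>
        boxTensor (highest i.1.1 (i.2 : ℕ)).toRepresentation (V i.2).toRepresentation)) := by
  refine nonempty_equiv_directSum (fun i => stringMap i.1.1 i.2)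
    (fun i g x => stringMap_boxTensor _ _ g x) (iSup_range_stringMap n p q) ?_
  rw [finrank_E2 hζ, Fintype.sum_prod_type]
  refine Finset.sum_le_sum fun T _ => ?_
  rw [← sum_finrank_highest T.1 T.2.2]
  refine Finset.sum_le_sum fun a _ => ?_
  rw [Module.finrank_tensorProduct]
  exact Nat.mul_le_mul_left _ (finrank_V_le _)

/-! ### The representations that occur -/

section

variable {n : ℕ}

theorem polyRep_torus (i j : ℕ) :
    polyRep torus (binaryMonomial i j) = ((2 : ℚ) ^ i * 2⁻¹ ^ j) • binaryMonomial i j := by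
  rw [binaryMonomial, polyRep]
  simp only [torus, MonoidHom.coe_mk, OneHom.coe_mk, AlgHom.toLinearMap_apply, map_mul, map_pow,
    MvPolynomial.aeval_X, Fin.sum_univ_two, Matrix.of_apply, Matrix.cons_val', Matrix.cons_val_zero,
    Matrix.cons_val_one, Matrix.cons_val_fin_one, zero_smul, add_zero, zero_add, smul_pow,
    smul_mul_smul_comm]

/-- A nonzero map of representations does not vanish on `X_0^a`, since this form generates `𝕍_a`. -/
theorem apply_highest_ne_zero {a : ℕ} {U : Type*} [AddCommGroup U] [Module ℚ U]
    {ρ : Representation ℚ SL(2, ℚ) U} (f : (V a).toRepresentation.IntertwiningMap ρ) (hf : f ≠ 0) :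
    f ⟨binaryMonomial a 0, binaryMonomial_mem_V (a := a) (Nat.zero_le a)⟩ ≠ 0 := by
  intro h0
  apply hf
  let b : ℕ → (V a).toSubmodule := fun i =>
    if h : i ≤ a then ⟨binaryMonomial (a - i) i, binaryMonomial_mem_V h⟩ else 0
  have hb : ∀ i ≤ a, (b i : MvPolynomial (Fin 2) ℚ) = binaryMonomial (a - i) i := by
    intro i hi
    simp [b, hi]
  -- The translates of `X_0^a` by the lower triangular matrices are polynomials in `t` with values
  -- in `𝕍_a`, whose coefficients are multiples of all the monomials.
  have h1 : ∀ t : ℚ, ∑ j ∈ Finset.range (a + 1), (t ^ j * a.choose j) • f (b j) = 0 := by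
    intro t
    have h2 : (V a).toRepresentation (lowerUnip t) (b 0)
        = ∑ j ∈ Finset.range (a + 1), (t ^ j * a.choose j) • b j := by
      apply Subtype.ext
      change polyRep (lowerUnip t) (b 0).1 = (V a).toSubmodule.subtype _
      rw [hb 0 (Nat.zero_le a), Nat.sub_zero, polyRep_lowerUnip, map_sum]
      refine Finset.sum_congr rfl fun j hj => ?_
      rw [map_smul, Submodule.subtype_apply, hb j (by have := Finset.mem_range.1 hj; omega),
        zero_add]
    have h3 := congrArg f h2
    have h4 : b 0 = ⟨binaryMonomial a 0, binaryMonomial_mem_V (a := a) (Nat.zero_le a)⟩ :=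
      Subtype.ext (hb 0 (Nat.zero_le a))
    rw [f.isIntertwining, h4, h0, map_zero, map_sum] at h3
    simpa using h3.symm
  have h2 : ∀ j ≤ a, f (b j) = 0 := by
    intro j hj
    rw [← Module.forall_dual_apply_eq_zero_iff ℚ]
    intro φ
    have h3 : (∑ j ∈ Finset.range (a + 1),
        Polynomial.monomial j ((a.choose j : ℚ) * φ (f (b j)))) = 0 := by
      refine Polynomial.funext fun t => ?_
      have h4 := congrArg φ (h1 t)
      rw [map_sum, map_zero] at h4
      rw [Polynomial.eval_finsetSum, Polynomial.eval_zero, ← h4]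
      refine Finset.sum_congr rfl fun i _ => ?_
      rw [Polynomial.eval_monomial, map_smul, smul_eq_mul]
      ring
    have h4 := congrArg (fun P => Polynomial.coeff P j) h3
    simp only [Polynomial.finsetSum_coeff, Polynomial.coeff_monomial, Polynomial.coeff_zero] at h4
    rw [Finset.sum_ite_eq' , if_pos (Finset.mem_range.2 (by omega))] at h4
    exact (mul_eq_zero.1 h4).resolve_left (by exact_mod_cast (Nat.choose_pos hj).ne')
  refine Representation.IntertwiningMap.ext (LinearMap.ext fun P => ?_)
  obtain ⟨P, hP⟩ := P
  have h3 : P ∈ (LinearMap.ker f.toLinearMap).map (V a).toSubmodule.subtype := by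
    rw [V_eq_span] at hP
    refine Submodule.span_le.2 ?_ hP
    rintro _ ⟨i, rfl⟩
    exact ⟨b i, h2 i (by omega), hb i (by omega)⟩
  obtain ⟨Q, hQ, hQP⟩ := h3
  have h4 : Q = ⟨P, hP⟩ := Subtype.ext hQP
  rw [← h4]
  exact hQ

/-- An eigenvalue on a sum of spaces on which an operator acts by scalars is one of these scalars. -/
theorem exists_eq_of_mem_iSup {K I U : Type*} [Field K] [AddCommGroup U] [Module K U]
    {A : I → Submodule K U} {φ : Module.End K U} {c : I → K} (hφ : ∀ i, ∀ v ∈ A i, φ v = c i • v)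
    {v : U} (hv : v ∈ ⨆ i, A i) (h0 : v ≠ 0) {r : K} (hr : φ v = r • v) : ∃ i, c i = r := by
  by_contra! h
  have h1 : ⨆ i, A i ≤ ⨆ s, ⨆ _ : s ≠ r, φ.eigenspace s := iSup_le fun i =>
    le_iSup₂_of_le (f := fun s (_ : s ≠ r) => φ.eigenspace s) (c i) (h i)
      fun w hw => Module.End.mem_eigenspace_iff.2 (hφ i w hw)
  exact h0 ((Submodule.mem_bot K).1 ((φ.eigenspaces_iSupIndep r).le_bot
    ⟨Module.End.mem_eigenspace_iff.2 hr, h1 hv⟩))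

/-- If `𝕍_a` occurs in the component of bidegree `(p,q)`, then a space `E(λ,s)` in it has
weight `a`. -/
theorem Occurs.exists_torusWeight_eq {a p q : ℕ} (h : Occurs a (E2 n p q).toSubmodule) :
    ∃ L : LabelledPartition n, (numBlocks (toWeighted L) + q = n ∧
      totalWeight (toWeighted L) = p) ∧ torusWeight L = a := by
  obtain ⟨f, hf, hmem⟩ := h
  have hv := apply_highest_ne_zero f hf
  set m : (V a).toSubmodule :=
    ⟨binaryMonomial a 0, binaryMonomial_mem_V (a := a) (Nat.zero_le a)⟩ with hm
  have htorus : slRep n torus (f m) = (2 : ℚ) ^ (a : ℤ) • f m := by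
    have h1 : (V a).toRepresentation torus m = (2 : ℚ) ^ (a : ℤ) • m := by
      apply Subtype.ext
      change polyRep torus (binaryMonomial a 0) = (2 : ℚ) ^ (a : ℤ) • binaryMonomial a 0
      rw [polyRep_torus]
      simp
    rw [← f.isIntertwining, h1, ← f.toLinearMap_apply, map_smul, f.toLinearMap_apply]
  have hfm := hmem m
  rw [E2_eq_iSup, iSup_subtype'] at hfm
  obtain ⟨L, hL⟩ := exists_eq_of_mem_iSup (c := fun L : {L : LabelledPartition n //
    numBlocks (toWeighted L) + q = n ∧ totalWeight (toWeighted L) = p} => (2 : ℚ) ^ torusWeight L.1)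
    (fun L v hv => slRep_torus_of_mem hv) hfm hv htorus
  exact ⟨L.1, L.2, zpow_right_injective₀ (by norm_num) (by norm_num) hL⟩

/-- The monomials of `E(λ,s)` bound the weight by the number of the labels: a block contributes at
most `2` to the sum of the degree and the absolute value of the weight. -/
theorem Occurs.bounds {a p q : ℕ} (hn : 1 ≤ n) (h : Occurs a (E2 n p q).toSubmodule) :
    a ≤ p ∧ p + 2 * q + a ≤ 2 * n ∧ q + 1 ≤ n := by
  obtain ⟨L, ⟨h1, h2⟩, h3⟩ := h.exists_torusWeight_eq
  have h4 := abs_torusWeight_le L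
  have h5 := totalWeight_add_torusWeight_le L
  rw [h2, h3, Nat.abs_cast] at h4 h5
  have h6 : numBlocks (toWeighted L) ≠ 0 := by
    intro h
    have h7 := (toWeighted L).sum_eq
    rw [Multiset.card_eq_zero.1 h, Multiset.map_zero, Multiset.sum_zero] at h7
    omega
  omega

/-- The value on the generators of the odd derivation that contracts with the `d`-th element of the
dual basis of `H^1(E)`. -/
def contraction (d : Fin 2) : Gen n → ℚ
  | .cls c _ => if c = d then 1 else 0
  | .edge _ _ => 0

/-- An odd derivation `ι` is encoded by the homomorphism to the triangular matrices with the entries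
`a`, `ι a` and the image of `a` under the parity automorphism. -/
theorem isE2Family_contraction (d : Fin 2) : IsE2Family fun g : Gen n =>
    (!![cl g, algebraMap ℚ (E2Alg n) (contraction d g); 0, -cl g] :
      Matrix (Fin 2) (Fin 2) (E2Alg n)) :=
  isE2Family_cl.extend _ (fun _ => rfl) (fun _ _ => rfl)
    (fun _ _ _ => by simp [contraction]) (fun _ _ _ => by simp [contraction])

theorem lift_contraction_apply (d : Fin 2) (a : E2Alg n) :
    (isE2Family_contraction d).lift a 0 0 = a ∧ (isE2Family_contraction d).lift a 1 0 = 0 := by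
  induction a using E2Alg.induction with
  | algebraMap r => simp [Matrix.algebraMap_matrix_apply]
  | cl g => simp
  | mul a b ha hb =>
    simp [Matrix.mul_apply, Fin.sum_univ_two, ha.1, ha.2, hb.1, hb.2]
  | add a b ha hb => simp [ha.1, ha.2, hb.1, hb.2]

theorem lift_contraction_mul (d : Fin 2) (a b : E2Alg n) :
    (isE2Family_contraction d).lift (a * b) 0 1 = a * (isE2Family_contraction d).lift b 0 1
      + (isE2Family_contraction d).lift a 0 1 * (isE2Family_contraction d).lift b 1 1 := by
  rw [map_mul, Matrix.mul_apply, Fin.sum_univ_two, (lift_contraction_apply d a).1]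

/-- The contractions vanish on the subalgebra generated by the differences and the `ω_{i,j}`. -/
theorem lift_contraction_eq_zero (d : Fin 2) {p q : ℕ} {a : E2Alg n} (ha : a ∈ E2Quot n p q) :
    (isE2Family_contraction d).lift a 0 1 = 0 := by
  let S : Submodule ℚ (E2Alg n) := LinearMap.ker
    ((Matrix.entryLinearMap ℚ (E2Alg n) 0 1) ∘ₗ (isE2Family_contraction d).lift.toLinearMap)
  have hS : ∀ a, a ∈ S ↔ (isE2Family_contraction d).lift a 0 1 = 0 := fun a => LinearMap.mem_ker
  have hone : (1 : E2Alg n) ∈ S := by rw [hS, map_one, Matrix.one_apply_ne zero_ne_one]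
  have hmul : S * S ≤ S := Submodule.mul_le.2 fun a ha b hb => by
    rw [hS] at ha hb ⊢
    rw [lift_contraction_mul, ha, hb, mul_zero, zero_mul, add_zero]
  have hpow : ∀ (R : Submodule ℚ (E2Alg n)) (k : ℕ), R ≤ S → R ^ k ≤ S := by
    intro R k hR
    induction k with
    | zero => rw [pow_zero]; exact Submodule.one_le.2 hone
    | succ k ih => rw [pow_succ]; exact (mul_le_mul' ih hR).trans hmul
  have hdiff : diffSpan n ≤ S := by
    rw [diffSpan, Submodule.span_le]
    rintro _ ⟨c, i, j, rfl⟩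
    rw [SetLike.mem_coe, hS, map_sub, IsE2Family.lift_cl, IsE2Family.lift_cl]
    simp [contraction]
  have hedge : edgeSpan n ≤ S := by
    rw [edgeSpan, Submodule.span_le]
    rintro _ ⟨i, j, rfl⟩
    rw [SetLike.mem_coe, hS, IsE2Family.lift_cl]
    simp [contraction]
  exact (hS a).1 (((mul_le_mul' (hpow _ p hdiff) (hpow _ q hedge)).trans hmul) ha)

/-- The multiplication by `x_i y_i` is injective on the subalgebra generated by the differences and
the `ω_{i,j}`. -/
theorem eq_zero_of_mul_labelClass_xy {p q : ℕ} {a : E2Alg n} (ha : a ∈ E2Quot n p q) (i : Fin n)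
    (h : a * labelClass .xy i = 0) : a = 0 := by
  have h1 : a * cl (.cls 1 i) = 0 := by
    have h2 := congrArg (fun b => (isE2Family_contraction 0).lift b 0 1) h
    simp only [lift_contraction_mul, labelClass, lift_contraction_eq_zero 0 ha, map_zero,
      IsE2Family.lift_cl] at h2
    simpa [contraction] using h2
  have h2 := congrArg (fun b => (isE2Family_contraction 1).lift b 0 1) h1
  simp only [lift_contraction_mul, lift_contraction_eq_zero 1 ha, map_zero,
    IsE2Family.lift_cl] at h2
  simpa [contraction] using h2

theorem mul_labelClass_xy_comm (a : E2Alg n) (i : Fin n) :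
    a * labelClass .xy i = labelClass .xy i * a := by
  induction a using E2Alg.induction with
  | algebraMap r => exact Algebra.commutes _ _
  | cl g =>
    rw [labelClass, ← mul_assoc, cl_anticomm g, neg_mul, mul_assoc, cl_anticomm g, mul_neg,
      neg_neg, mul_assoc]
  | mul a b ha hb => rw [mul_assoc, hb, ← mul_assoc, ha, mul_assoc]
  | add a b ha hb => rw [add_mul, ha, hb, mul_add]

/-- The group `SL_2` acts on `x_i y_i` by the determinant. -/
theorem slRep_labelClass_xy (A : SL(2, ℚ)) (i : Fin n) :
    slRep n A (labelClass .xy i) = labelClass .xy i := by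
  have key : ∀ (a b c d : ℚ) (u v : E2Alg n), u * u = 0 → v * v = 0 → v * u = -(u * v) →
      (a • u + c • v) * (b • u + d • v) = (a * d - b * c) • (u * v) := by
    intro a b c d u v h1 h2 h3
    simp only [add_mul, mul_add, smul_mul_smul_comm, h1, h2, h3]
    module
  have hdet := A.det_coe
  rw [Matrix.det_fin_two] at hdet
  rw [labelClass, slRep_mul, slRep_cl, slRep_cl]
  simp only [genAct, Fin.sum_univ_two, Equiv.Perm.one_apply]
  rw [key _ _ _ _ _ _ (cl_mul_self _) (cl_mul_self _) (cl_anticomm _ _), hdet, one_smul]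

theorem diffSpan_le_clsSpan (n : ℕ) : diffSpan n ≤ clsSpan n := by
  rw [diffSpan, Submodule.span_le]
  rintro _ ⟨c, i, j, rfl⟩
  exact Submodule.sub_mem _ (Submodule.subset_span ⟨c, i, rfl⟩)
    (Submodule.subset_span ⟨c, j, rfl⟩)

/-- Multiplication by the invariant `x_i y_i` turns occurrences in the component of the quotient by
the translations into occurrences in `E_2^{p+2,q}`. -/
theorem Occurs.mul_labelClass_xy {a p q : ℕ} (i : Fin n) (h : Occurs a (E2Quot n p q)) :
    Occurs a (E2 n (p + 2) q).toSubmodule := by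
  obtain ⟨f, hf, hmem⟩ := h
  refine ⟨⟨LinearMap.mulRight ℚ (labelClass .xy i) ∘ₗ f.toLinearMap, fun A => ?_⟩, ?_, ?_⟩
  · refine LinearMap.ext fun v => ?_
    change f ((V a).toRepresentation A v) * labelClass .xy i
      = slRep n A (f v * labelClass .xy i)
    rw [slRep_mul, slRep_labelClass_xy, f.isIntertwining]
  · intro h0
    apply hf
    refine Representation.IntertwiningMap.ext (LinearMap.ext fun v => ?_)
    have h1 := LinearMap.congr_fun (congrArg Representation.IntertwiningMap.toLinearMap h0) v
    exact eq_zero_of_mul_labelClass_xy (hmem v) i h1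
  · intro v
    change f v * labelClass .xy i ∈ clsSpan n ^ (p + 2) * edgeSpan n ^ q
    rw [mul_labelClass_xy_comm, add_comm, pow_add, mul_assoc]
    exact Submodule.mul_mem_mul (labelClass_mem .xy i)
      (mul_le_mul' (pow_le_pow_left' (diffSpan_le_clsSpan n) p) le_rfl (hmem v))

theorem Occurs.of_E2Quot {a p q : ℕ} (h : Occurs a (E2Quot n p q)) :
    Occurs a (E2 n p q).toSubmodule := by
  obtain ⟨f, hf, hmem⟩ := h
  refine ⟨f, hf, fun v => ?_⟩
  exact mul_le_mul' (pow_le_pow_left' (diffSpan_le_clsSpan n) p) le_rfl (hmem v)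

end

end BraidElliptic

end

open BraidElliptic in
theorem mainTheorem11 (n : ℕ) (hn : 1 ≤ n)
    (ζ : ∀ k : ℕ, AddChar (ZMod k) ℂ) (hζ : ∀ k : ℕ, 0 < k → Function.Injective (ζ k))
    (e : ∀ L : LabelledPartition n, Points L ≃ Fin n) :
    (∃ M : WeightedPartition n → ℕ → Rep.{0} ℚ (Equiv.Perm (Fin n)),
      (∀ (T : WeightedPartition n) (a : ℕ),
        Nonempty (((M T a).ρ.prod (EWeighted T (a + 2)).toRepresentation).Equiv
          (EWeighted T a).toRepresentation)) ∧
      ∀ p q : ℕ, Nonempty ((E2 n p q).toRepresentation.Equiv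
        (Representation.directSum
          fun i : {T : WeightedPartition n // numBlocks T + q = n ∧ totalWeight T = p}
              × Fin (p + 1) =>
            boxTensor (M i.1.1 i.2).ρ (V i.2).toRepresentation))) ∧
    (∀ (T : WeightedPartition n) (a : ℤ),
      Nonempty ((complexify (EWeighted T a).toRepresentation).Equiv
        ((sgnRep n).tprod
          (Representation.directSum fun L : Labellings T a => indXi ζ L.1 (e L.1))))) ∧
    (∀ p q a : ℕ, Occurs a (E2 n p q).toSubmodule →
      a ≤ p ∧ p + 2 * q + a ≤ 2 * n ∧ q + 1 ≤ n) ∧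
    (∀ p q a : ℕ, Occurs a (E2Quot n p q) → a ≤ p ∧ p + 2 * q + a + 2 ≤ 2 * n) := by
  refine ⟨⟨fun T a => Rep.of (highest T a).toRepresentation,
    fun T a => nonempty_highest_prod_equiv T (Int.natCast_nonneg a), nonempty_E2_equiv hζ⟩,
    nonempty_complexify_equiv hζ e, fun p q a h => h.bounds hn, fun p q a h => ?_⟩
  have h1 := h.of_E2Quot.bounds hn
  have h2 := (h.mul_labelClass_xy ⟨0, hn⟩).bounds hn
  omega
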